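/- Let $\mathbb T$ be an arbitrary dependent type theory whose rules include the structural rules (variables, weakening, substitution, equivalence-relation and conversion rules for definitional equality, compatibility of substitution with definitional equality) and the rules for identity types $\mathrm{Id}_A(a,b)$ with reflexivity elements $\mathrm r(a)$ and eliminator $\mathrm J$, where elimination is allowed in the presence of an arbitrary parameter context $\Theta(x,y,u)$. Let $\mathcal C(\mathbb T)$ be its classifying category: objects are contexts and maps are context morphisms, both up to definitional equality. For a context $\Phi$ let $\mathrm{Id}_\Phi(a,b)$ be the identity context, defined by induction on the length: it is empty for the empty context, and for $\Phi'=(x\in\Phi,\,x'\in A(x))$ it is $$\mathrm{Id}_{\Phi'}((a,a'),(b,b'))=\bigl(u\in\mathrm{Id}_\Phi(a,b),\ u'\in\mathrm{Id}_{A(b)}(u_!(a'),b')\bigr),$$ where $u_!$ is transport along $u$, defined by elimination on $u$ (the reflexivity elements $1_a=\mathrm r(a)\in\mathrm{Id}_\Phi(a,a)$ and the elimination operation for $\Phi'$ being obtained inductively from those for $\Phi$ and for $A(x)$). Let $\mathcal F(\Phi)$ have as objects the global elements of $\Phi$ and as maps $a\to b$ the classes $[p]$ of global elements $p\in\mathrm{Id}_\Phi(a,b)$,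 where $p,q$ are identified if $\mathrm{Id}_{\mathrm{Id}_\Phi(a,b)}(p,q)$ has a global element; identities, composites and inverses are $[1_a]$, $[q]\circ[p]=[q_!(p)]$ and $[p]^{-1}=[\mathrm J(a,b,p,[x]1_x)]$, and a context morphism $f:\Phi\to\Psi$ acts by $a\mapsto f(a)$, $[p]\mapsto[\mathrm J(a,b,p,[x]1_{f(x)})]$. These data are well defined, make every $\mathcal F(\Phi)$ a groupoid, and give a functor $\mathcal F:\mathcal C(\mathbb T)\to\mathbf{Gpd}$. For every context morphism $f:\Phi\to\Psi$, $$\mathrm{Id}(f)=\bigl(x\in\Phi,\ y\in\Psi,\ u\in\mathrm{Id}_\Psi(f(x),y)\bigr)$$ is a context, $i_f=(x,f(x),1_{f(x)}):\Phi\to\mathrm{Id}(f)$ and $p_f=(y):\mathrm{Id}(f)\to\Psi$ are context morphisms with $p_f\circ i_f=f$, and there is an equivalence of groupoids $$\sigma_f:\mathcal F(\mathrm{Id}(f))\to\mathrm{Path}(\mathcal F(f)),$$ surjective on objects, such that $\sigma_f\circ\mathcal F(i_f)=i_{\mathcal F(f)}$ and $p_{\mathcal F(f)}\circ\sigma_f=\mathcal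 F(p_f)$ (equalities of functors). Here, for a functor $F:A\to B$ of groupoids, $\mathrm{Path}(F)$ is the groupoid of triples $(a,b,\beta:F(a)\to b)$, whose maps are the pairs of maps of $A$ and $B$ making the evident square commute, with $i_F(a)=(a,F(a),1)$ and $p_F(a,b,\beta)=b$. As a special case, for every context $\Phi$ there is an equivalence, surjective on objects, $$\sigma:\mathcal F(x\in\Phi,\ y\in\Phi,\ u\in\mathrm{Id}_\Phi(x,y))\to\mathcal F(\Phi)^{\mathbf J},$$ where $\mathbf J$ is the groupoid with two objects and an isomorphism between them; moreover $\sigma\circ\mathcal F(x,x,1_x)$ is the diagonal (constant) functor, and $\sigma$ followed by evaluation at the target is $\mathcal F(y)$. -/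

import Mathlib

open CategoryTheory

universe u

/-! ## Raw syntax

Expressions are written with de Bruijn indices: `var 0` is the most recently declared variable.
Contexts, dependent contexts and sequences of terms are lists whose head is the most recent entry,
so that `Ψ ++ Γ` is the context `(Γ, Ψ)`. Renaming of variables is thereby built in. -/

/-- The symbols of a type theory other than those for identity types (type formers and term formers
alike). The list `arity o` has one entry for each argument of `o`: the number of variables which
are bound in that argument. -/
structure Signature where
  Op : Type u
  arity : Op → List ℕ

/-- Raw expressions. In `J k A Θ C d a b p t`, the parameter context `Θ` has length `k`; its entry
`Θ i` binds `x, y, u` and the earlier variables of `Θ`, the type `C` binds `x, y, u` and all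
variables of `Θ`, and the term `d` binds `x` and all variables of `Θ`. The terms `t` are
substituted for the variables of `Θ(a, b, p)`. -/
inductive Expr (S : Signature.{u}) : Type u
  | var (i : ℕ) : Expr S
  | op (o : S.Op) (args : Fin (S.arity o).length → Expr S) : Expr S
  | Id (A a b : Expr S) : Expr S
  | refl (a : Expr S) : Expr S
  | J (k : ℕ) (A : Expr S) (Θ : Fin k → Expr S) (C d a b p : Expr S) (t : Fin k → Expr S) : Expr S

namespace Expr

variable {S : Signature.{u}}

/-- Extension of a renaming under `n` binders. -/
def upR (n : ℕ) (ρ : ℕ → ℕ) : ℕ → ℕ := fun i => if i < n then i else ρ (i - n) + n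

def rename : (ℕ → ℕ) → Expr S → Expr S
  | ρ, var i => var (ρ i)
  | ρ, op o args => op o fun j => (args j).rename (upR ((S.arity o).get j) ρ)
  | ρ, Id A a b => Id (A.rename ρ) (a.rename ρ) (b.rename ρ)
  | ρ, refl a => refl (a.rename ρ)
  | ρ, J k A Θ C d a b p t =>
      J k (A.rename ρ) (fun i => (Θ i).rename (upR (3 + (k - 1 - i)) ρ)) (C.rename (upR (3 + k) ρ))
        (d.rename (upR (1 + k) ρ)) (a.rename ρ) (b.rename ρ) (p.rename ρ) fun i => (t i).rename ρ

/-- Weakening by `n` variables. -/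
abbrev wk (n : ℕ) (e : Expr S) : Expr S := e.rename (· + n)

/-- Extension of a substitution under `n` binders. -/
def up (n : ℕ) (σ : ℕ → Expr S) : ℕ → Expr S :=
  fun i => if i < n then var i else (σ (i - n)).wk n

/-- Simultaneous capture-avoiding substitution. -/
def subst : (ℕ → Expr S) → Expr S → Expr S
  | σ, var i => σ i
  | σ, op o args => op o fun j => (args j).subst (up ((S.arity o).get j) σ)
  | σ, Id A a b => Id (A.subst σ) (a.subst σ) (b.subst σ)
  | σ, refl a => refl (a.subst σ)
  | σ, J k A Θ C d a b p t =>
      J k (A.subst σ) (fun i => (Θ i).subst (up (3 + (k - 1 - i)) σ)) (C.subst (up (3 + k) σ))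
        (d.subst (up (1 + k) σ)) (a.subst σ) (b.subst σ) (p.subst σ) fun i => (t i).subst σ

/-- All free variables of the expression have index less than `n`. -/
def Scoped : ℕ → Expr S → Prop
  | n, var i => i < n
  | n, op o args => ∀ j, (args j).Scoped (n + (S.arity o).get j)
  | n, Id A a b => A.Scoped n ∧ a.Scoped n ∧ b.Scoped n
  | n, refl a => a.Scoped n
  | n, J k A Θ C d a b p t =>
      A.Scoped n ∧ (∀ i : Fin k, (Θ i).Scoped (n + (3 + (k - 1 - i)))) ∧ C.Scoped (n + (3 + k)) ∧
        d.Scoped (n + (1 + k)) ∧ a.Scoped n ∧ b.Scoped n ∧ p.Scoped n ∧ ∀ i, (t i).Scoped n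

/-- The substitution which replaces the most recent variables by the entries of `s` and the other
variables according to `σ`. -/
def push (s : List (Expr S)) (σ : ℕ → Expr S) : ℕ → Expr S :=
  fun i => s.getD i (σ (i - s.length))

/-- Substitution in a dependent context: an entry with `n` entries after it in the list is under
`n` binders. -/
def tsubst (σ : ℕ → Expr S) : List (Expr S) → List (Expr S)
  | [] => []
  | A :: Θ => A.subst (up Θ.length σ) :: tsubst σ Θ

/-- Renaming in a dependent context. -/
def trename (ρ : ℕ → ℕ) : List (Expr S) → List (Expr S)
  | [] => []
  | A :: Θ => A.rename (upR Θ.length ρ) :: trename ρ Θ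

/-- The sequence of `k` consecutive variables of which the most recent one is `var m`. -/
def vars (k m : ℕ) : List (Expr S) := (List.range k).map fun j => var (m + j)

/-! ### Substitution calculus -/

theorem rename_eq_subst (e : Expr S) : ∀ ρ : ℕ → ℕ, e.rename ρ = e.subst (fun i => var (ρ i)) := by
  have hup : ∀ (n : ℕ) (ρ : ℕ → ℕ),
      up n (fun i => (var (ρ i) : Expr S)) = fun i => var (upR n ρ i) := by
    intro n ρ; funext i; simp only [up, upR]; split <;> simp [wk, rename]
  induction e with
  | var i => intro ρ; rfl
  | op o args ih => intro ρ; simp only [rename, subst, hup, ih]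
  | Id A a b h1 h2 h3 => intro ρ; simp only [rename, subst, h1, h2, h3]
  | refl a h => intro ρ; simp only [rename, subst, h]
  | J k A Θ C d a b p t h1 h2 h3 h4 h5 h6 h7 h8 =>
    intro ρ; simp only [rename, subst, hup, h1, h2, h3, h4, h5, h6, h7, h8]

theorem subst_rename (e : Expr S) : ∀ (ρ : ℕ → ℕ) (σ : ℕ → Expr S),
    (e.rename ρ).subst σ = e.subst (fun i => σ (ρ i)) := by
  have hup : ∀ (n : ℕ) (ρ : ℕ → ℕ) (σ : ℕ → Expr S),
      (fun i => up n σ (upR n ρ i)) = up n (fun i => σ (ρ i)) := by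
    intro n ρ σ; funext i; simp only [up, upR]; split <;> simp
  induction e with
  | var i => intros; rfl
  | op o args ih => intros; simp only [rename, subst, hup, ih]
  | Id A a b h1 h2 h3 => intros; simp only [rename, subst, h1, h2, h3]
  | refl a h => intros; simp only [rename, subst, h]
  | J k A Θ C d a b p t h1 h2 h3 h4 h5 h6 h7 h8 =>
    intros; simp only [rename, subst, hup, h1, h2, h3, h4, h5, h6, h7, h8]

theorem rename_subst (e : Expr S) : ∀ (σ : ℕ → Expr S) (ρ : ℕ → ℕ),
    (e.subst σ).rename ρ = e.subst (fun i => (σ i).rename ρ) := by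
  have hup : ∀ (n : ℕ) (σ : ℕ → Expr S) (ρ : ℕ → ℕ),
      (fun i => (up n σ i).rename (upR n ρ)) = up n (fun i => (σ i).rename ρ) := by
    intro n σ ρ; funext i; simp only [up]; split
    · simp [rename, upR, *]
    · rw [wk, wk, rename_eq_subst _ (upR n ρ), subst_rename, rename_eq_subst _ (· + n),
        subst_rename]
      congr 1; funext j; simp [upR]
  induction e with
  | var i => intros; rfl
  | op o args ih => intros; simp only [rename, subst, hup, ih]
  | Id A a b h1 h2 h3 => intros; simp only [rename, subst, h1, h2, h3]
  | refl a h => intros; simp only [rename, subst, h]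
  | J k A Θ C d a b p t h1 h2 h3 h4 h5 h6 h7 h8 =>
    intros; simp only [rename, subst, hup, h1, h2, h3, h4, h5, h6, h7, h8]

theorem subst_subst (e : Expr S) : ∀ σ τ : ℕ → Expr S,
    (e.subst σ).subst τ = e.subst (fun i => (σ i).subst τ) := by
  have hup : ∀ (n : ℕ) (σ τ : ℕ → Expr S),
      (fun i => (up n σ i).subst (up n τ)) = up n (fun i => (σ i).subst τ) := by
    intro n σ τ; funext i; simp only [up]; split
    · simp [subst, up, *]
    · simp only [wk, subst_rename, rename_subst]
      congr 1; funext j; simp [up]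
  induction e with
  | var i => intros; rfl
  | op o args ih => intros; simp only [subst, hup, ih]
  | Id A a b h1 h2 h3 => intros; simp only [subst, h1, h2, h3]
  | refl a h => intros; simp only [subst, h]
  | J k A Θ C d a b p t h1 h2 h3 h4 h5 h6 h7 h8 =>
    intros; simp only [subst, hup, h1, h2, h3, h4, h5, h6, h7, h8]

theorem subst_congr (e : Expr S) : ∀ {n : ℕ} {σ τ : ℕ → Expr S}, e.Scoped n →
    (∀ i < n, σ i = τ i) → e.subst σ = e.subst τ := by
  have hup : ∀ (m : ℕ) {n : ℕ} {σ τ : ℕ → Expr S}, (∀ i < n, σ i = τ i) →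
      ∀ i < n + m, up m σ i = up m τ i := by
    intro m n σ τ h i hi; simp only [up]; split
    · rfl
    · rw [h _ (by omega)]
  induction e with
  | var i => intro n σ τ h hs; exact hs i h
  | op o args ih => intro n σ τ h hs; simp only [subst]; congr; funext j; exact ih j (h j) (hup _ hs)
  | Id A a b h1 h2 h3 =>
    intro n σ τ h hs; simp only [subst, h1 h.1 hs, h2 h.2.1 hs, h3 h.2.2 hs]
  | refl a ha => intro n σ τ h hs; simp only [subst, ha h hs]
  | J k A Θ C d a b p t h1 h2 h3 h4 h5 h6 h7 h8 =>
    intro n σ τ h hs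
    obtain ⟨g1, g2, g3, g4, g5, g6, g7, g8⟩ := h
    simp only [subst, h1 g1 hs, h3 g3 (hup _ hs), h4 g4 (hup _ hs), h5 g5 hs, h6 g6 hs, h7 g7 hs,
      funext fun i => h2 i (g2 i) (hup _ hs), funext fun i => h8 i (g8 i) hs]

theorem subst_var (e : Expr S) : e.subst var = e := by
  have hup : ∀ n : ℕ, up n (var : ℕ → Expr S) = var := by
    intro n; funext i; simp only [up]; split
    · rfl
    · simp only [wk, rename]; congr 1; omega
  induction e with
  | var i => rfl
  | op o args ih => simp only [subst, hup, ih]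
  | Id A a b h1 h2 h3 => simp only [subst, h1, h2, h3]
  | refl a h => simp only [subst, h]
  | J k A Θ C d a b p t h1 h2 h3 h4 h5 h6 h7 h8 =>
    simp only [subst, hup, h1, h2, h3, h4, h5, h6, h7, h8]

theorem Scoped.rename (e : Expr S) : ∀ {n m : ℕ} {ρ : ℕ → ℕ}, e.Scoped n →
    (∀ i < n, ρ i < m) → (e.rename ρ).Scoped m := by
  have hup : ∀ (l : ℕ) {n m : ℕ} {ρ : ℕ → ℕ}, (∀ i < n, ρ i < m) →
      ∀ i < n + l, upR l ρ i < m + l := by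
    intro l n m ρ h i hi; simp only [upR]; split
    · omega
    · have := h (i - l) (by omega); omega
  induction e with
  | var i => intro n m ρ h hs; exact hs i h
  | op o args ih => intro n m ρ h hs j; exact ih j (h j) (hup _ hs)
  | Id A a b h1 h2 h3 => intro n m ρ h hs; exact ⟨h1 h.1 hs, h2 h.2.1 hs, h3 h.2.2 hs⟩
  | refl a ha => intro n m ρ h hs; exact ha (n := n) h hs
  | J k A Θ C d a b p t h1 h2 h3 h4 h5 h6 h7 h8 =>
    intro n m ρ h hs
    obtain ⟨g1, g2, g3, g4, g5, g6, g7, g8⟩ := h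
    exact ⟨h1 g1 hs, fun i => h2 i (g2 i) (hup _ hs), h3 g3 (hup _ hs), h4 g4 (hup _ hs), h5 g5 hs,
      h6 g6 hs, h7 g7 hs, fun i => h8 i (g8 i) hs⟩

theorem Scoped.subst (e : Expr S) : ∀ {n m : ℕ} {σ : ℕ → Expr S}, e.Scoped n →
    (∀ i < n, (σ i).Scoped m) → (e.subst σ).Scoped m := by
  have hup : ∀ (l : ℕ) {n m : ℕ} {σ : ℕ → Expr S}, (∀ i < n, (σ i).Scoped m) →
      ∀ i < n + l, (up l σ i).Scoped (m + l) := by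
    intro l n m σ h i hi; simp only [up]; split
    · simp only [Scoped]; omega
    · exact Scoped.rename _ (h (i - l) (by omega)) (by intro j hj; omega)
  induction e with
  | var i => intro n m σ h hs; exact hs i h
  | op o args ih => intro n m σ h hs j; exact ih j (h j) (hup _ hs)
  | Id A a b h1 h2 h3 => intro n m σ h hs; exact ⟨h1 h.1 hs, h2 h.2.1 hs, h3 h.2.2 hs⟩
  | refl a ha => intro n m σ h hs; exact ha (n := n) h hs
  | J k A Θ C d a b p t h1 h2 h3 h4 h5 h6 h7 h8 =>
    intro n m σ h hs
    obtain ⟨g1, g2, g3, g4, g5, g6, g7, g8⟩ := h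
    exact ⟨h1 g1 hs, fun i => h2 i (g2 i) (hup _ hs), h3 g3 (hup _ hs), h4 g4 (hup _ hs), h5 g5 hs,
      h6 g6 hs, h7 g7 hs, fun i => h8 i (g8 i) hs⟩

/-- Every entry of the list, seen as a context, only mentions the variables declared before it. -/
def TScoped : List (Expr S) → Prop
  | [] => True
  | A :: Γ => A.Scoped Γ.length ∧ TScoped Γ

end Expr

open Expr

/-! ## Judgements and derivations -/

/-- Judgements relative to a context. Besides the four forms of judgement of type theory there is
a form `ctx` stating that the context is well-formed. -/
inductive Judgement (S : Signature.{u}) : Type u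
  | ctx : Judgement S
  | isType (A : Expr S) : Judgement S
  | isTerm (a A : Expr S) : Judgement S
  | eqType (A B : Expr S) : Judgement S
  | eqTerm (a b A : Expr S) : Judgement S

namespace Judgement

variable {S : Signature.{u}}

def subst (σ : ℕ → Expr S) : Judgement S → Judgement S
  | ctx => ctx
  | isType A => isType (A.subst σ)
  | isTerm a A => isTerm (a.subst σ) (A.subst σ)
  | eqType A B => eqType (A.subst σ) (B.subst σ)
  | eqTerm a b A => eqTerm (a.subst σ) (b.subst σ) (A.subst σ)

def Scoped (n : ℕ) : Judgement S → Prop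
  | ctx => True
  | isType A => A.Scoped n
  | isTerm a A => a.Scoped n ∧ A.Scoped n
  | eqType A B => A.Scoped n ∧ B.Scoped n
  | eqTerm a b A => a.Scoped n ∧ b.Scoped n ∧ A.Scoped n

/-- The judgements which have to hold for a judgement to be meaningful, apart from the
well-formedness of the context. -/
def presup : Judgement S → List (Judgement S)
  | ctx => [ctx]
  | isType _ => []
  | isTerm _ A => [isType A]
  | eqType A B => [isType A, isType B]
  | eqTerm a b A => [isTerm a A, isTerm b A]

end Judgement

/-- A dependent type theory with identity types is given by its symbols and by the set of (instances
of) its deduction rules beyond the structural rules and the rules for identity types. A rule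
instance is a list of premisses together with a conclusion. -/
structure TypeTheory where
  sig : Signature.{u}
  rules : Set (List (List (Expr sig) × Judgement sig) × (List (Expr sig) × Judgement sig))

namespace TypeTheory

variable (T : TypeTheory.{u})

/-- `T.Derives Γ 𝒥` states that the judgement `(Γ) 𝒥` is derivable. A rule of the theory is applied
only to draw a conclusion which is meaningful. The rules of weakening and of substitution of a term
for a variable are given jointly, as substitution along a sequence of terms (`subst`); substitution
respects definitional equality (`substEqType`, `substEqTerm`). In the rules for identity types the
variables of the parameter context `Θ(a, b, p)` are already replaced by terms `t`. Expressions formed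
by `J` record all the data of the elimination rule, and commute with substitution by definition.
Further congruence rules for `Id`, `refl`, `J` or other symbols may be among the rules of `T`. -/
inductive Derives : List (Expr T.sig) → Judgement T.sig → Prop
  -- rules of the theory
  | rule {prem : List (List (Expr T.sig) × Judgement T.sig)} {Γ : List (Expr T.sig)}
      {𝒥 : Judgement T.sig} (hr : (prem, (Γ, 𝒥)) ∈ T.rules) (hp : ∀ j ∈ prem, Derives j.1 j.2)
      (hΓ : Derives Γ .ctx) (h𝒥 : ∀ j ∈ 𝒥.presup, Derives Γ j) (hs : 𝒥.Scoped Γ.length) :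
      Derives Γ 𝒥
  -- contexts and variables
  | nil : Derives [] .ctx
  | cons {Γ : List (Expr T.sig)} {A : Expr T.sig} (hΓ : Derives Γ .ctx)
      (hA : Derives Γ (.isType A)) : Derives (A :: Γ) .ctx
  | var {Γ : List (Expr T.sig)} {i : ℕ} {A : Expr T.sig} (hΓ : Derives Γ .ctx)
      (hi : Γ[i]? = some A) : Derives Γ (.isTerm (.var i) (A.wk (i + 1)))
  -- weakening and substitution
  | subst {Γ Δ : List (Expr T.sig)} {𝒥 : Judgement T.sig} {σ : ℕ → Expr T.sig}
      (h : Derives Γ 𝒥) (hΔ : Derives Δ .ctx)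
      (hσ : ∀ (i : ℕ) (B : Expr T.sig), Γ[i]? = some B →
        Derives Δ (.isTerm (σ i) ((B.wk (i + 1)).subst σ))) :
      Derives Δ (𝒥.subst σ)
  | substEqType {Γ Δ : List (Expr T.sig)} {A : Expr T.sig} {σ τ : ℕ → Expr T.sig}
      (h : Derives Γ (.isType A)) (hΔ : Derives Δ .ctx)
      (hσ : ∀ (i : ℕ) (B : Expr T.sig), Γ[i]? = some B →
        Derives Δ (.isTerm (σ i) ((B.wk (i + 1)).subst σ)))
      (hτ : ∀ (i : ℕ) (B : Expr T.sig), Γ[i]? = some B →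
        Derives Δ (.isTerm (τ i) ((B.wk (i + 1)).subst τ)))
      (hστ : ∀ (i : ℕ) (B : Expr T.sig), Γ[i]? = some B →
        Derives Δ (.eqTerm (σ i) (τ i) ((B.wk (i + 1)).subst σ))) :
      Derives Δ (.eqType (A.subst σ) (A.subst τ))
  | substEqTerm {Γ Δ : List (Expr T.sig)} {a A : Expr T.sig} {σ τ : ℕ → Expr T.sig}
      (h : Derives Γ (.isTerm a A)) (hΔ : Derives Δ .ctx)
      (hσ : ∀ (i : ℕ) (B : Expr T.sig), Γ[i]? = some B →
        Derives Δ (.isTerm (σ i) ((B.wk (i + 1)).subst σ)))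
      (hτ : ∀ (i : ℕ) (B : Expr T.sig), Γ[i]? = some B →
        Derives Δ (.isTerm (τ i) ((B.wk (i + 1)).subst τ)))
      (hστ : ∀ (i : ℕ) (B : Expr T.sig), Γ[i]? = some B →
        Derives Δ (.eqTerm (σ i) (τ i) ((B.wk (i + 1)).subst σ))) :
      Derives Δ (.eqTerm (a.subst σ) (a.subst τ) (A.subst σ))
  -- definitional equality
  | reflType {Γ : List (Expr T.sig)} {A : Expr T.sig} (hA : Derives Γ (.isType A)) :
      Derives Γ (.eqType A A)
  | symmType {Γ : List (Expr T.sig)} {A B : Expr T.sig} (h : Derives Γ (.eqType A B)) :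
      Derives Γ (.eqType B A)
  | transType {Γ : List (Expr T.sig)} {A B C : Expr T.sig} (h : Derives Γ (.eqType A B))
      (h' : Derives Γ (.eqType B C)) : Derives Γ (.eqType A C)
  | reflTerm {Γ : List (Expr T.sig)} {a A : Expr T.sig} (ha : Derives Γ (.isTerm a A)) :
      Derives Γ (.eqTerm a a A)
  | symmTerm {Γ : List (Expr T.sig)} {a b A : Expr T.sig} (h : Derives Γ (.eqTerm a b A)) :
      Derives Γ (.eqTerm b a A)
  | transTerm {Γ : List (Expr T.sig)} {a b c A : Expr T.sig} (h : Derives Γ (.eqTerm a b A))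
      (h' : Derives Γ (.eqTerm b c A)) : Derives Γ (.eqTerm a c A)
  | conv {Γ : List (Expr T.sig)} {a A B : Expr T.sig} (ha : Derives Γ (.isTerm a A))
      (h : Derives Γ (.eqType A B)) : Derives Γ (.isTerm a B)
  | convEq {Γ : List (Expr T.sig)} {a b A B : Expr T.sig} (ha : Derives Γ (.eqTerm a b A))
      (h : Derives Γ (.eqType A B)) : Derives Γ (.eqTerm a b B)
  -- identity types
  | idForm {Γ : List (Expr T.sig)} {A a b : Expr T.sig} (hA : Derives Γ (.isType A))
      (ha : Derives Γ (.isTerm a A)) (hb : Derives Γ (.isTerm b A)) :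
      Derives Γ (.isType (.Id A a b))
  | idIntro {Γ : List (Expr T.sig)} {A a : Expr T.sig} (hA : Derives Γ (.isType A))
      (ha : Derives Γ (.isTerm a A)) : Derives Γ (.isTerm (.refl a) (.Id A a a))
  | idElim {Γ : List (Expr T.sig)} {k : ℕ} {A : Expr T.sig} {Θ : Fin k → Expr T.sig}
      {C d a b p : Expr T.sig} {t : Fin k → Expr T.sig} (hA : Derives Γ (.isType A))
      (hC : Derives
        (List.ofFn Θ ++ .Id (A.wk 2) (.var 1) (.var 0) :: A.wk 1 :: A :: Γ) (.isType C))
      (hd : Derives (tsubst (push [.refl (.var 0), .var 0] .var) (List.ofFn Θ) ++ A :: Γ)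
        (.isTerm d (C.subst (up k (push [.refl (.var 0), .var 0] .var)))))
      (ha : Derives Γ (.isTerm a A)) (hb : Derives Γ (.isTerm b A))
      (hp : Derives Γ (.isTerm p (.Id A a b)))
      (ht : ∀ (i : Fin k) (B : Expr T.sig),
        (tsubst (push [p, b, a] .var) (List.ofFn Θ))[(i : ℕ)]? = some B →
        Derives Γ (.isTerm (t i) ((B.wk (i + 1)).subst (push (List.ofFn t) .var)))) :
      Derives Γ (.isTerm (.J k A Θ C d a b p t)
        (C.subst (push (List.ofFn t) (push [p, b, a] .var))))
  | idComp {Γ : List (Expr T.sig)} {k : ℕ} {A : Expr T.sig} {Θ : Fin k → Expr T.sig}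
      {C d a : Expr T.sig} {t : Fin k → Expr T.sig} (hA : Derives Γ (.isType A))
      (hC : Derives
        (List.ofFn Θ ++ .Id (A.wk 2) (.var 1) (.var 0) :: A.wk 1 :: A :: Γ) (.isType C))
      (hd : Derives (tsubst (push [.refl (.var 0), .var 0] .var) (List.ofFn Θ) ++ A :: Γ)
        (.isTerm d (C.subst (up k (push [.refl (.var 0), .var 0] .var)))))
      (ha : Derives Γ (.isTerm a A))
      (ht : ∀ (i : Fin k) (B : Expr T.sig),
        (tsubst (push [.refl a, a, a] .var) (List.ofFn Θ))[(i : ℕ)]? = some B →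
        Derives Γ (.isTerm (t i) ((B.wk (i + 1)).subst (push (List.ofFn t) .var)))) :
      Derives Γ (.eqTerm (.J k A Θ C d a a (.refl a) t)
        (d.subst (push (List.ofFn t) (push [a] .var)))
        (C.subst (push (List.ofFn t) (push [.refl a, a, a] .var))))

/-- `(Γ) s ∈ Ψ`: the sequence `s` is a dependent element of the dependent context `Ψ`. -/
def IsElem (Γ s Ψ : List (Expr T.sig)) : Prop :=
  s.length = Ψ.length ∧ ∀ (i : ℕ) (B : Expr T.sig), Ψ[i]? = some B →
    T.Derives Γ (.isTerm (push s .var i) ((B.wk (i + 1)).subst (push s .var)))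

/-- `(Γ) s = s' ∈ Ψ`: componentwise definitional equality. -/
def EqElem (Γ s s' Ψ : List (Expr T.sig)) : Prop :=
  ∀ (i : ℕ) (B : Expr T.sig), Ψ[i]? = some B →
    T.Derives Γ (.eqTerm (push s .var i) (push s' .var i) ((B.wk (i + 1)).subst (push s .var)))

end TypeTheory

namespace Expr
variable {S : Signature.{u}}
theorem TScoped.get {Γ : List (Expr S)} (h : TScoped Γ) {i : ℕ} {A : Expr S}
    (hi : Γ[i]? = some A) : (A.wk (i + 1)).Scoped Γ.length := by
  induction Γ generalizing i with
  | nil => simp at hi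
  | cons B Γ ih =>
    cases i with
    | zero =>
      simp only [List.getElem?_cons_zero, Option.some.injEq] at hi
      subst hi
      exact Scoped.rename _ h.1 (by intro j hj; simp; omega)
    | succ i =>
      have h1 := ih h.2 (by simpa using hi)
      have h2 := Scoped.rename _ (ρ := (· + 1)) (m := Γ.length + 1) h1 (by intro j hj; omega)
      simp only [wk, rename_eq_subst _ (_ : ℕ → ℕ), subst_subst] at h2 ⊢
      simpa [Expr.subst, Nat.add_assoc] using h2

theorem tscoped_append {Θ Γ : List (Expr S)} (h : TScoped (Θ ++ Γ)) : TScoped Γ := by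
  induction Θ with
  | nil => exact h
  | cons A Θ ih => exact ih h.2

theorem tscoped_ofFn {k : ℕ} {Θ : Fin k → Expr S} {Γ : List (Expr S)}
    (h : TScoped (List.ofFn Θ ++ Γ)) (i : Fin k) : (Θ i).Scoped (Γ.length + (k - 1 - i)) := by
  induction k with
  | zero => exact i.elim0
  | succ k ih =>
    rw [List.ofFn_succ] at h
    cases i using Fin.cases with
    | zero =>
      have h' : (Θ 0).Scoped (List.ofFn (fun i : Fin k => Θ i.succ) ++ Γ).length := h.1
      rw [List.length_append, List.length_ofFn] at h'
      simpa [Nat.add_comm] using h'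
    | succ i =>
      have := ih h.2 i
      convert this using 2
      simp only [Fin.val_succ]; omega

theorem push_scoped {s : List (Expr S)} {σ : ℕ → Expr S} {n m : ℕ} (hs : ∀ e ∈ s, e.Scoped m)
    (hσ : ∀ i < n, (σ i).Scoped m) : ∀ i < n + s.length, (push s σ i).Scoped m := by
  intro i hi
  simp only [push, List.getD]
  by_cases h : i < s.length
  · rw [List.getElem?_eq_getElem h]; exact hs _ (List.getElem_mem h)
  · rw [List.getElem?_eq_none (by omega)]; exact hσ _ (by omega)

end Expr

namespace TypeTheory
variable {T : TypeTheory.{u}}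

theorem Derives.scoped {Γ : List (Expr T.sig)} {𝒥 : Judgement T.sig} (h : T.Derives Γ 𝒥) :
    TScoped Γ ∧ 𝒥.Scoped Γ.length := by
  induction h with
  | rule hr hp hΓ h𝒥 hs _ ih _ => exact ⟨ih.1, hs⟩
  | nil => exact ⟨trivial, trivial⟩
  | cons hΓ hA ih1 ih2 => exact ⟨⟨ih2.2, ih1.1⟩, trivial⟩
  | var hΓ hi ih =>
    refine ⟨ih.1, ?_, ih.1.get hi⟩
    exact (List.getElem?_eq_some_iff.1 hi).1
  | @subst Γ Δ 𝒥 σ h hΔ hσ ih1 ih2 ih3 =>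
    have hs : ∀ i < Γ.length, (σ i).Scoped Δ.length := fun i hi =>
      (ih3 i _ (List.getElem?_eq_getElem hi)).2.1
    refine ⟨ih2.1, ?_⟩
    have h2 := ih1.2
    cases 𝒥 with
    | ctx => trivial
    | isType A => exact Scoped.subst _ h2 hs
    | isTerm a A => exact ⟨Scoped.subst _ h2.1 hs, Scoped.subst _ h2.2 hs⟩
    | eqType A B => exact ⟨Scoped.subst _ h2.1 hs, Scoped.subst _ h2.2 hs⟩
    | eqTerm a b A =>
      exact ⟨Scoped.subst _ h2.1 hs, Scoped.subst _ h2.2.1 hs, Scoped.subst _ h2.2.2 hs⟩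
  | @substEqType Γ Δ A σ τ h hΔ hσ hτ _ ih1 ih2 ih3 ih4 _ =>
    exact ⟨ih2.1, Scoped.subst _ ih1.2 fun i hi => (ih3 i _ (List.getElem?_eq_getElem hi)).2.1,
      Scoped.subst _ ih1.2 fun i hi => (ih4 i _ (List.getElem?_eq_getElem hi)).2.1⟩
  | @substEqTerm Γ Δ a A σ τ h hΔ hσ hτ _ ih1 ih2 ih3 ih4 _ =>
    have hs : ∀ i < Γ.length, (σ i).Scoped Δ.length := fun i hi =>
      (ih3 i _ (List.getElem?_eq_getElem hi)).2.1
    exact ⟨ih2.1, Scoped.subst _ ih1.2.1 hs,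
      Scoped.subst _ ih1.2.1 fun i hi => (ih4 i _ (List.getElem?_eq_getElem hi)).2.1,
      Scoped.subst _ ih1.2.2 hs⟩
  | reflType _ ih => exact ⟨ih.1, ih.2, ih.2⟩
  | symmType _ ih => exact ⟨ih.1, ih.2.2, ih.2.1⟩
  | transType _ _ ih1 ih2 => exact ⟨ih1.1, ih1.2.1, ih2.2.2⟩
  | reflTerm _ ih => exact ⟨ih.1, ih.2.1, ih.2.1, ih.2.2⟩
  | symmTerm _ ih => exact ⟨ih.1, ih.2.2.1, ih.2.1, ih.2.2.2⟩
  | transTerm _ _ ih1 ih2 => exact ⟨ih1.1, ih1.2.1, ih2.2.2.1, ih1.2.2.2⟩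
  | conv _ _ ih1 ih2 => exact ⟨ih1.1, ih1.2.1, ih2.2.2⟩
  | convEq _ _ ih1 ih2 => exact ⟨ih1.1, ih1.2.1, ih1.2.2.1, ih2.2.2⟩
  | idForm _ _ _ ih1 ih2 ih3 => exact ⟨ih1.1, ih1.2, ih2.2.1, ih3.2.1⟩
  | idIntro _ _ ih1 ih2 => exact ⟨ih1.1, ih2.2.1, ih1.2, ih2.2.1, ih2.2.1⟩
  | @idElim Γ k A Θ C d a b p t hA hC hd ha hb hp ht ih1 ih2 ih3 ih4 ih5 ih6 ih7 =>
    have hlen : ∀ (σ : ℕ → Expr T.sig) (L : List (Expr T.sig)), (tsubst σ L).length = L.length := by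
      intro σ L; induction L <;> simp_all [tsubst]
    have ht' : ∀ i, (t i).Scoped Γ.length := fun i =>
      (ih7 i _ (List.getElem?_eq_getElem (by simp [hlen]))).2.1
    have hC' : C.Scoped (Γ.length + (3 + k)) := by
      have := ih2.2; simp only [Judgement.Scoped, List.length_append, List.length_ofFn,
        List.length_cons] at this
      convert this using 1; omega
    have hd' : d.Scoped (Γ.length + (1 + k)) := by
      have := ih3.2.1; simp only [List.length_append, List.length_ofFn,
        List.length_cons, hlen] at this
      convert this using 1; omega
    refine ⟨ih1.1, ⟨ih1.2, fun i => ?_, hC', hd', ih4.2.1, ih5.2.1, ih6.2.1, ht'⟩, ?_⟩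
    · have := tscoped_ofFn ih2.1 i
      simp only [List.length_cons] at this
      convert this using 1; omega
    · refine Scoped.subst _ hC' ?_
      have h1 := push_scoped (s := [p, b, a]) (σ := .var) (n := Γ.length) (m := Γ.length)
        (by simp only [List.mem_cons, List.not_mem_nil, or_false]
            rintro e (rfl | rfl | rfl)
            exacts [ih6.2.1, ih5.2.1, ih4.2.1]) (fun i hi => hi)
      have h2 := push_scoped (s := List.ofFn t) (m := Γ.length)
        (by intro e he; obtain ⟨i, rfl⟩ := (List.mem_ofFn' t e).1 he; exact ht' i) h1
      simpa [Nat.add_assoc] using h2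
  | @idComp Γ k A Θ C d a t hA hC hd ha ht ih1 ih2 ih3 ih4 ih7 =>
    have hlen : ∀ (σ : ℕ → Expr T.sig) (L : List (Expr T.sig)), (tsubst σ L).length = L.length := by
      intro σ L; induction L <;> simp_all [tsubst]
    have ht' : ∀ i, (t i).Scoped Γ.length := fun i =>
      (ih7 i _ (List.getElem?_eq_getElem (by simp [hlen]))).2.1
    have hC' : C.Scoped (Γ.length + (3 + k)) := by
      have := ih2.2; simp only [Judgement.Scoped, List.length_append, List.length_ofFn,
        List.length_cons] at this
      convert this using 1; omega
    have hd' : d.Scoped (Γ.length + (1 + k)) := by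
      have := ih3.2.1; simp only [List.length_append, List.length_ofFn,
        List.length_cons, hlen] at this
      convert this using 1; omega
    have hmem : ∀ e ∈ List.ofFn t, e.Scoped Γ.length := by
      intro e he; obtain ⟨i, rfl⟩ := (List.mem_ofFn' t e).1 he; exact ht' i
    refine ⟨ih1.1, ⟨ih1.2, fun i => ?_, hC', hd', ih4.2.1, ih4.2.1, ih4.2.1, ht'⟩, ?_, ?_⟩
    · have := tscoped_ofFn ih2.1 i
      simp only [List.length_cons] at this
      convert this using 1; omega
    · refine Scoped.subst _ hd' ?_
      have h1 := push_scoped (s := [a]) (σ := .var) (n := Γ.length) (m := Γ.length)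
        (by simpa using ih4.2.1) (fun i hi => hi)
      have h2 := push_scoped (s := List.ofFn t) (m := Γ.length) hmem h1
      simpa [Nat.add_assoc] using h2
    · refine Scoped.subst _ hC' ?_
      have h1 := push_scoped (s := [.refl a, a, a]) (σ := .var) (n := Γ.length) (m := Γ.length)
        (by simp only [List.mem_cons, List.not_mem_nil, or_false]
            rintro e (rfl | rfl | rfl)
            exacts [ih4.2.1, ih4.2.1, ih4.2.1]) (fun i hi => hi)
      have h2 := push_scoped (s := List.ofFn t) (m := Γ.length) hmem h1
      simpa [Nat.add_assoc] using h2

end TypeTheory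

/-! ## The classifying category -/

namespace TypeTheory

variable {T : TypeTheory.{u}}

theorem getElem?_push {s : List (Expr T.sig)} {σ : ℕ → Expr T.sig} {i : ℕ} {e : Expr T.sig}
    (h : s[i]? = some e) : push s σ i = e := by
  simp [push, List.getD, h]

theorem getElem?_vars {k m i : ℕ} (h : i < k) :
    (vars k m : List (Expr T.sig))[i]? = some (.var (m + i)) := by
  simp [vars, h]

/-- Substitution of the composite sequence agrees with iterated substitution on the declared
variables. -/
theorem push_comp {s t : List (Expr T.sig)} {i : ℕ} (hi : i < t.length) :
    push (t.map (Expr.subst (push s .var))) .var i = (push t .var i).subst (push s .var) := by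
  simp [push, List.getD, hi]

theorem isElem_vars {Γ : List (Expr T.sig)} (hΓ : T.Derives Γ .ctx) :
    T.IsElem Γ (vars Γ.length 0) Γ := by
  refine ⟨by simp [vars], fun i B hi => ?_⟩
  have hi' : i < Γ.length := (List.getElem?_eq_some_iff.1 hi).1
  have h1 : ∀ j < Γ.length, push (vars Γ.length 0) .var j = (.var j : Expr T.sig) := fun j hj => by
    rw [getElem?_push (getElem?_vars hj), Nat.zero_add]
  rw [h1 i hi', Expr.subst_congr _ (hΓ.scoped.1.get hi) h1, subst_var]
  exact .var hΓ hi

theorem IsElem.comp {Γ Δ Ξ s t : List (Expr T.sig)} (hΓ : T.Derives Γ .ctx)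
    (hΞ : T.Derives Ξ .ctx) (hs : T.IsElem Γ s Δ) (ht : T.IsElem Δ t Ξ) :
    T.IsElem Γ (t.map (Expr.subst (push s .var))) Ξ := by
  refine ⟨by simp [ht.1], fun i B hi => ?_⟩
  have hi' : i < t.length := ht.1 ▸ (List.getElem?_eq_some_iff.1 hi).1
  have h := Derives.subst (ht.2 i B hi) hΓ hs.2
  rw [push_comp hi', Expr.subst_congr _ (hΞ.scoped.1.get hi)
    (fun j hj => push_comp (ht.1 ▸ hj)), ← subst_subst]
  exact h

theorem EqElem.comp_left {Γ Δ Ξ s t t' : List (Expr T.sig)} (hΓ : T.Derives Γ .ctx)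
    (hΞ : T.Derives Ξ .ctx) (hs : T.IsElem Γ s Δ) (ht : T.IsElem Δ t Ξ) (ht' : T.IsElem Δ t' Ξ)
    (h : T.EqElem Δ t t' Ξ) : T.EqElem Γ (t.map (Expr.subst (push s .var)))
      (t'.map (Expr.subst (push s .var))) Ξ := by
  intro i B hi
  have hi' : i < Ξ.length := (List.getElem?_eq_some_iff.1 hi).1
  have h := Derives.subst (h i B hi) hΓ hs.2
  rw [push_comp (ht.1 ▸ hi'), push_comp (ht'.1 ▸ hi'), Expr.subst_congr _ (hΞ.scoped.1.get hi)
    (fun j hj => push_comp (ht.1 ▸ hj)), ← subst_subst]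
  exact h

theorem EqElem.comp_right {Γ Δ Ξ s s' t : List (Expr T.sig)} (hΓ : T.Derives Γ .ctx)
    (hΞ : T.Derives Ξ .ctx) (hs : T.IsElem Γ s Δ) (hs' : T.IsElem Γ s' Δ) (ht : T.IsElem Δ t Ξ)
    (h : T.EqElem Γ s s' Δ) : T.EqElem Γ (t.map (Expr.subst (push s .var)))
      (t.map (Expr.subst (push s' .var))) Ξ := by
  intro i B hi
  have hi' : i < Ξ.length := (List.getElem?_eq_some_iff.1 hi).1
  have h := Derives.substEqTerm (ht.2 i B hi) hΓ hs.2 hs'.2 h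
  rw [push_comp (ht.1 ▸ hi'), push_comp (ht.1 ▸ hi'), Expr.subst_congr _ (hΞ.scoped.1.get hi)
    (fun j hj => push_comp (ht.1 ▸ hj)), ← subst_subst]
  exact h

theorem IsElem.scoped {Γ s Ψ : List (Expr T.sig)} (h : T.IsElem Γ s Ψ) :
    ∀ e ∈ s, e.Scoped Γ.length := by
  intro e he
  obtain ⟨i, hi, rfl⟩ := List.getElem_of_mem he
  have h1 := (h.2 i _ (List.getElem?_eq_getElem (h.1 ▸ hi))).scoped.2.1
  rwa [getElem?_push (List.getElem?_eq_getElem hi)] at h1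

end TypeTheory

/-- Well-formed contexts of a type theory. -/
structure Cxt (T : TypeTheory.{u}) where
  toList : List (Expr T.sig)
  wf : T.Derives toList .ctx

namespace Cxt

variable {T : TypeTheory.{u}}

/-- The length of a context. -/
abbrev len (Φ : Cxt T) : ℕ := Φ.toList.length

/-- Context morphisms, up to componentwise definitional equality. -/
def Mor (Φ Ψ : Cxt T) : Type u :=
  Quot fun s s' : {s : List (Expr T.sig) // T.IsElem Φ.toList s Ψ.toList} =>
    T.EqElem Φ.toList s.1 s'.1 Ψ.toList

/-- Contexts and context morphisms; composition is substitution. -/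
instance : Category.{u} (Cxt T) where
  Hom := Mor
  id Φ := Quot.mk _ ⟨vars Φ.len 0, TypeTheory.isElem_vars Φ.wf⟩
  comp {Φ Ψ Ξ} := Quot.map₂
    (fun s t => ⟨t.1.map (Expr.subst (push s.1 .var)), s.2.comp Φ.wf Ξ.wf t.2⟩)
    (fun s t t' h => h.comp_left Φ.wf Ξ.wf s.2 t.2 t'.2)
    (fun s s' t h => h.comp_right Φ.wf Ξ.wf s.2 s'.2 t.2)
  id_comp {Φ Ψ} f := by
    induction f using Quot.ind with | _ s
    refine congrArg (Quot.mk _) (Subtype.ext ?_)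
    refine (List.map_congr_left fun e he => ?_).trans (List.map_id s.1)
    rw [Expr.subst_congr e (τ := .var) (s.2.scoped e he), subst_var]; · rfl
    intro i hi
    rw [TypeTheory.getElem?_push (TypeTheory.getElem?_vars hi), Nat.zero_add]
  comp_id {Φ Ψ} f := by
    induction f using Quot.ind with | _ s
    refine congrArg (Quot.mk _) (Subtype.ext ?_)
    refine List.ext_getElem? fun i => ?_
    have hl : s.1.length = Ψ.len := s.2.1
    by_cases hi : i < Ψ.len
    · have hi' : i < s.1.length := by omega
      simp [TypeTheory.getElem?_vars hi, Expr.subst, push, List.getD, hi']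
    · have hi' : s.1.length ≤ i := by omega
      simp [vars, hi']; omega
  assoc {Φ Ψ Ξ Υ} f g h := by
    induction f using Quot.ind with | _ s
    induction g using Quot.ind with | _ t
    induction h using Quot.ind with | _ r
    refine congrArg (Quot.mk _) (Subtype.ext ?_)
    simp only [List.map_map]
    refine List.map_congr_left fun e he => ?_
    simp only [Function.comp, subst_subst]
    exact Expr.subst_congr e (r.2.scoped e he) fun i hi =>
      TypeTheory.push_comp (by have := t.2.1; omega)

/-- The context morphism `f` is given by the sequence of terms `s`. -/
def Represents {Φ Ψ : Cxt T} (f : Φ ⟶ Ψ) (s : List (Expr T.sig)) : Prop :=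
  ∃ h : T.IsElem Φ.toList s Ψ.toList, f = Quot.mk _ ⟨s, h⟩

/-- A sequence of terms which represents a given context morphism. -/
noncomputable def rep {Φ Ψ : Cxt T} (f : Φ ⟶ Ψ) : List (Expr T.sig) := (Quot.out f).1

/-- Componentwise definitional equality of contexts. (This is an equivalence relation, and so is
definitional equality of context morphisms and homotopy of paths.) -/
def DefEq (Φ Ψ : Cxt T) : Prop :=
  Φ.len = Ψ.len ∧ ∀ (i : ℕ) (A B : Expr T.sig), Φ.toList[i]? = some A → Ψ.toList[i]? = some B →
    T.Derives (Φ.toList.drop (i + 1)) (.eqType A B)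

/-- The empty context. -/
def empty (T : TypeTheory.{u}) : Cxt T := ⟨[], .nil⟩

end Cxt

/-- The classifying category. Its objects are contexts up to componentwise definitional equality and
its maps are context morphisms up to definitional equality. The context morphisms between two
equivalence classes are those between chosen representatives; they are given by the same sequences
of terms as the context morphisms between any other representatives. -/
abbrev ClassifyingCategory (T : TypeTheory.{u}) :=
  InducedCategory (Cxt T) (Quot.out : Quot (Cxt.DefEq (T := T)) → Cxt T)

/-- The object of the classifying category given by a context. -/
def Cxt.cls {T : TypeTheory.{u}} (Φ : Cxt T) : ClassifyingCategory T := Quot.mk _ Φ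

/-- The map `f` of the classifying category is given by the sequence of terms `s`. -/
def ClassifyingCategory.Represents {T : TypeTheory.{u}} {X Y : ClassifyingCategory T} (f : X ⟶ Y)
    (s : List (Expr T.sig)) : Prop := Cxt.Represents f.hom s

/-! ## Identity contexts

Below, `Φ` is a dependent context of length `k` relative to `Γ`. In `(Γ, x ∈ Φ, y ∈ Φ, u ∈ Id(x, y))`
the variables `u`, `y`, `x` start at the indices `0`, `k`, `2k` and those of `Γ` at `3k`. -/

namespace Expr

variable {S : Signature.{u}}

/-- The elimination term for a single type `A` in terms of variables: given `A` in `(Γ)`, `Θ` in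
`(Γ, x, y, u)`, `C` in `(Γ, x, y, u, Θ)` and `d` in `(Γ, x, Θ(x, x, r(x)))`, this is the term
`J(x, y, u, d)` in `(Γ, x, y, u, Θ)`. -/
def jVar (A : Expr S) (Θ : List (Expr S)) (C d : Expr S) : Expr S :=
  let l := Θ.length
  let Θ' := trename (upR 3 (· + (3 + l))) Θ
  J l (A.wk (3 + l)) (fun i => Θ'.getD i (var 0)) (C.rename (upR (3 + l) (· + (3 + l))))
    (d.rename (upR (1 + l) (· + (3 + l)))) (var (l + 2)) (var (l + 1)) (var l) fun i => var i

/-- For a context of length `k + 1`, the renaming from `(Γ, x, x', y, y', u, u')` to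
`(Γ, x, y, u, x', y', u')`, where `x'`, `y'`, `u'` are the last components. -/
def shuffle (k : ℕ) : ℕ → ℕ := fun i =>
  if i = 0 then 0
  else if i < k + 1 then i + 2
  else if i = k + 1 then 1
  else if i < 2 * k + 2 then i + 1
  else if i = 2 * k + 2 then 2
  else i

/-- The inverse of `shuffle k`. -/
def unshuffle (k : ℕ) : ℕ → ℕ := fun i =>
  if i = 0 then 0
  else if i = 1 then k + 1
  else if i = 2 then 2 * k + 2
  else if i < k + 3 then i - 2
  else if i < 2 * k + 3 then i - 1
  else i

/-- The reflexivity element `r(x) ∈ Id(x, x)` in `(Γ, x ∈ Φ)`. -/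
def rTerms : List (Expr S) → List (Expr S)
  | [] => []
  | _ :: Φ => refl (var 0) :: (rTerms Φ).map (wk 1)

/-- The substitution from `(Γ, x, x', y, y', u, u')` to `(Γ, x, x', y', u')` which replaces `y` by `x`
and `u` by `r(x)`; here `x ∈ Φ`. -/
def diag (Φ : List (Expr S)) : ℕ → Expr S := fun i =>
  let k := Φ.length
  if i = 0 then var 0
  else if i < k + 1 then ((rTerms Φ).getD (i - 1) (var 0)).wk 3
  else if i = k + 1 then var 1
  else if i < 2 * k + 2 then var (i - k + 1)
  else if i = 2 * k + 2 then var 2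
  else var (i - 2 * k)

/-- Given `A` in `(Γ, x ∈ Φ)` and `z ∈ A(x)` and an elimination operation `j` for `Φ`, the transport
`u_!(z) ∈ A(y)` in `(Γ, x, y, u, z ∈ A(x))`, obtained by elimination on `u` with parameter
`z ∈ A(x)`, eliminating type `A(y)` and eliminating term `z`. -/
def transport (j : List (Expr S) → Expr S → Expr S → Expr S) (k : ℕ) (A : Expr S) : Expr S :=
  j [A.wk (2 * k)] (A.rename fun i => if i < k then i + (k + 1) else i + (2 * k + 1)) (var 0)

/-- The type `Id_{A(y)}(u_!(x'), y')` in `(Γ, x, y, u, x' ∈ A(x), y' ∈ A(y))`. -/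
def lastId (j : List (Expr S) → Expr S → Expr S → Expr S) (k : ℕ) (A : Expr S) : Expr S :=
  Id (A.rename fun i => if i < k then i + (k + 2) else i + (2 * k + 2))
    ((transport j k A).wk 1) (var 0)

/-- The elimination term for a context `Φ`, with a single eliminating type: given `Θ` in
`(Γ, x, y, u)`, `C` in `(Γ, x, y, u, Θ)` and `d` in `(Γ, x, Θ(x, x, r(x)))`, this is the term
`J(x, y, u, d)` of `C` in `(Γ, x, y, u, Θ)`. For a context `(Φ, A)` one eliminates on `u`, with
parameters `(x', y', u', Θ)`, and then on `u'`, with parameters `Θ`. -/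
def jTerm : List (Expr S) → List (Expr S) → Expr S → Expr S → Expr S
  | [], _, _, d => d
  | A :: Φ, Θ, C, d =>
    let k := Φ.length
    let l := Θ.length
    let Θ₁ := trename (shuffle k) Θ ++
      [lastId (jTerm Φ) k A, A.rename fun i => if i < k then i + (k + 1) else i + (2 * k + 1),
        A.wk (2 * k)]
    let d₁ := jVar A (tsubst (diag Φ) Θ) (C.subst (up l (diag Φ))) d
    (jTerm Φ Θ₁ (C.rename (upR l (shuffle k))) d₁).rename (upR l (unshuffle k))

/-- The elimination element for a context `Φ` with eliminating context `Ω` in `(Γ, x, y, u, Θ)` and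
eliminating family `d` in `(Γ, x, Θ(x, x, r(x)))`. -/
def jTerms (Φ Θ : List (Expr S)) : List (Expr S) → List (Expr S) → List (Expr S)
  | C :: Ω, d :: ds =>
    jTerm Φ Θ (C.subst (push (jTerms Φ Θ Ω ds) var)) d :: jTerms Φ Θ Ω ds
  | _, _ => []

/-- The identity context `Id_Φ(x, y)` in `(Γ, x ∈ Φ, y ∈ Φ)`: it is empty for the empty context, and
for `(Φ, A)` it is `(u ∈ Id_Φ(x, y), u' ∈ Id_{A(y)}(u_!(x'), y'))`. -/
def idVar : List (Expr S) → List (Expr S)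
  | [] => []
  | A :: Φ =>
    let k := Φ.length
    ((lastId (jTerm Φ) k A).rename fun i =>
      if i = 0 then k else if i = 1 then 2 * k + 1 else if i < k + 2 then i - 2
      else if i < 2 * k + 2 then i - 1 else i) ::
    trename (fun i => if i < k then i + 1 else i + 2) (idVar Φ)

/-- The identity context `Id_{Φ[σ]}(a, b)`, where `σ` substitutes for the variables of `Γ`. -/
def idAt (Φ : List (Expr S)) (σ : ℕ → Expr S) (a b : List (Expr S)) : List (Expr S) :=
  tsubst (push b (push a σ)) (idVar Φ)

/-- The path `1_a = r(a) ∈ Id_Φ(a, a)`. -/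
def onePath (Φ a : List (Expr S)) : List (Expr S) := (rTerms Φ).map (subst (push a var))

/-- The composite `q ∘ p = q_!(p) ∈ Id_Φ(a, c)` of `p ∈ Id_Φ(a, b)` and `q ∈ Id_Φ(b, c)`, where `q_!` is
transport in `(x ∈ Φ) Id_Φ(a, x)`: elimination on `q` with parameters `z ∈ Id_Φ(a, x)`, eliminating
context `Id_Φ(a, y)` and eliminating family `z`. -/
def compPath (Φ a b c p q : List (Expr S)) : List (Expr S) :=
  let k := Φ.length
  (jTerms Φ (idAt Φ (fun i => var (i + 3 * k)) (a.map (wk (3 * k))) (vars k (2 * k)))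
    (idAt Φ (fun i => var (i + 4 * k)) (a.map (wk (4 * k))) (vars k (2 * k))) (vars k 0)).map
    (subst (push p (push q (push c (push b var)))))

/-- The inverse `p⁻¹ = J(a, b, p, [x] r(x)) ∈ Id_Φ(b, a)` of `p ∈ Id_Φ(a, b)`. -/
def invPath (Φ a b p : List (Expr S)) : List (Expr S) :=
  let k := Φ.length
  (jTerms Φ [] (idAt Φ (fun i => var (i + 3 * k)) (vars k k) (vars k (2 * k))) (rTerms Φ)).map
    (subst (push p (push b (push a var))))

/-- For a context morphism `f` from `Φ` to `Ψ` and `p ∈ Id_Φ(a, b)`, the path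
`f(p) = J(a, b, p, [x] 1_{f(x)}) ∈ Id_Ψ(f(a), f(b))`. Here `Φ` and `Ψ` are contexts relative to the empty
context. -/
def mapPath (Φ Ψ f a b p : List (Expr S)) : List (Expr S) :=
  let k := Φ.length
  (jTerms Φ [] (idAt Ψ var (f.map (wk (2 * k))) (f.map (wk k))) (onePath Ψ f)).map
    (subst (push p (push b (push a var))))

/-- The context `Id(f) = (x ∈ Φ, y ∈ Ψ, u ∈ Id_Ψ(f(x), y))` of a context morphism `f` from `Φ` to
`Ψ`. -/
def idMor (Φ Ψ f : List (Expr S)) : List (Expr S) :=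
  let m := Ψ.length
  idAt Ψ var (f.map (wk m)) (vars m 0) ++ (Ψ ++ Φ)

/-- The sequence `i_f = (x, f(x), 1_{f(x)})`. -/
def iMor (Φ Ψ f : List (Expr S)) : List (Expr S) := onePath Ψ f ++ (f ++ vars Φ.length 0)

/-- The sequence `p_f = (y)`. -/
def pMor (Ψ : List (Expr S)) : List (Expr S) := vars Ψ.length Ψ.length

end Expr

/-! ## The fundamental groupoid -/

namespace Cxt

variable {T : TypeTheory.{u}}

/-- The points of a context: its global elements, up to definitional equality. -/
abbrev Pt (Φ : Cxt T) : Type u := empty T ⟶ Φ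

variable {Φ : Cxt T}

/-- The identity context of two points. -/
noncomputable def idCxt (a b : Pt Φ) : List (Expr T.sig) := idAt Φ.toList .var (rep a) (rep b)

/-- Paths from `a` to `b`. -/
def Path (a b : Pt Φ) : Type u := {p : List (Expr T.sig) // T.IsElem [] p (idCxt a b)}

/-- Two paths are homotopic if their identity context has an element. -/
def Homotopic {a b : Pt Φ} (p q : Path a b) : Prop :=
  ∃ h : List (Expr T.sig), T.IsElem [] h (idAt (idCxt a b) .var p.1 q.1)

/-- Homotopy classes of paths from `a` to `b`. -/
def PathClass (a b : Pt Φ) : Type u := Quot (Homotopic (a := a) (b := b))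

/-- The sequence of terms `p` is a path, and its homotopy class is `P`. -/
def PathClass.IsClassOf {a b : Pt Φ} (P : PathClass a b) (p : List (Expr T.sig)) : Prop :=
  ∃ h : T.IsElem [] p (idCxt a b), P = Quot.mk _ ⟨p, h⟩

end Cxt

/-- The fundamental groupoid functor: on homotopy classes of paths, `[q] ∘ [p] = [q ∘ p]`,
`1_a = [1_a]`, `[p]⁻¹ = [p⁻¹]` and `F(f)([p]) = [f(p)]` are well-defined, and satisfy the laws of a
groupoid and of a functor to groupoids. All operations are uniquely determined, so that there is at
most one such structure; its existence is a property of the type theory, to be proved. -/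
structure FundamentalGroupoidFunctor (T : TypeTheory.{u}) where
  one {Φ : Cxt T} (a : Φ.Pt) : Cxt.PathClass a a
  comp {Φ : Cxt T} {a b c : Φ.Pt} (P : Cxt.PathClass a b) (Q : Cxt.PathClass b c) :
    Cxt.PathClass a c
  inv {Φ : Cxt T} {a b : Φ.Pt} (P : Cxt.PathClass a b) : Cxt.PathClass b a
  map {Φ Ψ : Cxt T} (f : Φ ⟶ Ψ) {a b : Φ.Pt} (P : Cxt.PathClass a b) :
    Cxt.PathClass (a ≫ f) (b ≫ f)
  one_class {Φ : Cxt T} (a : Φ.Pt) : (one a).IsClassOf (onePath Φ.toList (Cxt.rep a))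
  comp_class {Φ : Cxt T} {a b c : Φ.Pt} {P : Cxt.PathClass a b} {Q : Cxt.PathClass b c}
    {p q : List (Expr T.sig)} (hp : P.IsClassOf p) (hq : Q.IsClassOf q) :
    (comp P Q).IsClassOf (compPath Φ.toList (Cxt.rep a) (Cxt.rep b) (Cxt.rep c) p q)
  inv_class {Φ : Cxt T} {a b : Φ.Pt} {P : Cxt.PathClass a b} {p : List (Expr T.sig)}
    (hp : P.IsClassOf p) : (inv P).IsClassOf (invPath Φ.toList (Cxt.rep a) (Cxt.rep b) p)
  map_class {Φ Ψ : Cxt T} (f : Φ ⟶ Ψ) {a b : Φ.Pt} {P : Cxt.PathClass a b}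
    {p : List (Expr T.sig)} (hp : P.IsClassOf p) : (map f P).IsClassOf
      (mapPath Φ.toList Ψ.toList (Cxt.rep f) (Cxt.rep a) (Cxt.rep b) p)
  one_comp {Φ : Cxt T} {a b : Φ.Pt} (P : Cxt.PathClass a b) : comp (one a) P = P
  comp_one {Φ : Cxt T} {a b : Φ.Pt} (P : Cxt.PathClass a b) : comp P (one b) = P
  assoc {Φ : Cxt T} {a b c d : Φ.Pt} (P : Cxt.PathClass a b) (Q : Cxt.PathClass b c)
    (R : Cxt.PathClass c d) : comp (comp P Q) R = comp P (comp Q R)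
  inv_comp {Φ : Cxt T} {a b : Φ.Pt} (P : Cxt.PathClass a b) : comp (inv P) P = one b
  comp_inv {Φ : Cxt T} {a b : Φ.Pt} (P : Cxt.PathClass a b) : comp P (inv P) = one a
  map_one {Φ Ψ : Cxt T} (f : Φ ⟶ Ψ) (a : Φ.Pt) : map f (one a) = one (a ≫ f)
  map_comp {Φ Ψ : Cxt T} (f : Φ ⟶ Ψ) {a b c : Φ.Pt} (P : Cxt.PathClass a b)
    (Q : Cxt.PathClass b c) : map f (comp P Q) = comp (map f P) (map f Q)
  id_map {Φ : Cxt T} {a b : Φ.Pt} (P : Cxt.PathClass a b) : HEq (map (𝟙 Φ) P) P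
  comp_map {Φ Ψ Ξ : Cxt T} (f : Φ ⟶ Ψ) (g : Ψ ⟶ Ξ) {a b : Φ.Pt} (P : Cxt.PathClass a b) :
    HEq (map (f ≫ g) P) (map g (map f P))

namespace FundamentalGroupoidFunctor

variable {T : TypeTheory.{u}} (F : FundamentalGroupoidFunctor T)

/-- The fundamental groupoid of a context: its objects are the points, and its maps are the homotopy
classes of paths. -/
abbrev groupoid (Φ : Cxt T) : Groupoid.{u} Φ.Pt where
  Hom a b := Cxt.PathClass a b
  id a := F.one a
  comp P Q := F.comp P Q
  inv P := F.inv P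
  id_comp P := F.one_comp P
  comp_id P := F.comp_one P
  assoc P Q R := F.assoc P Q R
  inv_comp P := F.inv_comp P
  comp_inv P := F.comp_inv P

/-- The action on contexts and context morphisms. -/
def onCxt : Cxt T ⥤ Grpd.{u, u} where
  obj Φ := letI := F.groupoid Φ; Grpd.of Φ.Pt
  map {Φ Ψ} f :=
    letI := F.groupoid Φ
    letI := F.groupoid Ψ
    { obj := fun a => a ≫ f
      map := fun P => F.map f P
      map_id := fun a => F.map_one f a
      map_comp := fun P Q => F.map_comp f P Q }
  map_id Φ := by
    let := F.groupoid Φ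
    exact CategoryTheory.Functor.hext (fun a => Category.comp_id a) fun a b P => F.id_map P
  map_comp {Φ Ψ Ξ} f g := by
    let := F.groupoid Φ
    let := F.groupoid Ψ
    let := F.groupoid Ξ
    exact CategoryTheory.Functor.hext (fun a => (Category.assoc a f g).symm)
      fun a b P => F.comp_map f g P

/-- The functor from the classifying category to groupoids. -/
noncomputable def functor : ClassifyingCategory T ⥤ Grpd.{u, u} := inducedFunctor _ ⋙ F.onCxt

end FundamentalGroupoidFunctor

/-! ## Factorisations -/

/-- The factorisation `i_f`, `p_f` of a map `f` of the classifying category through `Id(f)`, where `f`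
is given by the context morphism `s` from `Φ` to `Ψ`. As `obj`, `i` and `p` are completely
determined, this states that `Id(f)` is a context and that `i_f` and `p_f` are context morphisms. -/
structure IdFactorisation {T : TypeTheory.{u}} {Φ Ψ : Cxt T} (f : Φ.cls ⟶ Ψ.cls)
    (s : List (Expr T.sig)) where
  obj : ClassifyingCategory T
  i : Φ.cls ⟶ obj
  p : obj ⟶ Ψ.cls
  obj_eq : ∃ h : T.Derives (idMor Φ.toList Ψ.toList s) .ctx, obj = Cxt.cls ⟨_, h⟩
  i_eq : ClassifyingCategory.Represents i (iMor Φ.toList Ψ.toList s)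
  p_eq : ClassifyingCategory.Represents p (pMor Ψ.toList)
  fac : i ≫ p = f

namespace CategoryTheory.Grpd

/-- The mapping space `Path(f)`: objects are triples `(a, b, β : f(a) ⟶ b)`, and maps are pairs of
maps which make the evident square commute. -/
noncomputable def path {A B : Grpd.{u, u}} (f : A ⟶ B) : Grpd.{u, u} :=
  letI F : A ⥤ B := f
  letI : Groupoid (Comma F (𝟭 B)) := Groupoid.ofIsIso fun {X Y} (φ : CommaMorphism X Y) =>
    (Comma.isoMk (asIso φ.left) (asIso φ.right) φ.w).isIso_hom
  Grpd.of (Comma F (𝟭 B))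

/-- The functor `a ↦ (a, f(a), 1)`. -/
def iPath {A B : Grpd.{u, u}} (f : A ⟶ B) : A ⟶ path f :=
  letI F : A ⥤ B := f
  show A ⥤ Comma F (𝟭 B) from
    { obj := fun a => { left := a, right := F.obj a, hom := 𝟙 _ }
      map := fun α => { left := α, right := F.map α } }

/-- The functor `(a, b, β) ↦ b`. -/
def pPath {A B : Grpd.{u, u}} (f : A ⟶ B) : path f ⟶ B :=
  letI F : A ⥤ B := f
  show Comma F (𝟭 B) ⥤ B from Comma.snd F (𝟭 B)

/-- The groupoid `J` with two objects and an isomorphism between them. -/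
abbrev J : Type := Codiscrete Bool

/-- The groupoid `A^J` of isomorphisms in `A`. -/
noncomputable def powJ (A : Grpd.{u, u}) : Grpd.{u, u} :=
  letI : Groupoid (J ⥤ A) := Groupoid.ofIsIso fun φ => NatIso.isIso_of_isIso_app φ
  Grpd.of (J ⥤ A)

/-- The functor sending an object to its identity isomorphism. -/
def constJ (A : Grpd.{u, u}) : A ⟶ powJ A := show A ⥤ (J ⥤ A) from Functor.const J

/-- The functor sending an isomorphism to its target. -/
def targetJ (A : Grpd.{u, u}) : powJ A ⟶ A :=
  show (J ⥤ A) ⥤ A from (evaluation J A).obj ⟨true⟩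

/-- A functor of groupoids is an equivalence which is surjective on objects. -/
def SurjectiveEquivalence {A B : Grpd.{u, u}} (f : A ⟶ B) : Prop :=
  letI F : A ⥤ B := f
  F.IsEquivalence ∧ Function.Surjective F.obj

end CategoryTheory.Grpd

/-! ### Calculus of lifted, extended and iterated substitutions -/

namespace Expr

variable {S : Signature.{u}}

/-! Contexts form a category in which projections of dependent contexts behave like fibrations and
identity contexts like path objects. The rule `J` with parameters says exactly that reflexivity, and
each of its pullbacks along a fibration, has the left lifting property against fibrations. Once this
is known, the groupoid structure and the comparison functor come from an argument of abstract
homotopy theory.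

The syntactic work is to extend `J` from types to contexts. For `(Φ, A)`, the element `u'` is an
identification of `u_!(x')` with `y'`. Setting `u` to reflexivity makes the transport definitionally
trivial (`ElimSpec.transport`), so `u'` becomes an element of an ordinary identity type of `A`
(`ElimSpec.lastId_refl`) and can be eliminated. Elimination on `u`, with `x'`, `y'`, `u'` as
parameters, then gives the general case (`ElimSpec.elim_cons`). Everything commutes with
substitution (`jTerm_subst`, `pathCxt_tsubst`), so the lifting property survives any change of base
(`llp_of_isPullback`), and contexts form a `PathCategory` (`Cxt.pathCategory`).

In a path category, a homotopy of paths with fixed endpoints only has to be given after restriction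
along a map with the lifting property (`Htp.extend`). All groupoid and functor laws follow by
restricting some path to a reflexivity, where they are evident. The operations written out as terms
in the statement agree with the abstract ones on reflexivities, hence up to homotopy everywhere
(`invPath_spec`, `mapPath_spec`, `compPath_spec`). Homotopy by means of the identity context of an
identity context agrees with homotopy in the abstract sense (`homotopic_iff`).

The context `Id(f)` is the pullback of the path object of `Ψ` along `f` (`isPullback_mappingSpace`).
It deformation retracts onto `Φ` (`exists_retraction`), so `F(i_f)` is an equivalence. The functor
`σ_f` sends a point `e` of `Id(f)` to its components in `Φ` and `Ψ` together with the class of its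
path. Since `σ_f ∘ F(i_f)` is the equivalence `a ↦ (a, F(f)(a), 1)`, so is `σ_f`. It is surjective
on objects because every path which starts at `f(a)` is the path component of a point of `Id(f)`
over `a`.

The classifying category works with chosen representatives of contexts, so the construction is
carried along the isomorphisms given by the variables. For the special case, the mapping space of an
identity functor consists of commutative squares, that is, of functors on `J` (`exists_powJ`). -/

theorem wk_subst (e : Expr S) (n : ℕ) (σ : ℕ → Expr S) :
    (e.wk n).subst σ = e.subst fun i => σ (i + n) := subst_rename e _ σ

theorem subst_wk (e : Expr S) (n : ℕ) (σ : ℕ → Expr S) :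
    (e.subst σ).wk n = e.subst fun i => (σ i).wk n := rename_subst e σ _

theorem wk_eq_subst (e : Expr S) (n : ℕ) : e.wk n = e.subst fun i => var (i + n) :=
  rename_eq_subst e _

theorem subst_ext {σ τ : ℕ → Expr S} (h : ∀ i, σ i = τ i) (e : Expr S) : e.subst σ = e.subst τ := by
  rw [funext h]

theorem up_zero (σ : ℕ → Expr S) : up 0 σ = σ := by
  funext i
  simp only [up, Nat.not_lt_zero, if_false, Nat.sub_zero, wk_eq_subst, Nat.add_zero]
  exact subst_var _

theorem up_var (n : ℕ) : up n (var : ℕ → Expr S) = var := by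
  funext i
  simp only [up, wk, rename]
  split_ifs
  · rfl
  · congr 1; omega

theorem up_lt {n i : ℕ} (h : i < n) (σ : ℕ → Expr S) : up n σ i = var i := by simp [up, h]

theorem up_add (n i : ℕ) (σ : ℕ → Expr S) : up n σ (i + n) = (σ i).wk n := by simp [up]

theorem up_up (m n : ℕ) (σ : ℕ → Expr S) : up m (up n σ) = up (m + n) σ := by
  funext i
  by_cases h : i < m
  · rw [up_lt h, up_lt (by omega)]
  obtain ⟨j, rfl⟩ : ∃ j, i = j + m := ⟨i - m, by omega⟩
  rw [up_add]
  by_cases h' : j < n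
  · rw [up_lt h', up_lt (by omega)]; simp [wk, rename]
  obtain ⟨k, rfl⟩ : ∃ k, j = k + n := ⟨j - n, by omega⟩
  rw [up_add, show k + n + m = k + (m + n) by omega, up_add, wk_eq_subst (wk n _), wk_subst,
    wk_eq_subst]
  congr 1; funext l; congr 1; omega

theorem subst_up_up (n : ℕ) (σ τ : ℕ → Expr S) (i : ℕ) :
    (up n σ i).subst (up n τ) = up n (fun i => (σ i).subst τ) i := by
  by_cases h : i < n
  · rw [up_lt h, up_lt h, Expr.subst, up_lt h]
  obtain ⟨j, rfl⟩ : ∃ j, i = j + n := ⟨i - n, by omega⟩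
  rw [up_add, up_add, wk_subst, subst_wk]
  simp only [up_add]

theorem up_upR (n : ℕ) (ρ : ℕ → ℕ) (σ : ℕ → Expr S) (i : ℕ) :
    up n σ (upR n ρ i) = up n (fun i => σ (ρ i)) i := by
  simp only [up, upR]; split <;> simp

theorem up_var_comp (n : ℕ) (ρ : ℕ → ℕ) :
    up n (fun i => (var (ρ i) : Expr S)) = fun i => var (upR n ρ i) := by
  funext i; simp only [up, upR]; split <;> simp [wk, rename]

@[simp] theorem length_tsubst (σ : ℕ → Expr S) (Θ : List (Expr S)) :
    (tsubst σ Θ).length = Θ.length := by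
  induction Θ <;> simp_all [tsubst]

@[simp] theorem length_trename (ρ : ℕ → ℕ) (Θ : List (Expr S)) :
    (trename ρ Θ).length = Θ.length := by
  induction Θ <;> simp_all [trename]

@[simp] theorem length_vars (k m : ℕ) : (vars k m : List (Expr S)).length = k := by simp [vars]

theorem trename_eq_tsubst (ρ : ℕ → ℕ) (Θ : List (Expr S)) :
    trename ρ Θ = tsubst (fun i => var (ρ i)) Θ := by
  induction Θ with
  | nil => rfl
  | cons A Θ ih => simp only [trename, tsubst, ih, up_var_comp, rename_eq_subst]

theorem tsubst_tsubst (σ τ : ℕ → Expr S) (Θ : List (Expr S)) :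
    tsubst τ (tsubst σ Θ) = tsubst (fun i => (σ i).subst τ) Θ := by
  induction Θ with
  | nil => rfl
  | cons A Θ ih =>
    simp only [tsubst, ih, subst_subst, length_tsubst]
    congr 2; funext i; exact subst_up_up _ _ _ _

theorem tsubst_trename (ρ : ℕ → ℕ) (τ : ℕ → Expr S) (Θ : List (Expr S)) :
    tsubst τ (trename ρ Θ) = tsubst (fun i => τ (ρ i)) Θ := by
  rw [trename_eq_tsubst, tsubst_tsubst]; rfl

theorem tsubst_var (Θ : List (Expr S)) : tsubst var Θ = Θ := by
  induction Θ with
  | nil => rfl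
  | cons A Θ ih => simp only [tsubst, ih, up_var, subst_var]

theorem tsubst_append (σ : ℕ → Expr S) (Θ Γ : List (Expr S)) :
    tsubst σ (Θ ++ Γ) = tsubst (up Γ.length σ) Θ ++ tsubst σ Γ := by
  induction Θ with
  | nil => rfl
  | cons A Θ ih => simp only [List.cons_append, tsubst, ih, List.length_append, up_up]

theorem push_lt {s : List (Expr S)} {i : ℕ} (h : i < s.length) (σ : ℕ → Expr S) :
    push s σ i = s[i] := by simp [push, List.getD, h]

theorem push_add (s : List (Expr S)) (σ : ℕ → Expr S) (i : ℕ) :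
    push s σ (i + s.length) = σ i := by simp [push, List.getD]

theorem push_add' {s : List (Expr S)} {n : ℕ} (h : s.length = n) (σ : ℕ → Expr S) (i : ℕ) :
    push s σ (i + n) = σ i := by rw [← h, push_add]

theorem push_nil (σ : ℕ → Expr S) : push [] σ = σ := by funext i; simp [push, List.getD]

theorem push_cons_zero (a : Expr S) (s : List (Expr S)) (σ : ℕ → Expr S) :
    push (a :: s) σ 0 = a := rfl

theorem push_cons_succ (a : Expr S) (s : List (Expr S)) (σ : ℕ → Expr S) (i : ℕ) :
    push (a :: s) σ (i + 1) = push s σ i := by simp [push, List.getD]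

theorem push_vars (k m : ℕ) (σ : ℕ → Expr S) (i : ℕ) :
    push (vars k m) σ i = if i < k then var (m + i) else σ (i - k) := by
  by_cases h : i < k
  · rw [push_lt (by simpa using h), if_pos h]; simp [vars]
  · obtain ⟨j, rfl⟩ : ∃ j, i = j + k := ⟨i - k, by omega⟩
    simp [push_add' (length_vars k m)]

theorem subst_push (s : List (Expr S)) (σ τ : ℕ → Expr S) (i : ℕ) :
    (push s σ i).subst τ = push (s.map (Expr.subst τ)) (fun i => (σ i).subst τ) i := by
  by_cases h : i < s.length
  · rw [push_lt h, push_lt (by simpa using h)]; simp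
  · obtain ⟨j, rfl⟩ : ∃ j, i = j + s.length := ⟨i - s.length, by omega⟩
    rw [push_add, push_add' (by simp)]

/-- Plugging in `s` for the last `n` variables after lifting `σ` amounts to one simultaneous
substitution. This collapses iterated instances of dependent contexts to a single `push`. -/
theorem up_subst_push {s : List (Expr S)} {n : ℕ} (hs : s.length = n) (σ τ : ℕ → Expr S) (i : ℕ) :
    (up n σ i).subst (push s τ) = push s (fun i => (σ i).subst τ) i := by
  by_cases h : i < n
  · rw [up_lt h, Expr.subst, push_lt (hs ▸ h), push_lt (hs ▸ h)]
  · obtain ⟨j, rfl⟩ : ∃ j, i = j + n := ⟨i - n, by omega⟩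
    rw [up_add, wk_subst, push_add' hs]
    simp only [push_add' hs]

theorem up_subst_push_var {s : List (Expr S)} {n : ℕ} (hs : s.length = n) (σ : ℕ → Expr S)
    (i : ℕ) : (up n σ i).subst (push s var) = push s σ i := by
  simp only [up_subst_push hs, subst_var]

theorem push_append (s t : List (Expr S)) (σ : ℕ → Expr S) :
    push (s ++ t) σ = push s (push t σ) := by
  funext i
  by_cases h : i < s.length
  · rw [push_lt h, push_lt (by simp; omega)]; simp [h]
  obtain ⟨j, rfl⟩ : ∃ j, i = j + s.length := ⟨i - s.length, by omega⟩
  rw [push_add]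
  by_cases h' : j < t.length
  · rw [push_lt h', push_lt (by simp; omega)]; simp
  obtain ⟨k, rfl⟩ : ∃ k, j = k + t.length := ⟨j - t.length, by omega⟩
  rw [push_add, show k + t.length + s.length = k + (s ++ t).length by simp; omega, push_add]

theorem map_subst_congr {s : List (Expr S)} {n : ℕ} (hs : ∀ e ∈ s, e.Scoped n)
    {σ τ : ℕ → Expr S} (h : ∀ i < n, σ i = τ i) :
    s.map (Expr.subst σ) = s.map (Expr.subst τ) :=
  List.map_congr_left fun e he => subst_congr e (hs e he) h

theorem tsubst_congr {Ψ Γ : List (Expr S)} (h : TScoped (Ψ ++ Γ)) {σ τ : ℕ → Expr S}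
    (hs : ∀ i < Γ.length, σ i = τ i) : tsubst σ Ψ = tsubst τ Ψ := by
  induction Ψ with
  | nil => rfl
  | cons A Ψ ih =>
    simp only [tsubst, ih h.2]
    congr 1
    have h1 : A.Scoped (Ψ ++ Γ).length := h.1
    refine subst_congr A h1 fun i hi => ?_
    simp only [up]
    split_ifs with hh
    · rfl
    · rw [hs _ (by simp at hi; omega)]

end Expr


/-! ### Typed substitutions and their definitional equality -/

namespace TypeTheory

variable {T : TypeTheory.{u}}

/-- `σ` is a substitution from `Γ` to `Δ`: its entries are terms of the types declared in `Γ`. For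
a dependent context `Γ` only the entries for `Γ` are considered. -/
def IsSub (T : TypeTheory.{u}) (Δ : List (Expr T.sig)) (σ : ℕ → Expr T.sig)
    (Γ : List (Expr T.sig)) : Prop :=
  ∀ (i : ℕ) (B : Expr T.sig), Γ[i]? = some B →
    T.Derives Δ (.isTerm (σ i) ((B.wk (i + 1)).subst σ))

/-- Componentwise definitional equality of substitutions. -/
def EqSub (T : TypeTheory.{u}) (Δ : List (Expr T.sig)) (σ τ : ℕ → Expr T.sig)
    (Γ : List (Expr T.sig)) : Prop :=
  ∀ (i : ℕ) (B : Expr T.sig), Γ[i]? = some B →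
    T.Derives Δ (.eqTerm (σ i) (τ i) ((B.wk (i + 1)).subst σ))

theorem isSub_nil (Δ : List (Expr T.sig)) (σ : ℕ → Expr T.sig) : T.IsSub Δ σ [] := by
  intro i B h; simp at h

theorem isSub_cons {Δ Γ : List (Expr T.sig)} {A : Expr T.sig} {σ : ℕ → Expr T.sig} :
    T.IsSub Δ σ (A :: Γ) ↔ T.Derives Δ (.isTerm (σ 0) (A.subst fun j => σ (j + 1))) ∧
      T.IsSub Δ (fun j => σ (j + 1)) Γ := by
  constructor
  · intro h
    refine ⟨by simpa [wk_subst] using h 0 A rfl, fun i B hi => ?_⟩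
    have := h (i + 1) B (by simpa using hi)
    rw [wk_subst] at this ⊢
    exact this
  · rintro ⟨h1, h2⟩ i B hi
    cases i with
    | zero =>
      obtain rfl : A = B := by simpa using hi
      simpa [wk_subst] using h1
    | succ i =>
      have := h2 i B (by simpa using hi)
      rw [wk_subst] at this ⊢
      exact this

theorem eqSub_nil (Δ : List (Expr T.sig)) (σ τ : ℕ → Expr T.sig) : T.EqSub Δ σ τ [] := by
  intro i B h; simp at h

theorem eqSub_cons {Δ Γ : List (Expr T.sig)} {A : Expr T.sig} {σ τ : ℕ → Expr T.sig} :
    T.EqSub Δ σ τ (A :: Γ) ↔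
      T.Derives Δ (.eqTerm (σ 0) (τ 0) (A.subst fun j => σ (j + 1))) ∧
      T.EqSub Δ (fun j => σ (j + 1)) (fun j => τ (j + 1)) Γ := by
  constructor
  · intro h
    refine ⟨by simpa [wk_subst] using h 0 A rfl, fun i B hi => ?_⟩
    have := h (i + 1) B (by simpa using hi)
    rw [wk_subst] at this ⊢
    exact this
  · rintro ⟨h1, h2⟩ i B hi
    cases i with
    | zero =>
      obtain rfl : A = B := by simpa using hi
      simpa [wk_subst] using h1
    | succ i =>
      have := h2 i B (by simpa using hi)
      rw [wk_subst] at this ⊢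
      exact this

theorem isSub_append {Δ Ψ Γ : List (Expr T.sig)} {σ : ℕ → Expr T.sig} :
    T.IsSub Δ σ (Ψ ++ Γ) ↔ T.IsSub Δ σ Ψ ∧ T.IsSub Δ (fun j => σ (j + Ψ.length)) Γ := by
  induction Ψ generalizing σ with
  | nil => simp [isSub_nil]
  | cons A Ψ ih =>
    rw [List.cons_append, isSub_cons, isSub_cons, ih, and_assoc]
    simp only [List.length_cons]
    simp only [show ∀ j, j + Ψ.length + 1 = j + (Ψ.length + 1) from fun j => by omega]

theorem eqSub_append {Δ Ψ Γ : List (Expr T.sig)} {σ τ : ℕ → Expr T.sig} :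
    T.EqSub Δ σ τ (Ψ ++ Γ) ↔ T.EqSub Δ σ τ Ψ ∧
      T.EqSub Δ (fun j => σ (j + Ψ.length)) (fun j => τ (j + Ψ.length)) Γ := by
  induction Ψ generalizing σ τ with
  | nil => simp [eqSub_nil]
  | cons A Ψ ih =>
    rw [List.cons_append, eqSub_cons, eqSub_cons, ih, and_assoc]
    simp only [List.length_cons]
    simp only [show ∀ j, j + Ψ.length + 1 = j + (Ψ.length + 1) from fun j => by omega]

theorem glue_aux {S : Signature.{u}} (Ψ : List (Expr S)) (A : Expr S) (σ τ : ℕ → Expr S) (j : ℕ) :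
    (up Ψ.length τ j).subst (fun j => σ (j + 1)) =
      if j + 1 < (A :: Ψ).length then σ (j + 1)
      else (τ (j + 1 - (A :: Ψ).length)).subst fun i => σ (i + (A :: Ψ).length) := by
  by_cases h : j < Ψ.length
  · rw [up_lt h, if_pos (by simpa using h)]; rfl
  · obtain ⟨k, rfl⟩ : ∃ k, j = k + Ψ.length := ⟨j - Ψ.length, by omega⟩
    rw [up_add, if_neg (by simp), wk_subst]
    simp only [List.length_cons]
    congr 1
    congr 1; omega

/-- An entry of `tsubst τ Ψ` refers to the earlier variables of `Ψ` directly and to all others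
through `τ`. Composing with `σ` in the second case gives conditions on the original `Ψ`, so that
substituted contexts never have to be inspected entry by entry. -/
theorem isSub_tsubst {Δ Ψ : List (Expr T.sig)} {σ τ : ℕ → Expr T.sig} :
    T.IsSub Δ σ (tsubst τ Ψ) ↔ T.IsSub Δ (fun j => if j < Ψ.length then σ j
      else (τ (j - Ψ.length)).subst fun i => σ (i + Ψ.length)) Ψ := by
  induction Ψ generalizing σ with
  | nil => simp [isSub_nil, tsubst]
  | cons A Ψ ih =>
    rw [tsubst, isSub_cons, isSub_cons, ih]
    simp only [subst_subst, glue_aux Ψ A]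
    rw [if_pos (by simp)]
    simp only [List.length_cons, Nat.add_lt_add_iff_right, Nat.add_sub_add_right, Nat.add_assoc]

theorem eqSub_tsubst {Δ Ψ : List (Expr T.sig)} {σ σ' τ : ℕ → Expr T.sig} :
    T.EqSub Δ σ σ' (tsubst τ Ψ) ↔ T.EqSub Δ (fun j => if j < Ψ.length then σ j
      else (τ (j - Ψ.length)).subst fun i => σ (i + Ψ.length)) (fun j => if j < Ψ.length then σ' j
      else (τ (j - Ψ.length)).subst fun i => σ' (i + Ψ.length)) Ψ := by
  induction Ψ generalizing σ σ' with
  | nil => simp [eqSub_nil, tsubst]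
  | cons A Ψ ih =>
    rw [tsubst, eqSub_cons, eqSub_cons, ih]
    simp only [subst_subst, glue_aux Ψ A]
    rw [if_pos (by simp), if_pos (by simp)]
    simp only [List.length_cons, Nat.add_lt_add_iff_right, Nat.add_sub_add_right, Nat.add_assoc]

/-! ### Contexts and presuppositions -/

theorem Derives.ctx {Γ : List (Expr T.sig)} {𝒥 : Judgement T.sig} (h : T.Derives Γ 𝒥) :
    T.Derives Γ .ctx := by
  induction h with
  | rule hr hp hΓ h𝒥 hs _ ih _ => exact hΓ
  | nil => exact .nil
  | cons hΓ hA => exact .cons hΓ hA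
  | var hΓ => exact hΓ
  | subst _ hΔ => exact hΔ
  | substEqType _ hΔ => exact hΔ
  | substEqTerm _ hΔ => exact hΔ
  | reflType _ ih => exact ih
  | symmType _ ih => exact ih
  | transType _ _ ih => exact ih
  | reflTerm _ ih => exact ih
  | symmTerm _ ih => exact ih
  | transTerm _ _ ih => exact ih
  | conv _ _ ih => exact ih
  | convEq _ _ ih => exact ih
  | idForm _ _ _ ih => exact ih
  | idIntro _ _ ih => exact ih
  | idElim hA hC hd ha hb hp ht ih => exact ih
  | idComp hA hC hd ha ht ih => exact ih

/-- The induction runs over all judgements because `cons` is not the only rule that can conclude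
`ctx`: a rule of the theory or `subst` can do so too. Those rules have the well-formedness of the
same context as a premiss, so the induction reaches a `cons`. -/
theorem Derives.ctx_inv {Γ : List (Expr T.sig)} {𝒥 : Judgement T.sig} (h : T.Derives Γ 𝒥) :
    ∀ {A : Expr T.sig} {Γ' : List (Expr T.sig)}, Γ = A :: Γ' → T.Derives Γ' (.isType A) := by
  induction h with
  | rule hr hp hΓ h𝒥 hs _ ih _ => exact ih
  | nil => intro A Γ' h; cases h
  | cons hΓ hA => intro A Γ' h; cases h; exact hA
  | var hΓ _ ih => exact ih
  | subst _ hΔ _ _ ih => exact ih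
  | substEqType _ hΔ _ _ _ _ ih => exact ih
  | substEqTerm _ hΔ _ _ _ _ ih => exact ih
  | reflType _ ih => exact ih
  | symmType _ ih => exact ih
  | transType _ _ ih => exact ih
  | reflTerm _ ih => exact ih
  | symmTerm _ ih => exact ih
  | transTerm _ _ ih => exact ih
  | conv _ _ ih => exact ih
  | convEq _ _ ih => exact ih
  | idForm _ _ _ ih => exact ih
  | idIntro _ _ ih => exact ih
  | idElim hA hC hd ha hb hp ht ih => exact ih
  | idComp hA hC hd ha ht ih => exact ih

theorem Derives.head {Γ : List (Expr T.sig)} {A : Expr T.sig} (h : T.Derives (A :: Γ) .ctx) :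
    T.Derives Γ (.isType A) := h.ctx_inv rfl

theorem Derives.tail {Γ : List (Expr T.sig)} {A : Expr T.sig} (h : T.Derives (A :: Γ) .ctx) :
    T.Derives Γ .ctx := h.head.ctx

theorem Derives.of_append {Ψ Γ : List (Expr T.sig)} (h : T.Derives (Ψ ++ Γ) .ctx) :
    T.Derives Γ .ctx := by
  induction Ψ with
  | nil => exact h
  | cons A Ψ ih => exact ih h.tail

theorem IsSub.var {Γ : List (Expr T.sig)} (h : T.Derives Γ .ctx) : T.IsSub Γ .var Γ := by
  intro i B hi
  rw [subst_var]
  exact .var h hi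

theorem IsSub.wk {Ψ Γ : List (Expr T.sig)} (h : T.Derives (Ψ ++ Γ) .ctx) :
    T.IsSub (Ψ ++ Γ) (fun i => .var (i + Ψ.length)) Γ := by
  have := (isSub_append.1 (IsSub.var h)).2
  exact this

theorem Derives.wk {Ψ Γ : List (Expr T.sig)} {𝒥 : Judgement T.sig} (h : T.Derives Γ 𝒥)
    (hΨ : T.Derives (Ψ ++ Γ) .ctx) :
    T.Derives (Ψ ++ Γ) (𝒥.subst fun i => .var (i + Ψ.length)) :=
  .subst h hΨ (IsSub.wk hΨ)

theorem Derives.get {Γ : List (Expr T.sig)} (h : T.Derives Γ .ctx) {i : ℕ} {A : Expr T.sig}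
    (hi : Γ[i]? = some A) : T.Derives Γ (.isType (A.wk (i + 1))) := by
  induction Γ generalizing i with
  | nil => simp at hi
  | cons B Γ ih =>
    cases i with
    | zero =>
      obtain rfl : B = A := by simpa using hi
      have := h.head.wk (Ψ := [B]) h
      simpa [Judgement.subst, wk_eq_subst] using this
    | succ i =>
      have := (ih h.tail (by simpa using hi)).wk (Ψ := [B]) h
      simpa [Judgement.subst, wk_eq_subst, subst_subst, Expr.subst, Nat.add_assoc] using this

theorem isElem_iff {Γ s Ψ : List (Expr T.sig)} :
    T.IsElem Γ s Ψ ↔ s.length = Ψ.length ∧ T.IsSub Γ (push s .var) Ψ := Iff.rfl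

theorem glue_push {S : Signature.{u}} {s : List (Expr S)} {n : ℕ} (hs : s.length = n)
    (σ : ℕ → Expr S) :
    (fun j => if j < n then push s Expr.var j
      else (σ (j - n)).subst fun i => push s Expr.var (i + n)) = push s σ := by
  funext j
  by_cases h : j < n
  · rw [if_pos h, push_lt (hs ▸ h), push_lt (hs ▸ h)]
  · obtain ⟨k, rfl⟩ : ∃ k, j = k + n := ⟨j - n, by omega⟩
    rw [if_neg h, push_add' hs]
    simp [push_add' hs, subst_var]

/-- An element of `Ψ` at the parameters `σ` is the same as an extension of `σ` to the variables of
`Ψ`. This is the passage between dependent elements and substitutions used from here on. -/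
theorem isElem_tsubst_iff {Δ s Ψ : List (Expr T.sig)} {σ : ℕ → Expr T.sig} :
    T.IsElem Δ s (tsubst σ Ψ) ↔ s.length = Ψ.length ∧ T.IsSub Δ (push s σ) Ψ := by
  rw [isElem_iff, length_tsubst]
  refine and_congr_right fun h => ?_
  rw [isSub_tsubst, glue_push h]

theorem eqElem_tsubst_iff {Δ s s' Ψ : List (Expr T.sig)} {σ : ℕ → Expr T.sig}
    (hs : s.length = Ψ.length) (hs' : s'.length = Ψ.length) :
    T.EqElem Δ s s' (tsubst σ Ψ) ↔ T.EqSub Δ (push s σ) (push s' σ) Ψ := by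
  change T.EqSub Δ _ _ _ ↔ _
  rw [eqSub_tsubst, glue_push hs, glue_push hs']

theorem IsSub.push {Δ Γ s Ψ : List (Expr T.sig)} {σ : ℕ → Expr T.sig} (hσ : T.IsSub Δ σ Γ)
    (hs : T.IsElem Δ s (tsubst σ Ψ)) : T.IsSub Δ (push s σ) (Ψ ++ Γ) := by
  obtain ⟨h1, h2⟩ := isElem_tsubst_iff.1 hs
  refine isSub_append.2 ⟨h2, ?_⟩
  simpa only [push_add' h1] using hσ

theorem isElem_of_derives {Γ Θ : List (Expr T.sig)} {k : ℕ} {t : Fin k → Expr T.sig}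
    (hk : Θ.length = k)
    (ht : ∀ (i : Fin k) (B : Expr T.sig), Θ[(i : ℕ)]? = some B →
        T.Derives Γ (.isTerm (t i) ((B.wk (i + 1)).subst (Expr.push (List.ofFn t) .var)))) :
    T.IsElem Γ (List.ofFn t) Θ := by
  refine ⟨by simp [hk], fun i B hi => ?_⟩
  have hi' : i < k := hk ▸ (List.getElem?_eq_some_iff.1 hi).1
  have := ht ⟨i, hi'⟩ B hi
  rw [push_lt (by simpa using hi')]
  simpa using this

theorem IsSub.jPoint {Γ : List (Expr T.sig)} {A a b p : Expr T.sig}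
    (hΓ : T.Derives Γ .ctx) (ha : T.Derives Γ (.isTerm a A))
    (hb : T.Derives Γ (.isTerm b A)) (hp : T.Derives Γ (.isTerm p (.Id A a b))) :
    T.IsSub Γ (Expr.push [p, b, a] .var) (.Id (A.wk 2) (.var 1) (.var 0) :: A.wk 1 :: A :: Γ) := by
  simp only [isSub_cons, push_cons_zero, push_cons_succ, push_nil, wk_subst, subst_var, Expr.subst]
  refine ⟨hp, hb, ha, ?_⟩
  exact IsSub.var hΓ

/-- For rules of the theory this is built into `Derives.rule`. For the identity rules, the type of
the conclusion is an instance of `C` along a well-typed substitution; in `idComp`, the right-hand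
side is likewise an instance of `d`. -/
theorem Derives.presup {Γ : List (Expr T.sig)} {𝒥 : Judgement T.sig} (h : T.Derives Γ 𝒥) :
    ∀ j ∈ 𝒥.presup, T.Derives Γ j := by
  induction h with
  | rule hr hp hΓ h𝒥 hs _ ih _ => exact h𝒥
  | nil => simpa [Judgement.presup] using .nil
  | cons hΓ hA => simpa [Judgement.presup] using .cons hΓ hA
  | var hΓ hi => simpa [Judgement.presup] using hΓ.get hi
  | @subst Γ Δ 𝒥 σ h hΔ hσ ih =>
    cases 𝒥 with
    | ctx => simpa [Judgement.presup, Judgement.subst] using hΔ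
    | isType A => simp [Judgement.presup, Judgement.subst]
    | isTerm a A =>
      simp only [Judgement.presup, List.mem_singleton, forall_eq, Judgement.subst] at ih ⊢
      exact .subst ih hΔ hσ
    | eqType A B =>
      simp only [Judgement.presup, List.mem_cons, List.not_mem_nil, or_false, forall_eq_or_imp,
        forall_eq, Judgement.subst] at ih ⊢
      exact ⟨.subst ih.1 hΔ hσ, .subst ih.2 hΔ hσ⟩
    | eqTerm a b A =>
      simp only [Judgement.presup, List.mem_cons, List.not_mem_nil, or_false, forall_eq_or_imp,
        forall_eq, Judgement.subst] at ih ⊢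
      exact ⟨.subst ih.1 hΔ hσ, .subst ih.2 hΔ hσ⟩
  | substEqType h hΔ hσ hτ hστ =>
    simp only [Judgement.presup, List.mem_cons, List.not_mem_nil, or_false, forall_eq_or_imp,
        forall_eq]
    exact ⟨.subst h hΔ hσ, .subst h hΔ hτ⟩
  | substEqTerm h hΔ hσ hτ hστ ih =>
    simp only [Judgement.presup, List.mem_cons, List.not_mem_nil, or_false, forall_eq_or_imp,
        forall_eq] at ih ⊢
    -- The term substituted along `τ` naturally has type `A.subst τ`; `substEqType` moves it back to
    -- `A.subst σ`.
    exact ⟨.subst h hΔ hσ, .conv (.subst h hΔ hτ) (.symmType (.substEqType ih hΔ hσ hτ hστ))⟩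
  | reflType hA => simpa [Judgement.presup] using hA
  | symmType _ ih => simp_all [Judgement.presup]
  | transType _ _ ih ih' => simp_all [Judgement.presup]
  | reflTerm hA => simpa [Judgement.presup] using hA
  | symmTerm _ ih => simp_all [Judgement.presup]
  | transTerm _ _ ih ih' => simp_all [Judgement.presup]
  | conv _ _ ih ih' => simp_all [Judgement.presup]
  | convEq _ h ih ih' =>
    simp only [Judgement.presup, List.mem_cons, List.not_mem_nil, or_false, forall_eq_or_imp,
        forall_eq] at ih ⊢
    exact ⟨.conv ih.1 h, .conv ih.2 h⟩
  | idForm _ _ _ => simp [Judgement.presup]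
  | idIntro hA ha => simpa [Judgement.presup] using .idForm hA ha ha
  | idElim hA hC hd ha hb hp ht =>
    simp only [Judgement.presup, List.mem_singleton, forall_eq]
    refine .subst hC hA.ctx ((IsSub.jPoint hA.ctx ha hb hp).push ?_)
    exact isElem_of_derives (by simp) ht
  | @idComp Γ k A Θ C d a t hA hC hd ha ht =>
    simp only [Judgement.presup, List.mem_cons, List.not_mem_nil, or_false, forall_eq_or_imp,
        forall_eq]
    have hr := Derives.idIntro hA ha
    refine ⟨.idElim hA hC hd ha ha hr ht, ?_⟩
    have h1 : T.IsSub Γ (Expr.push [a] .var) (A :: Γ) := by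
      simp only [isSub_cons, push_cons_zero, push_cons_succ, push_nil, subst_var]
      exact ⟨ha, IsSub.var hA.ctx⟩
    have h2 : T.IsElem Γ (List.ofFn t) (tsubst (Expr.push [a] .var)
        (tsubst (Expr.push [.refl (.var 0), .var 0] .var) (List.ofFn Θ))) := by
      rw [tsubst_tsubst]
      refine isElem_of_derives (by simp) ?_
      convert ht using 8
      rename_i j
      rcases j with _ | _ | j <;> rfl
    have h3 := Derives.subst hd hA.ctx (h1.push h2)
    convert h3 using 1
    simp only [Judgement.subst, subst_subst]
    congr 2
    funext j
    by_cases h : j < k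
    · rw [up_lt h, push_lt (by simpa using h)]
      simp [Expr.subst, push_lt, h]
    · obtain ⟨j, rfl⟩ : ∃ i, j = i + k := ⟨j - k, by omega⟩
      rw [up_add, push_add' (by simp), wk_subst]
      simp only [push_add' (List.length_ofFn (f := t))]
      rcases j with _ | _ | j <;> rfl

theorem Derives.isType {Γ : List (Expr T.sig)} {a A : Expr T.sig}
    (h : T.Derives Γ (.isTerm a A)) : T.Derives Γ (.isType A) := h.presup _ (by simp [Judgement.presup])

theorem Derives.eqType_left {Γ : List (Expr T.sig)} {A B : Expr T.sig}
    (h : T.Derives Γ (.eqType A B)) : T.Derives Γ (.isType A) := h.presup _ (by simp [Judgement.presup])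

theorem Derives.eqType_right {Γ : List (Expr T.sig)} {A B : Expr T.sig}
    (h : T.Derives Γ (.eqType A B)) : T.Derives Γ (.isType B) := h.presup _ (by simp [Judgement.presup])

theorem Derives.eqTerm_left {Γ : List (Expr T.sig)} {a b A : Expr T.sig}
    (h : T.Derives Γ (.eqTerm a b A)) : T.Derives Γ (.isTerm a A) := h.presup _ (by simp [Judgement.presup])

theorem Derives.eqTerm_right {Γ : List (Expr T.sig)} {a b A : Expr T.sig}
    (h : T.Derives Γ (.eqTerm a b A)) : T.Derives Γ (.isTerm b A) := h.presup _ (by simp [Judgement.presup])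

end TypeTheory
namespace Judgement

theorem subst_var {S : Signature.{u}} (𝒥 : Judgement S) : 𝒥.subst Expr.var = 𝒥 := by
  cases 𝒥 <;> simp [subst, Expr.subst_var]

end Judgement

namespace TypeTheory

variable {T : TypeTheory.{u}}

/-! ### Substitutions -/

theorem IsSub.comp {Γ Δ Ξ : List (Expr T.sig)} {σ τ : ℕ → Expr T.sig} (hσ : T.IsSub Δ σ Γ)
    (hτ : T.IsSub Ξ τ Δ) (hΞ : T.Derives Ξ .ctx) : T.IsSub Ξ (fun i => (σ i).subst τ) Γ := by
  intro i B hi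
  have := Derives.subst (hσ i B hi) hΞ hτ
  rwa [Judgement.subst, subst_subst] at this

theorem IsSub.wk_comp {Γ Δ Ψ : List (Expr T.sig)} {σ : ℕ → Expr T.sig} (hσ : T.IsSub Δ σ Γ)
    (h : T.Derives (Ψ ++ Δ) .ctx) : T.IsSub (Ψ ++ Δ) (fun i => (σ i).wk Ψ.length) Γ := by
  simpa only [← wk_eq_subst] using hσ.comp (IsSub.wk h) h

/-- The two claims depend on each other: an entry of the substituted context is well-formed by
substitution along the lift, and the lift is typed in the context extended by that entry. -/
theorem IsSub.up_aux {Γ Δ : List (Expr T.sig)} {σ : ℕ → Expr T.sig} (hσ : T.IsSub Δ σ Γ)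
    (hΔ : T.Derives Δ .ctx) {Ψ : List (Expr T.sig)} (hΨ : T.Derives (Ψ ++ Γ) .ctx) :
    T.Derives (tsubst σ Ψ ++ Δ) .ctx ∧ T.IsSub (tsubst σ Ψ ++ Δ) (up Ψ.length σ) (Ψ ++ Γ) := by
  induction Ψ with
  | nil => exact ⟨hΔ, by simpa [up_zero, tsubst] using hσ⟩
  | cons A Ψ ih =>
    obtain ⟨h1, h2⟩ := ih hΨ.tail
    have h3 : T.Derives (tsubst σ (A :: Ψ) ++ Δ) .ctx := .cons h1 (.subst hΨ.head h1 h2)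
    refine ⟨h3, ?_⟩
    rw [List.cons_append, isSub_cons, List.length_cons, Nat.add_comm _ 1, ← up_up]
    have h4 := h2.wk_comp (Ψ := [A.subst (up Ψ.length σ)]) h3
    refine ⟨?_, ?_⟩
    · simp only [up_add]
      have := Derives.var (i := 0) h3 rfl
      rwa [subst_wk] at this
    · simpa only [up_add] using! h4

theorem IsSub.up {Γ Δ : List (Expr T.sig)} {σ : ℕ → Expr T.sig} (hσ : T.IsSub Δ σ Γ)
    (hΔ : T.Derives Δ .ctx) {Ψ : List (Expr T.sig)} (hΨ : T.Derives (Ψ ++ Γ) .ctx) :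
    T.IsSub (tsubst σ Ψ ++ Δ) (up Ψ.length σ) (Ψ ++ Γ) := (hσ.up_aux hΔ hΨ).2

theorem IsSub.tsubst_ctx {Γ Δ : List (Expr T.sig)} {σ : ℕ → Expr T.sig} (hσ : T.IsSub Δ σ Γ)
    (hΔ : T.Derives Δ .ctx) {Ψ : List (Expr T.sig)} (hΨ : T.Derives (Ψ ++ Γ) .ctx) :
    T.Derives (tsubst σ Ψ ++ Δ) .ctx := (hσ.up_aux hΔ hΨ).1

/-- The hypothesis says that the variables of `Γ'` have the types declared in `Γ` up to conversion.
Change of context along definitional equality is thus a special case of substitution. -/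
theorem Derives.conv_ctx {Γ Γ' : List (Expr T.sig)} {𝒥 : Judgement T.sig} (h : T.Derives Γ 𝒥)
    (hs : T.IsSub Γ' .var Γ) (hΓ' : T.Derives Γ' .ctx) : T.Derives Γ' 𝒥 := by
  simpa only [Judgement.subst_var] using Derives.subst h hΓ' hs

theorem IsSub.up_var {Γ Γ' : List (Expr T.sig)} (hs : T.IsSub Γ' .var Γ)
    (hΓ' : T.Derives Γ' .ctx) {Ψ : List (Expr T.sig)} (hΨ : T.Derives (Ψ ++ Γ) .ctx) :
    T.IsSub (Ψ ++ Γ') .var (Ψ ++ Γ) := by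
  simpa only [tsubst_var, Expr.up_var] using hs.up hΓ' hΨ

theorem IsSub.var_cons {Γ : List (Expr T.sig)} {A B : Expr T.sig}
    (h : T.Derives Γ (.eqType A B)) : T.IsSub (B :: Γ) .var (A :: Γ) := by
  have hB := Derives.cons h.ctx h.eqType_right
  refine isSub_cons.2 ⟨?_, IsSub.wk (Ψ := [B]) hB⟩
  have h1 := (Derives.symmType h).wk (Ψ := [B]) hB
  have h2 := Derives.var (i := 0) hB rfl
  rw [wk_eq_subst] at h2
  exact h2.conv h1

theorem IsSub.eqType {Γ Δ : List (Expr T.sig)} {σ τ : ℕ → Expr T.sig} (hσ : T.IsSub Δ σ Γ)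
    (hτ : T.IsSub Δ τ Γ) (h : T.EqSub Δ σ τ Γ) (hΔ : T.Derives Δ .ctx) {A : Expr T.sig}
    (hA : T.Derives Γ (.isType A)) : T.Derives Δ (.eqType (A.subst σ) (A.subst τ)) :=
  .substEqType hA hΔ hσ hτ h

/-- The equations are typed by `σ`, whereas the entries of `τ` must have types instantiated at `τ`.
By induction the earlier entries are well-typed, and then `substEqType` provides the conversion. -/
theorem EqSub.isSub_right {Γ Δ : List (Expr T.sig)} {σ τ : ℕ → Expr T.sig}
    (h : T.EqSub Δ σ τ Γ) (hσ : T.IsSub Δ σ Γ) (hΔ : T.Derives Δ .ctx) (hΓ : T.Derives Γ .ctx) :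
    T.IsSub Δ τ Γ := by
  induction Γ generalizing σ τ with
  | nil => exact isSub_nil _ _
  | cons A Γ ih =>
    rw [eqSub_cons] at h
    rw [isSub_cons] at hσ ⊢
    have h1 := ih h.2 hσ.2 hΓ.tail
    exact ⟨h.1.eqTerm_right.conv (hσ.2.eqType h1 h.2 hΔ hΓ.head), h1⟩

theorem EqSub.refl {Γ Δ : List (Expr T.sig)} {σ : ℕ → Expr T.sig} (hσ : T.IsSub Δ σ Γ) :
    T.EqSub Δ σ σ Γ := fun i B hi => .reflTerm (hσ i B hi)

theorem EqSub.symm {Γ Δ : List (Expr T.sig)} {σ τ : ℕ → Expr T.sig}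
    (h : T.EqSub Δ σ τ Γ) (hσ : T.IsSub Δ σ Γ) (hΔ : T.Derives Δ .ctx) (hΓ : T.Derives Γ .ctx) :
    T.EqSub Δ τ σ Γ := fun i B hi =>
  .convEq (.symmTerm (h i B hi)) (hσ.eqType (h.isSub_right hσ hΔ hΓ) h hΔ (hΓ.get hi))

theorem EqSub.trans {Γ Δ : List (Expr T.sig)} {σ τ υ : ℕ → Expr T.sig}
    (h : T.EqSub Δ σ τ Γ) (h' : T.EqSub Δ τ υ Γ) (hσ : T.IsSub Δ σ Γ) (hΔ : T.Derives Δ .ctx)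
    (hΓ : T.Derives Γ .ctx) : T.EqSub Δ σ υ Γ := fun i B hi =>
  .transTerm (h i B hi) (.convEq (h' i B hi) (.symmType
    (hσ.eqType (h.isSub_right hσ hΔ hΓ) h hΔ (hΓ.get hi))))

theorem EqSub.push_left {Γ Δ s Ψ : List (Expr T.sig)} {σ τ : ℕ → Expr T.sig}
    (h : T.EqSub Δ σ τ Γ) (hs : T.IsElem Δ s (tsubst σ Ψ)) :
    T.EqSub Δ (Expr.push s σ) (Expr.push s τ) (Ψ ++ Γ) := by
  obtain ⟨h1, h2⟩ := isElem_tsubst_iff.1 hs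
  refine eqSub_append.2 ⟨fun i B hi => ?_, ?_⟩
  · have hi' : i < s.length := h1 ▸ (List.getElem?_eq_some_iff.1 hi).1
    have := h2 i B hi
    have h3 : Expr.push s τ i = Expr.push s σ i := by rw [push_lt hi', push_lt hi']
    rw [h3]
    exact .reflTerm this
  · simpa only [push_add' h1] using h

/-- The sequence itself is unchanged: only its types, which depend on `σ`, are converted. -/
theorem IsElem.conv {Γ Δ s Ψ : List (Expr T.sig)} {σ τ : ℕ → Expr T.sig}
    (hs : T.IsElem Δ s (tsubst σ Ψ)) (h : T.EqSub Δ σ τ Γ) (hσ : T.IsSub Δ σ Γ)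
    (hΔ : T.Derives Δ .ctx) (hΨ : T.Derives (Ψ ++ Γ) .ctx) : T.IsElem Δ s (tsubst τ Ψ) :=
  isElem_tsubst_iff.2 ⟨by simpa using hs.1,
    (isSub_append.1 ((h.push_left hs).isSub_right (hσ.push hs) hΔ hΨ)).1⟩

theorem EqSub.push {Δ Γ s s' Ψ : List (Expr T.sig)} {σ τ : ℕ → Expr T.sig}
    (h : T.EqSub Δ σ τ Γ) (hσ : T.IsSub Δ σ Γ) (hs : T.IsElem Δ s (tsubst σ Ψ))
    (hs' : T.IsElem Δ s' (tsubst σ Ψ)) (hss : T.EqElem Δ s s' (tsubst σ Ψ))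
    (hΔ : T.Derives Δ .ctx) (hΨ : T.Derives (Ψ ++ Γ) .ctx) :
    T.EqSub Δ (Expr.push s σ) (Expr.push s' τ) (Ψ ++ Γ) := by
  have l1 : s.length = Ψ.length := by simpa using hs.1
  have l2 : s'.length = Ψ.length := by simpa using hs'.1
  rw [eqElem_tsubst_iff l1 l2] at hss
  refine EqSub.trans (τ := Expr.push s' σ) ?_ (h.push_left hs') (hσ.push hs) hΔ hΨ
  refine eqSub_append.2 ⟨hss, ?_⟩
  simpa only [push_add' l1, push_add' l2] using EqSub.refl hσ

/-- Congruence of identity types in their end points. -/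
theorem Derives.id_congr {Γ : List (Expr T.sig)} {A a a' b b' : Expr T.sig}
    (ha : T.Derives Γ (.eqTerm a a' A)) (hb : T.Derives Γ (.eqTerm b b' A)) :
    T.Derives Γ (.eqType (.Id A a b) (.Id A a' b')) := by
  have hA := ha.eqTerm_left.isType
  have c1 := Derives.cons hA.ctx hA
  have hA1 := hA.wk (Ψ := [A]) c1
  simp only [Judgement.subst, List.length_singleton, ← wk_eq_subst] at hA1
  have c2 := Derives.cons c1 hA1
  have v0 := Derives.var (i := 0) c2 rfl
  have v1 := Derives.var (i := 1) c2 rfl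
  have e : (A.wk 1).wk 1 = A.wk 2 := by
    rw [wk_eq_subst (A.wk 1), wk_subst, wk_eq_subst]
  have s1 : T.IsSub Γ (Expr.push [b, a] .var) (A.wk 1 :: A :: Γ) := by
    simp only [isSub_cons, push_cons_zero, push_cons_succ, push_nil, wk_subst, subst_var]
    exact ⟨hb.eqTerm_left, ha.eqTerm_left, IsSub.var hA.ctx⟩
  have s2 : T.IsSub Γ (Expr.push [b', a'] .var) (A.wk 1 :: A :: Γ) := by
    simp only [isSub_cons, push_cons_zero, push_cons_succ, push_nil, wk_subst, subst_var]
    exact ⟨hb.eqTerm_right, ha.eqTerm_right, IsSub.var hA.ctx⟩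
  have s3 : T.EqSub Γ (Expr.push [b, a] .var) (Expr.push [b', a'] .var) (A.wk 1 :: A :: Γ) := by
    simp only [eqSub_cons, push_cons_zero, push_cons_succ, push_nil, wk_subst, subst_var]
    exact ⟨hb, ha, EqSub.refl (IsSub.var hA.ctx)⟩
  have hA2 : T.Derives (A.wk 1 :: A :: Γ) (.isType (A.wk 2)) := v1.isType
  rw [Nat.zero_add, e] at v0
  -- Congruence of `Id` in its end points is not a rule. It is obtained by substituting
  -- definitionally equal pairs into the generic identity type between two variables of type `A`.
  have := s1.eqType s2 s3 hA.ctx (Derives.idForm hA2 v1 v0)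
  have e2 : ∀ a b : Expr T.sig, (A.wk 2).subst (Expr.push [b, a] .var) = A := by
    intro a b
    rw [wk_subst]
    simp only [push_add' (show [b, a].length = 2 from rfl), subst_var]
  simp only [Expr.subst, e2] at this
  exact this

/-! ### Elimination for a single type -/

theorem _root_.Expr.getD_tsubst {S : Signature.{u}} (σ : ℕ → Expr S) (Θ : List (Expr S)) {i : ℕ}
    (hi : i < Θ.length) (e e' : Expr S) :
    (tsubst σ Θ).getD i e = (Θ.getD i e').subst (Expr.up (Θ.length - 1 - i) σ) := by
  induction Θ generalizing i with
  | nil => simp at hi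
  | cons A Θ ih =>
    cases i with
    | zero => simp [tsubst]
    | succ i =>
      simp only [tsubst, List.getD_cons_succ]
      rw [ih (by simpa using hi)]
      simp only [List.length_cons]
      congr 2; omega

theorem _root_.Expr.ofFn_getD {S : Signature.{u}} (L : List (Expr S)) {l : ℕ} (h : L.length = l)
    (e : Expr S) : List.ofFn (fun i : Fin l => L.getD i e) = L := by
  subst h
  refine List.ext_getElem (by simp) fun i h1 h2 => ?_
  simp

/-- The instance of the elimination rule at `a`, `b`, `p` and `t` and at parameters `σ`. -/
def _root_.Expr.jApp {S : Signature.{u}} (A : Expr S) (Θ : List (Expr S)) (C d : Expr S)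
    (σ : ℕ → Expr S) (a b p : Expr S) (t : List (Expr S)) : Expr S :=
  .J Θ.length (A.subst σ) (fun i => (tsubst (Expr.up 3 σ) Θ).getD i (.var 0))
    (C.subst (Expr.up (3 + Θ.length) σ)) (d.subst (Expr.up (1 + Θ.length) σ)) a b p
    fun i => t.getD i (.var 0)

theorem _root_.Expr.jApp_subst {S : Signature.{u}} (A : Expr S) (Θ : List (Expr S)) (C d : Expr S)
    (σ : ℕ → Expr S) (a b p : Expr S) {t : List (Expr S)} (ht : t.length = Θ.length)
    (τ : ℕ → Expr S) : (jApp A Θ C d σ a b p t).subst τ =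
      jApp A Θ C d (fun i => (σ i).subst τ) (a.subst τ) (b.subst τ) (p.subst τ)
        (t.map (Expr.subst τ)) := by
  simp only [jApp, Expr.subst, subst_subst, subst_up_up]
  congr 1
  · funext i
    have hi : (i : ℕ) < Θ.length := i.2
    rw [getD_tsubst _ _ hi _ (.var 0), getD_tsubst _ _ hi _ (.var 0), subst_subst]
    congr 1
    funext j
    rw [up_up, up_up, Nat.add_comm 3, subst_up_up]
  · funext i
    simp [ht]

/-- The elimination term in variables is the generic instance of the rule, so its typing,
computation and behaviour under substitution are read off from those of `jApp`. -/
theorem _root_.Expr.jVar_eq_jApp {S : Signature.{u}} (A : Expr S) (Θ : List (Expr S))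
    (C d : Expr S) : jVar A Θ C d = jApp A Θ C d (fun i => .var (i + (3 + Θ.length)))
      (.var (Θ.length + 2)) (.var (Θ.length + 1)) (.var Θ.length) (vars Θ.length 0) := by
  simp only [jVar, jApp, trename_eq_tsubst, up_var_comp, rename_eq_subst]
  congr 1
  funext i
  simp [vars]

/-- The premisses of elimination are stable under a change of parameters. The essential point is
that replacing `y` by `x` and `u` by reflexivity commutes with substitution for the variables of
`Γ`. -/
theorem jApp_aux {Γ Δ : List (Expr T.sig)} {A C d : Expr T.sig} {Θ : List (Expr T.sig)}
    {σ : ℕ → Expr T.sig}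
    (hC : T.Derives (Θ ++ .Id (A.wk 2) (.var 1) (.var 0) :: A.wk 1 :: A :: Γ) (.isType C))
    (hd : T.Derives (tsubst (Expr.push [.refl (.var 0), .var 0] .var) Θ ++ A :: Γ)
        (.isTerm d (C.subst (Expr.up Θ.length (Expr.push [.refl (.var 0), .var 0] .var)))))
    (hσ : T.IsSub Δ σ Γ) (hΔ : T.Derives Δ .ctx) :
    T.Derives Δ (.isType (A.subst σ)) ∧
    T.Derives (tsubst (Expr.up 3 σ) Θ ++ .Id ((A.subst σ).wk 2) (.var 1) (.var 0) ::
      (A.subst σ).wk 1 :: A.subst σ :: Δ) (.isType (C.subst (Expr.up (3 + Θ.length) σ))) ∧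
    T.Derives (tsubst (Expr.push [.refl (.var 0), .var 0] .var) (tsubst (Expr.up 3 σ) Θ) ++
        A.subst σ :: Δ) (.isTerm (d.subst (Expr.up (1 + Θ.length) σ))
          ((C.subst (Expr.up (3 + Θ.length) σ)).subst
            (Expr.up Θ.length (Expr.push [.refl (.var 0), .var 0] .var)))) := by
  have c1 : T.Derives (A :: Γ) .ctx := hd.ctx.of_append
  have e2 : ∀ n, (A.wk n).subst (Expr.up n σ) = (A.subst σ).wk n := by
    intro n
    rw [wk_subst, subst_wk]
    simp only [up_add]
  have s1 := hσ.up hΔ (Ψ := [A]) c1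
  have s3 := hσ.up hΔ (Ψ := [.Id (A.wk 2) (.var 1) (.var 0), A.wk 1, A]) hC.ctx.of_append
  have d3 := hσ.tsubst_ctx hΔ (Ψ := [.Id (A.wk 2) (.var 1) (.var 0), A.wk 1, A]) hC.ctx.of_append
  simp only [tsubst, List.length_cons, List.length_nil, Nat.zero_add, up_zero, Nat.reduceAdd,
    List.cons_append, List.nil_append, Expr.subst, e2] at s3 s1 d3
  rw [up_lt (by omega), up_lt (by omega)] at s3 d3
  refine ⟨.subst c1.head hΔ hσ, ?_, ?_⟩
  · have := Derives.subst hC (s3.tsubst_ctx d3 hC.ctx) (s3.up d3 hC.ctx)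
    rwa [up_up, Nat.add_comm] at this
  · have d1 := d3.tail.tail
    have h := Derives.subst hd (s1.tsubst_ctx d1 hd.ctx) (s1.up d1 hd.ctx)
    have e : ∀ i, (Expr.push [.refl (.var 0), .var 0] .var i).subst (Expr.up 1 σ) =
        (Expr.up 3 σ i).subst (Expr.push [.refl (.var 0), .var 0] .var) := by
      intro i
      rcases i with _ | _ | _ | i
      · rfl
      · rfl
      · rfl
      · have := up_add 3 i σ
        rw [show i + 1 + 1 + 1 = i + 3 from rfl, up_add, wk_subst]
        have h2 : (Expr.push [.refl (.var 0), .var 0] .var (i + 3) : Expr T.sig) =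
          .var (i + 1) := rfl
        rw [h2, Expr.subst, up_add, wk_eq_subst]
        rfl
    rw [tsubst_tsubst, Judgement.subst, subst_subst, length_tsubst, up_up, Nat.add_comm _ 1] at h
    rw [tsubst_tsubst, subst_subst]
    simp only [← e]
    convert h using 3
    funext i
    rw [Nat.add_comm 3, Nat.add_comm 1, ← up_up, ← up_up, subst_up_up, subst_up_up]
    simp only [e]

theorem jApp_type {Γ Δ : List (Expr T.sig)} {A C d a b p : Expr T.sig} {Θ : List (Expr T.sig)}
    {σ : ℕ → Expr T.sig} {t : List (Expr T.sig)}
    (hC : T.Derives (Θ ++ .Id (A.wk 2) (.var 1) (.var 0) :: A.wk 1 :: A :: Γ) (.isType C))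
    (hd : T.Derives (tsubst (Expr.push [.refl (.var 0), .var 0] .var) Θ ++ A :: Γ)
        (.isTerm d (C.subst (Expr.up Θ.length (Expr.push [.refl (.var 0), .var 0] .var)))))
    (hσ : T.IsSub Δ σ Γ) (hΔ : T.Derives Δ .ctx) (ha : T.Derives Δ (.isTerm a (A.subst σ)))
    (hb : T.Derives Δ (.isTerm b (A.subst σ)))
    (hp : T.Derives Δ (.isTerm p (.Id (A.subst σ) a b)))
    (ht : T.IsElem Δ t (tsubst (Expr.push [p, b, a] σ) Θ)) :
    T.Derives Δ (.isTerm (jApp A Θ C d σ a b p t)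
      (C.subst (Expr.push t (Expr.push [p, b, a] σ)))) := by
  obtain ⟨h1, h2, h3⟩ := jApp_aux hC hd hσ hΔ
  have lt : t.length = Θ.length := by simpa using ht.1
  have e1 := ofFn_getD (tsubst (Expr.up 3 σ) Θ) (l := Θ.length) (by simp) (.var 0)
  have e2 := ofFn_getD t (l := Θ.length) lt (.var 0)
  have := Derives.idElim (Γ := Δ) (k := Θ.length) (A := A.subst σ)
    (Θ := fun i => (tsubst (Expr.up 3 σ) Θ).getD i (.var 0))
    (C := C.subst (Expr.up (3 + Θ.length) σ)) (d := d.subst (Expr.up (1 + Θ.length) σ)) (a := a)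
    (b := b) (p := p) (t := fun i => t.getD i (.var 0)) h1 (by rw [e1]; exact h2)
    (by rw [e1]; exact h3) ha hb hp (by
      rw [e1, e2, tsubst_tsubst]
      simp only [up_subst_push_var (show [p, b, a].length = 3 from rfl)]
      intro i B hi
      have := ht.2 i B hi
      rwa [push_lt (by omega), ← List.getD_eq_getElem _ (.var 0)] at this)
  rw [e2, subst_subst] at this
  simp only [← push_append] at this ⊢
  simp only [up_subst_push_var (show (t ++ [p, b, a]).length = 3 + Θ.length by
    simp [lt, Nat.add_comm])] at this
  exact this

theorem jApp_comp {Γ Δ : List (Expr T.sig)} {A C d a : Expr T.sig} {Θ : List (Expr T.sig)}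
    {σ : ℕ → Expr T.sig} {t : List (Expr T.sig)}
    (hC : T.Derives (Θ ++ .Id (A.wk 2) (.var 1) (.var 0) :: A.wk 1 :: A :: Γ) (.isType C))
    (hd : T.Derives (tsubst (Expr.push [.refl (.var 0), .var 0] .var) Θ ++ A :: Γ)
        (.isTerm d (C.subst (Expr.up Θ.length (Expr.push [.refl (.var 0), .var 0] .var)))))
    (hσ : T.IsSub Δ σ Γ) (hΔ : T.Derives Δ .ctx) (ha : T.Derives Δ (.isTerm a (A.subst σ)))
    (ht : T.IsElem Δ t (tsubst (Expr.push [.refl a, a, a] σ) Θ)) :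
    T.Derives Δ (.eqTerm (jApp A Θ C d σ a a (.refl a) t) (d.subst (Expr.push t (Expr.push [a] σ)))
      (C.subst (Expr.push t (Expr.push [.refl a, a, a] σ)))) := by
  obtain ⟨h1, h2, h3⟩ := jApp_aux hC hd hσ hΔ
  have lt : t.length = Θ.length := by simpa using ht.1
  have e1 := ofFn_getD (tsubst (Expr.up 3 σ) Θ) (l := Θ.length) (by simp) (.var 0)
  have e2 := ofFn_getD t (l := Θ.length) lt (.var 0)
  have := Derives.idComp (Γ := Δ) (k := Θ.length) (A := A.subst σ)
    (Θ := fun i => (tsubst (Expr.up 3 σ) Θ).getD i (.var 0))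
    (C := C.subst (Expr.up (3 + Θ.length) σ)) (d := d.subst (Expr.up (1 + Θ.length) σ)) (a := a)
    (t := fun i => t.getD i (.var 0)) h1 (by rw [e1]; exact h2)
    (by rw [e1]; exact h3) ha (by
      rw [e1, e2, tsubst_tsubst]
      simp only [up_subst_push_var (show [Expr.refl a, a, a].length = 3 from rfl)]
      intro i B hi
      have := ht.2 i B hi
      rwa [push_lt (by omega), ← List.getD_eq_getElem _ (.var 0)] at this)
  rw [e2, subst_subst, subst_subst] at this
  simp only [← push_append] at this ⊢
  simp only [up_subst_push_var (show (t ++ [Expr.refl a, a, a]).length = 3 + Θ.length by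
    simp [lt, Nat.add_comm]), up_subst_push_var (show (t ++ [a]).length = 1 + Θ.length by
    simp [lt, Nat.add_comm])] at this
  exact this

theorem jVar_type {Γ : List (Expr T.sig)} {A C d : Expr T.sig} {Θ : List (Expr T.sig)}
    (hC : T.Derives (Θ ++ .Id (A.wk 2) (.var 1) (.var 0) :: A.wk 1 :: A :: Γ) (.isType C))
    (hd : T.Derives (tsubst (Expr.push [.refl (.var 0), .var 0] .var) Θ ++ A :: Γ)
        (.isTerm d (C.subst (Expr.up Θ.length (Expr.push [.refl (.var 0), .var 0] .var))))) :
    T.Derives (Θ ++ .Id (A.wk 2) (.var 1) (.var 0) :: A.wk 1 :: A :: Γ)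
      (.isTerm (jVar A Θ C d) C) := by
  have hv := IsSub.var hC.ctx
  rw [isSub_append, isSub_cons, isSub_cons, isSub_cons] at hv
  obtain ⟨hΘ, hp, hb, ha, hΓ⟩ := hv
  rw [jVar_eq_jApp]
  simp only [Expr.subst, wk_subst] at hΘ hp hb ha hΓ
  set Ξ := Θ ++ .Id (A.wk 2) (.var 1) (.var 0) :: A.wk 1 :: A :: Γ
  replace hΓ : T.IsSub Ξ (fun i => .var (i + (3 + Θ.length))) Γ := by
    convert hΓ using 3; omega
  replace hp : T.Derives Ξ (.isTerm (.var Θ.length) (.Id (A.subst fun i => .var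
      (i + (3 + Θ.length))) (.var (Θ.length + 2)) (.var (Θ.length + 1)))) := by
    convert hp using 4 <;> first | omega | (funext i; congr 1; omega)
  replace hb : T.Derives Ξ (.isTerm (.var (Θ.length + 1)) (A.subst fun i => .var
      (i + (3 + Θ.length)))) := by
    convert hb using 3 <;> first | omega | (funext i; congr 1; omega)
  replace ha : T.Derives Ξ (.isTerm (.var (Θ.length + 2)) (A.subst fun i => .var
      (i + (3 + Θ.length)))) := by
    convert ha using 3 <;> first | omega | (funext i; congr 1; omega)
  have hpush : Expr.push [.var Θ.length, .var (Θ.length + 1), .var (Θ.length + 2)]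
      (fun i => .var (i + (3 + Θ.length))) = fun i => (.var (i + Θ.length) : Expr T.sig) := by
    funext i
    rcases i with _ | _ | _ | i
    · simp [push_cons_zero]
    · simp [push_cons_succ, push_cons_zero]; omega
    · simp [push_cons_succ, push_cons_zero]; omega
    · rw [push_cons_succ, push_cons_succ, push_cons_succ, push_nil]; congr 1; omega
  have hpush2 : (Expr.push (vars Θ.length 0) fun i => (.var (i + Θ.length) : Expr T.sig)) =
      .var := by
    funext i
    rw [push_vars]
    split_ifs <;> congr 1 <;> omega
  have := jApp_type hC hd hΓ hC.ctx ha hb hp (t := vars Θ.length 0) (by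
    rw [isElem_tsubst_iff, hpush, hpush2]
    exact ⟨by simp, hΘ⟩)
  rwa [hpush, hpush2, subst_var] at this

/-- On the diagonal the generic instance turns into an instance at a reflexivity, with the
parameters `Θ` left as variables; there the computation rule applies and returns `d` itself. -/
theorem jVar_comp {Γ : List (Expr T.sig)} {A C d : Expr T.sig} {Θ : List (Expr T.sig)}
    (hC : T.Derives (Θ ++ .Id (A.wk 2) (.var 1) (.var 0) :: A.wk 1 :: A :: Γ) (.isType C))
    (hd : T.Derives (tsubst (Expr.push [.refl (.var 0), .var 0] .var) Θ ++ A :: Γ)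
        (.isTerm d (C.subst (Expr.up Θ.length (Expr.push [.refl (.var 0), .var 0] .var))))) :
    T.Derives (tsubst (Expr.push [.refl (.var 0), .var 0] .var) Θ ++ A :: Γ) (.eqTerm
      ((jVar A Θ C d).subst (Expr.up Θ.length (Expr.push [.refl (.var 0), .var 0] .var))) d
      (C.subst (Expr.up Θ.length (Expr.push [.refl (.var 0), .var 0] .var)))) := by
  have hv := IsSub.var hd.ctx
  rw [isSub_append, isSub_cons, length_tsubst, isSub_tsubst] at hv
  obtain ⟨hΘ, ha, hΓ⟩ := hv
  set ρ : ℕ → Expr T.sig := Expr.push [.refl (.var 0), .var 0] .var with hρ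
  rw [jVar_eq_jApp, jApp_subst _ _ _ _ _ _ _ _ (by simp)]
  have e1 : (vars Θ.length 0).map (Expr.subst (Expr.up Θ.length ρ)) = vars Θ.length 0 := by
    simp only [vars, List.map_map]
    refine List.map_congr_left fun i hi => ?_
    simp at hi
    simp [Expr.subst, up_lt hi]
  have e2 : ∀ i, (Expr.var (S := T.sig) (i + (3 + Θ.length))).subst (Expr.up Θ.length ρ) =
      .var (i + 1 + Θ.length) := by
    intro i
    rw [Expr.subst, show i + (3 + Θ.length) = i + 3 + Θ.length by omega, up_add, hρ,
      push_cons_succ, push_cons_succ, push_nil, Expr.wk, rename]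
  have ea : (Expr.var (S := T.sig) (Θ.length + 2)).subst (Expr.up Θ.length ρ) =
      .var Θ.length := by
    rw [Expr.subst, Nat.add_comm, up_add]; simp [hρ, push, rename, Expr.wk]
  have eb : (Expr.var (S := T.sig) (Θ.length + 1)).subst (Expr.up Θ.length ρ) =
      .var Θ.length := by
    rw [Expr.subst, Nat.add_comm, up_add]; simp [hρ, push, rename, Expr.wk]
  have ep : (Expr.var (S := T.sig) Θ.length).subst (Expr.up Θ.length ρ) =
      .refl (.var Θ.length) := by
    have := up_add Θ.length 0 ρ
    rw [Nat.zero_add] at this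
    rw [Expr.subst, this]; simp [hρ, push, rename, Expr.wk]
  simp only [e1, e2, ea, eb, ep, Nat.zero_add] at ha hΓ ⊢
  have e3 : Expr.push (vars Θ.length 0) (Expr.push [.refl (.var Θ.length), .var Θ.length,
      .var Θ.length] fun i => .var (i + 1 + Θ.length)) = Expr.up Θ.length ρ := by
    funext i
    rw [push_vars]
    by_cases h : i < Θ.length
    · rw [up_lt h, if_pos h, Nat.zero_add]
    · obtain ⟨j, rfl⟩ : ∃ j, i = j + Θ.length := ⟨i - Θ.length, by omega⟩
      rw [if_neg h, up_add, Nat.add_sub_cancel, hρ]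
      rcases j with _ | _ | _ | j <;> simp [push, rename, Expr.wk]
  have e4 : Expr.push (vars Θ.length 0) (Expr.push [.var Θ.length] fun i =>
      .var (i + 1 + Θ.length)) = (.var : ℕ → Expr T.sig) := by
    funext i
    rw [push_vars]
    split_ifs with h
    · rw [Nat.zero_add]
    · obtain ⟨j, rfl⟩ : ∃ j, i = j + Θ.length := ⟨i - Θ.length, by omega⟩
      rcases j with _ | j <;> simp [push]
  have := jApp_comp hC hd hΓ hd.ctx ha (t := vars Θ.length 0) (by
    rw [isElem_tsubst_iff, e3]
    refine ⟨by simp, ?_⟩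
    convert hΘ using 1
    funext i
    by_cases h : i < Θ.length
    · rw [up_lt h, if_pos h]
    · obtain ⟨j, rfl⟩ : ∃ j, i = j + Θ.length := ⟨i - Θ.length, by omega⟩
      rw [if_neg h, up_add, Nat.add_sub_cancel, wk_eq_subst])
  rwa [e3, e4, subst_var] at this

end TypeTheory

namespace Expr

variable {S : Signature.{u}}

/-! ### Identity contexts are stable under substitution -/

/-- Only the length of `Φ` matters, so reflexivity elements, and with them `reflSub` and `diag`, are
unchanged by substitution in `Φ`. -/
theorem rTerms_eq (Φ : List (Expr S)) :
    rTerms Φ = (List.range Φ.length).map fun i => refl (var i) := by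
  induction Φ with
  | nil => rfl
  | cons A Φ ih =>
    rw [rTerms, ih, List.length_cons, List.range_succ_eq_map, List.map_cons, List.map_map,
      List.map_map]
    rfl

@[simp] theorem length_rTerms (Φ : List (Expr S)) : (rTerms Φ).length = Φ.length := by
  simp [rTerms_eq]

theorem push_rTerms (Φ : List (Expr S)) (σ : ℕ → Expr S) (i : ℕ) :
    push (rTerms Φ) σ i = if i < Φ.length then refl (var i) else σ (i - Φ.length) := by
  by_cases h : i < Φ.length
  · rw [push_lt (by simpa using h), if_pos h]; simp [rTerms_eq]
  · obtain ⟨j, rfl⟩ : ∃ j, i = j + Φ.length := ⟨i - Φ.length, by omega⟩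
    rw [push_add' (length_rTerms Φ)]; simp

theorem diag_apply (Φ : List (Expr S)) (i : ℕ) : diag Φ i =
    if i = 0 then var 0
    else if i < Φ.length + 1 then refl (var (i + 2))
    else if i = Φ.length + 1 then var 1
    else if i < 2 * Φ.length + 2 then var (i - Φ.length + 1)
    else if i = 2 * Φ.length + 2 then var 2
    else var (i - 2 * Φ.length) := by
  simp only [diag]
  split_ifs <;> try rfl
  rw [rTerms_eq, List.getD_eq_getElem _ _ (by simp; omega)]
  simp [wk, rename]; omega

/-- The substitution `δ` replaces `n` variables by terms in `m` variables and fixes all others. -/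
structure IsBlock (δ : ℕ → Expr S) (n m : ℕ) : Prop where
  lt : ∀ i < n, ∀ σ, (δ i).subst (up m σ) = δ i
  add : ∀ i, δ (i + n) = var (i + m)

theorem isBlock_var {ρ : ℕ → ℕ} {n m : ℕ} (h1 : ∀ i < n, ρ i < m) (h2 : ∀ i, ρ (i + n) = i + m) :
    IsBlock (fun i => (var (ρ i) : Expr S)) n m :=
  ⟨fun i hi σ => by rw [Expr.subst, up_lt (h1 i hi)], fun i => by rw [h2]⟩

theorem IsBlock.up {δ : ℕ → Expr S} {n m : ℕ} (h : IsBlock δ n m) (l : ℕ) :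
    IsBlock (up l δ) (l + n) (l + m) := by
  refine ⟨fun i hi σ => ?_, fun i => ?_⟩
  · rw [← up_up, subst_up_up]
    by_cases h' : i < l
    · rw [up_lt h', up_lt h']
    · obtain ⟨j, rfl⟩ : ∃ j, i = j + l := ⟨i - l, by omega⟩
      rw [up_add, up_add, h.lt _ (by omega)]
  · rw [show i + (l + n) = i + n + l by omega, up_add, h.add, wk, rename]
    congr 1; omega

/-- A block touches only the local variables and `σ` only the outer ones, so they commute. All
rearrangements of variables in the definition of `jTerm` are blocks, which is what makes stability
under substitution provable. -/
theorem IsBlock.comm {δ : ℕ → Expr S} {n m : ℕ} (h : IsBlock δ n m) (σ : ℕ → Expr S) (i : ℕ) :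
    (δ i).subst (Expr.up m σ) = (Expr.up n σ i).subst δ := by
  by_cases h' : i < n
  · rw [up_lt h', h.lt _ h', Expr.subst]
  · obtain ⟨j, rfl⟩ : ∃ j, i = j + n := ⟨i - n, by omega⟩
    rw [h.add, Expr.subst, up_add, up_add, wk_subst, wk_eq_subst]
    simp only [h.add]

theorem IsBlock.subst {δ : ℕ → Expr S} {n m : ℕ} (h : IsBlock δ n m) (e : Expr S)
    (σ : ℕ → Expr S) :
    (e.subst δ).subst (Expr.up m σ) = (e.subst (Expr.up n σ)).subst δ := by
  simp only [subst_subst, h.comm]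

theorem IsBlock.tsubst {δ : ℕ → Expr S} {n m : ℕ} (h : IsBlock δ n m) (Θ : List (Expr S))
    (σ : ℕ → Expr S) :
    tsubst (Expr.up m σ) (tsubst δ Θ) = Expr.tsubst δ (Expr.tsubst (Expr.up n σ) Θ) := by
  simp only [tsubst_tsubst, h.comm]

theorem isBlock_diag (Φ : List (Expr S)) : IsBlock (diag Φ) (3 * Φ.length + 3) (Φ.length + 3) := by
  refine ⟨fun i hi σ => ?_, fun i => ?_⟩
  · rw [diag_apply]
    split_ifs <;> simp only [Expr.subst] <;> rw [up_lt (by omega)]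
  · rw [diag_apply]
    split_ifs <;> first | contradiction | omega | exact congrArg var (by omega)

theorem isBlock_shuffle (k : ℕ) :
    IsBlock (fun i => (var (shuffle k i) : Expr S)) (3 * k + 3) (3 * k + 3) := by
  refine isBlock_var (fun i hi => ?_) fun i => ?_ <;> simp only [shuffle] <;> split_ifs <;> omega

theorem isBlock_unshuffle (k : ℕ) :
    IsBlock (fun i => (var (unshuffle k i) : Expr S)) (3 * k + 3) (3 * k + 3) := by
  refine isBlock_var (fun i hi => ?_) fun i => ?_ <;> simp only [unshuffle] <;> split_ifs <;> omega

theorem isBlock_wk (n m k : ℕ) (h : n + k = m) :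
    IsBlock (fun i => (var (i + k) : Expr S)) n m :=
  isBlock_var (fun i hi => by omega) fun i => by omega

theorem isBlock_ite (k a b m : ℕ) (h : k + a ≤ m) (hb : k + b = m) :
    IsBlock (fun i => (var (if i < k then i + a else i + b) : Expr S)) k m :=
  isBlock_var (fun i hi => by simp only [hi, if_true]; omega) fun i => by
    simp only [show ¬ i + k < k by omega, if_false]; omega

theorem J_ext {k k' : ℕ} (h : k = k') {A A' C C' d d' a a' b b' p p' : Expr S}
    {Θ t : Fin k → Expr S} {Θ' t' : Fin k' → Expr S} (hA : A = A')
    (hΘ : ∀ i (h1 : i < k) (h2 : i < k'), Θ ⟨i, h1⟩ = Θ' ⟨i, h2⟩) (hC : C = C') (hd : d = d')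
    (ha : a = a') (hb : b = b') (hp : p = p')
    (ht : ∀ i (h1 : i < k) (h2 : i < k'), t ⟨i, h1⟩ = t' ⟨i, h2⟩) :
    J k A Θ C d a b p t = J k' A' Θ' C' d' a' b' p' t' := by
  subst h hA hC hd ha hb hp
  rw [show Θ = Θ' from funext fun i => hΘ i i.2 i.2, show t = t' from funext fun i => ht i i.2 i.2]

theorem jVar_subst (A : Expr S) (Θ : List (Expr S)) (C d : Expr S) (τ : ℕ → Expr S) :
    (jVar A Θ C d).subst (up (Θ.length + 3) τ) = jVar (A.subst τ) (tsubst (up 3 τ) Θ)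
      (C.subst (up (Θ.length + 3) τ)) (d.subst (up (Θ.length + 1) τ)) := by
  rw [jVar_eq_jApp, jVar_eq_jApp, jApp_subst _ _ _ _ _ _ _ _ (by simp)]
  simp only [jApp, length_tsubst, subst_subst, Expr.subst, tsubst_tsubst, subst_up_up,
    Nat.add_comm Θ.length]
  have h1 : ∀ i, up (3 + Θ.length) τ (i + (3 + Θ.length)) =
      (τ i).subst fun i => var (i + (3 + Θ.length)) := by
    intro i; rw [up_add, wk_eq_subst]
  have h2 : ∀ i < 3 + Θ.length, up (3 + Θ.length) τ i = var i := fun i hi => up_lt hi _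
  simp only [h1]
  rw [h2 _ (by omega), h2 _ (by omega), h2 _ (by omega)]
  refine J_ext (by simp) rfl (fun i _ _ => rfl) rfl rfl rfl rfl rfl fun i hi _ => ?_
  simp [vars, Expr.subst, h2 i (by omega), hi]

/-- By induction on `Φ`: each renaming in the recursive clause is a block and so commutes with `σ`,
while the inner term, the transport and the outer elimination are covered by `jVar_subst` and the
induction hypothesis. -/
theorem jTerm_subst (Φ : List (Expr S)) : ∀ (Θ : List (Expr S)) (C d : Expr S) (σ : ℕ → Expr S),
    (jTerm Φ Θ C d).subst (up (Θ.length + 3 * Φ.length) σ) =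
      jTerm (tsubst σ Φ) (tsubst (up (3 * Φ.length) σ) Θ)
        (C.subst (up (Θ.length + 3 * Φ.length) σ)) (d.subst (up (Θ.length + Φ.length) σ)) := by
  induction Φ with
  | nil => intro Θ C d σ; rfl
  | cons A Φ ih =>
    intro Θ C d σ
    have e1 := (isBlock_unshuffle (S := S) Φ.length).up Θ.length
    have e2 := (isBlock_shuffle (S := S) Φ.length).up Θ.length
    have e3 := (isBlock_diag (S := S) Φ).up Θ.length
    simp only [Expr.tsubst, jTerm, length_tsubst, List.length_cons, rename_eq_subst,
      ← up_var_comp, trename_eq_tsubst]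
    rw [show 3 * (Φ.length + 1) = 3 * Φ.length + 3 by omega, e1.subst]
    have h1 := fun Θ C d => ih Θ C d σ
    congr 1
    have h2 := h1 [A.wk (2 * Φ.length)] (A.subst fun i => .var
      (if i < Φ.length then i + (Φ.length + 1) else i + (2 * Φ.length + 1))) (var 0)
    have b1 := (isBlock_wk (S := S) Φ.length (3 * Φ.length) (2 * Φ.length) (by omega))
    have b2 := (isBlock_ite (S := S) Φ.length (Φ.length + 1) (2 * Φ.length + 1) (3 * Φ.length + 1)
      (by omega) (by omega))
    have b3 := (isBlock_ite (S := S) Φ.length (Φ.length + 2) (2 * Φ.length + 2) (3 * Φ.length + 2)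
      (by omega) (by omega))
    have b4 := (isBlock_wk (S := S) (3 * Φ.length + 1) (3 * Φ.length + 2) 1 (by omega))
    simp only [List.length_singleton, Nat.add_comm 1, Expr.tsubst, List.length_nil, up_zero,
      Expr.subst, up_lt (Nat.succ_pos _), wk_eq_subst, b1.subst, b2.subst] at h2
    have h3 := h1 (tsubst (fun i => .var (shuffle Φ.length i)) Θ ++
      [lastId (jTerm Φ) Φ.length A, A.subst fun i => var (if i < Φ.length then i + (Φ.length + 1)
        else i + (2 * Φ.length + 1)), A.subst fun i => .var (i + 2 * Φ.length)])
      (C.subst (up Θ.length fun i => var (shuffle Φ.length i)))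
      (jVar A (tsubst (diag Φ) Θ) (C.subst (up Θ.length (diag Φ))) d)
    simp only [List.length_append, length_tsubst, List.length_cons, List.length_nil] at h3
    rw [show Θ.length + (0 + 1 + 1 + 1) + 3 * Φ.length = Θ.length + (3 * Φ.length + 3) by omega,
      show Θ.length + (0 + 1 + 1 + 1) + Φ.length = Θ.length + (Φ.length + 3) by omega] at h3
    rw [h3, e2.subst, tsubst_append]
    have h4 := jVar_subst A (tsubst (diag Φ) Θ) (C.subst (up Θ.length (diag Φ))) d (up Φ.length σ)
    rw [length_tsubst, up_up, up_up, up_up, show Θ.length + 3 + Φ.length =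
      Θ.length + (Φ.length + 3) by omega, Nat.add_comm 3, e3.subst, (isBlock_diag Φ).tsubst] at h4
    rw [h4]
    -- `diag` depends on `Φ` only through its length.
    have h5 : diag (tsubst σ Φ) = diag Φ := by funext i; simp [diag_apply]
    rw [h5]
    simp only [List.length_cons, List.length_nil, up_up, Expr.tsubst, Nat.zero_add,
      Nat.reduceAdd]
    rw [Nat.add_comm 3, (isBlock_shuffle _).tsubst, Nat.add_comm 1, Nat.add_comm 2,
      b1.subst, b2.subst, Nat.add_right_comm Θ.length 1]
    simp only [lastId, transport, Expr.subst, up_lt (Nat.succ_pos _), rename_eq_subst,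
      b4.subst, h2, b3.subst, Nat.add_assoc]

theorem transport_subst (Φ : List (Expr S)) (A : Expr S) (σ : ℕ → Expr S) :
    (transport (jTerm Φ) Φ.length A).subst (up (3 * Φ.length + 1) σ) =
      transport (jTerm (tsubst σ Φ)) Φ.length (A.subst (up Φ.length σ)) := by
  have h := jTerm_subst Φ [A.wk (2 * Φ.length)] (A.rename fun i =>
      (if i < Φ.length then i + (Φ.length + 1) else i + (2 * Φ.length + 1))) (var 0) σ
  have b1 := (isBlock_wk (S := S) Φ.length (3 * Φ.length) (2 * Φ.length) (by omega))
  have b2 := (isBlock_ite (S := S) Φ.length (Φ.length + 1) (2 * Φ.length + 1) (3 * Φ.length + 1)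
      (by omega) (by omega))
  simp only [List.length_singleton, Nat.add_comm 1, Expr.tsubst, List.length_nil, up_zero,
      Expr.subst, up_lt (Nat.succ_pos _), rename_eq_subst, b1.subst, b2.subst] at h
  simp only [transport, rename_eq_subst]
  exact h

theorem lastId_subst (Φ : List (Expr S)) (A : Expr S) (σ : ℕ → Expr S) :
    (lastId (jTerm Φ) Φ.length A).subst (up (3 * Φ.length + 2) σ) =
      lastId (jTerm (tsubst σ Φ)) Φ.length (A.subst (up Φ.length σ)) := by
  have b3 := (isBlock_ite (S := S) Φ.length (Φ.length + 2) (2 * Φ.length + 2) (3 * Φ.length + 2)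
      (by omega) (by omega))
  have b4 := (isBlock_wk (S := S) (3 * Φ.length + 1) (3 * Φ.length + 2) 1 (by omega))
  simp only [lastId, Expr.subst, up_lt (Nat.succ_pos _), rename_eq_subst,
      b4.subst, b3.subst, transport_subst]

@[simp] theorem length_idVar (Φ : List (Expr S)) : (idVar Φ).length = Φ.length := by
  induction Φ <;> simp_all [idVar]

theorem idVar_subst (Φ : List (Expr S)) (σ : ℕ → Expr S) :
    tsubst (up (2 * Φ.length) σ) (idVar Φ) = idVar (tsubst σ Φ) := by
  induction Φ with
  | nil => rfl
  | cons A Φ ih =>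
    have b1 : IsBlock (fun i => (var (if i = 0 then Φ.length else if i = 1 then 2 * Φ.length + 1
        else if i < Φ.length + 2 then i - 2 else if i < 2 * Φ.length + 2 then i - 1 else i) :
        Expr S)) (3 * Φ.length + 2) (3 * Φ.length + 2) := by
      refine isBlock_var (fun i hi => ?_) fun i => ?_ <;> split_ifs <;>
        first | contradiction | omega
    have b2 : IsBlock (fun i => (var (if i < Φ.length then i + 1 else i + 2) :
        Expr S)) (2 * Φ.length) (2 * (Φ.length + 1)) := by
      refine isBlock_var (fun i hi => ?_) fun i => ?_ <;> split_ifs <;> omega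
    simp only [idVar, Expr.tsubst, length_idVar, up_up, length_tsubst, List.length_cons,
      rename_eq_subst, trename_eq_tsubst, b2.tsubst, ih]
    rw [show Φ.length + 2 * (Φ.length + 1) = 3 * Φ.length + 2 by omega, b1.subst, lastId_subst]

/-- The dependent context `(x ∈ Φ, y ∈ Φ, u ∈ Id_Φ(x, y))`. -/
def pathCxt (Φ : List (Expr S)) : List (Expr S) :=
  idVar Φ ++ (trename (· + Φ.length) Φ ++ Φ)

@[simp] theorem length_pathCxt (Φ : List (Expr S)) : (pathCxt Φ).length = 3 * Φ.length := by
  simp [pathCxt]; omega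

/-- Strict stability of identity contexts under substitution. It becomes the stability of path
objects under change of base. -/
theorem pathCxt_tsubst (Φ : List (Expr S)) (σ : ℕ → Expr S) :
    tsubst σ (pathCxt Φ) = pathCxt (tsubst σ Φ) := by
  have b := isBlock_wk (S := S) 0 Φ.length Φ.length (by omega)
  simp only [pathCxt, tsubst_append, trename_eq_tsubst, length_tsubst,
    b.tsubst, up_zero]
  simp only [List.length_append, length_tsubst]
  rw [← two_mul, idVar_subst]

/-- The substitution from `(Γ, x, y, u)` to `(Γ, x)` which replaces `y` by `x` and `u` by `r(x)`. -/
def reflSub (Φ : List (Expr S)) : ℕ → Expr S :=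
  push (rTerms Φ) (push (vars Φ.length 0) var)

theorem reflSub_apply (Φ : List (Expr S)) (i : ℕ) : reflSub Φ i =
    if i < Φ.length then refl (var i) else if i < 2 * Φ.length then var (i - Φ.length)
    else var (i - 2 * Φ.length) := by
  simp only [reflSub, push_rTerms, push_vars]
  split_ifs <;> first | rfl | omega | (congr 1; omega)

end Expr
-- Elimination for identity contexts, by induction on the length
namespace TypeTheory

variable {T : TypeTheory.{u}}

/-- The rules for the identity context of the dependent context `Φ` relative to `Γ`, with a single
eliminating type. -/
structure ElimSpec (T : TypeTheory.{u}) (Γ Φ : List (Expr T.sig)) : Prop where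
  ctx : T.Derives (pathCxt Φ ++ Γ) .ctx
  refl : T.IsSub (Φ ++ Γ) (reflSub Φ) (pathCxt Φ ++ Γ)
  elim (Θ : List (Expr T.sig)) (C d : Expr T.sig)
    (hC : T.Derives (Θ ++ (pathCxt Φ ++ Γ)) (.isType C))
    (hd : T.Derives (tsubst (reflSub Φ) Θ ++ (Φ ++ Γ))
      (.isTerm d (C.subst (up Θ.length (reflSub Φ))))) :
    T.Derives (Θ ++ (pathCxt Φ ++ Γ)) (.isTerm (jTerm Φ Θ C d) C) ∧
    T.Derives (tsubst (reflSub Φ) Θ ++ (Φ ++ Γ))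
      (.eqTerm ((jTerm Φ Θ C d).subst (up Θ.length (reflSub Φ))) d
        (C.subst (up Θ.length (reflSub Φ))))

section Cons

variable {Γ Φ : List (Expr T.sig)} {A : Expr T.sig}

/-- The type `A(y)` in `(Γ, x, y, u, x' ∈ A(x))`. -/
abbrev _root_.Expr.secondType {S : Signature.{u}} (k : ℕ) (A : Expr S) : Expr S :=
  A.rename fun i => if i < k then i + (k + 1) else i + (2 * k + 1)

theorem ElimSpec.isSub_second (h : ElimSpec T Γ Φ) :
    T.IsSub (pathCxt Φ ++ Γ)
      (fun i => .var (if i < Φ.length then i + Φ.length else i + 2 * Φ.length)) (Φ ++ Γ) := by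
  have h0 := h.ctx
  simp only [pathCxt, List.append_assoc] at h0 ⊢
  have h1 := (IsSub.wk h0.of_append.of_append).up h0.of_append.of_append h0.of_append.of_append
  rw [← trename_eq_tsubst] at h1
  have h2 := h1.wk_comp h0
  convert h2 using 1
  funext i
  simp only [Expr.up, length_idVar]
  split_ifs <;> simp only [Expr.wk, rename]; congr 1; omega

theorem ElimSpec.firstType (h : ElimSpec T Γ Φ) (hA : T.Derives (Φ ++ Γ) (.isType A)) :
    T.Derives (pathCxt Φ ++ Γ) (.isType (A.wk (2 * Φ.length))) := by
  have h0 := h.ctx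
  have e : pathCxt Φ ++ Γ = (idVar Φ ++ trename (· + Φ.length) Φ) ++ (Φ ++ Γ) := by
    simp [pathCxt]
  have := hA.wk (e ▸ h0)
  rw [← e] at this
  have e2 : (idVar Φ ++ trename (· + Φ.length) Φ).length = 2 * Φ.length := by simp; omega
  rw [e2] at this
  rw [wk_eq_subst]
  exact this

theorem ElimSpec.secondType (h : ElimSpec T Γ Φ) (hA : T.Derives (Φ ++ Γ) (.isType A)) :
    T.Derives (A.wk (2 * Φ.length) :: (pathCxt Φ ++ Γ))
      (.isType (Expr.secondType Φ.length A)) := by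
  have c := Derives.cons h.ctx (h.firstType hA)
  have h1 := h.isSub_second.wk_comp (Ψ := [A.wk (2 * Φ.length)]) c
  have := Derives.subst hA c h1
  rw [Judgement.subst] at this
  convert this using 2
  rw [Expr.secondType, rename_eq_subst]
  refine subst_ext (fun i => ?_) A
  simp only [Expr.wk, rename, List.length_singleton]
  split_ifs <;> congr 1

theorem firstType_subst (A : Expr T.sig) (Φ : List (Expr T.sig)) :
    (A.wk (2 * Φ.length)).subst (reflSub Φ) = A := by
  rw [wk_subst]
  conv_rhs => rw [← subst_var A]
  congr 1
  funext i
  rw [reflSub_apply]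
  split_ifs <;> first | omega | exact congrArg _ (by omega)

theorem secondType_subst (A : Expr T.sig) (Φ : List (Expr T.sig)) :
    (Expr.secondType Φ.length A).subst (up 1 (reflSub Φ)) = A.wk 1 := by
  rw [Expr.secondType, subst_rename, wk_eq_subst]
  congr 1
  funext i
  split_ifs with h
  · rw [← Nat.add_assoc, up_add, reflSub_apply, if_neg (by omega), if_pos (by omega)]
    simp [Expr.wk, rename]
  · rw [← Nat.add_assoc, up_add, reflSub_apply, if_neg (by omega), if_neg (by omega)]
    simp [Expr.wk, rename]

/-- Elimination with parameter `z ∈ A(x)` and eliminating term `z`. The computation rule makes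
transport along reflexivity definitionally the identity. -/
theorem ElimSpec.transport (h : ElimSpec T Γ Φ) (hA : T.Derives (Φ ++ Γ) (.isType A)) :
    T.Derives (A.wk (2 * Φ.length) :: (pathCxt Φ ++ Γ))
      (.isTerm (transport (jTerm Φ) Φ.length A) (Expr.secondType Φ.length A)) ∧
    T.Derives (A :: (Φ ++ Γ))
      (.eqTerm ((Expr.transport (jTerm Φ) Φ.length A).subst (up 1 (reflSub Φ))) (.var 0)
        (A.wk 1)) := by
  have := h.elim [A.wk (2 * Φ.length)] (Expr.secondType Φ.length A) (.var 0) (h.secondType hA) (by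
    simp only [tsubst, List.length_nil, up_zero, List.length_singleton, firstType_subst,
      secondType_subst]
    exact Derives.var (i := 0) (.cons hA.ctx hA) rfl)
  simp only [tsubst, List.length_nil, up_zero, List.length_singleton, firstType_subst,
      secondType_subst] at this
  exact this

theorem ElimSpec.lastId (h : ElimSpec T Γ Φ) (hA : T.Derives (Φ ++ Γ) (.isType A)) :
    T.Derives (Expr.secondType Φ.length A :: A.wk (2 * Φ.length) :: (pathCxt Φ ++ Γ))
      (.isType (lastId (jTerm Φ) Φ.length A)) := by
  have h1 := h.secondType hA
  have c := Derives.cons h1.ctx h1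
  have h2 := (h.transport hA).1.wk (Ψ := [Expr.secondType Φ.length A]) c
  simp only [Judgement.subst, ← wk_eq_subst, List.length_singleton] at h2
  have h3 := Derives.var (i := 0) c rfl
  have e : (Expr.secondType Φ.length A).wk 1 = A.rename fun i =>
      if i < Φ.length then i + (Φ.length + 2) else i + (2 * Φ.length + 2) := by
    rw [Expr.secondType, rename_eq_subst, rename_eq_subst, subst_wk]
    congr 1
    funext i
    simp only [Expr.wk, rename]
    split_ifs <;> congr 1
  rw [Nat.zero_add] at h3
  rw [e] at h2 h3
  exact .idForm h2.isType h2 h3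

/-- Since transport along reflexivity is trivial, the type of `u'` over the diagonal is
definitionally an identity type of `A` between the two variables. This is what allows elimination on
`u'` by the rule for single types. -/
theorem ElimSpec.lastId_refl (h : ElimSpec T Γ Φ) (hA : T.Derives (Φ ++ Γ) (.isType A)) :
    T.Derives (A.wk 1 :: A :: (Φ ++ Γ)) (.eqType
      ((Expr.lastId (jTerm Φ) Φ.length A).subst (up 2 (reflSub Φ)))
      (.Id (A.wk 2) (.var 1) (.var 0))) := by
  have h0 := (h.transport hA).2
  have h1 := hA.wk (Ψ := [A]) (.cons hA.ctx hA)
  simp only [Judgement.subst, ← wk_eq_subst, List.length_singleton] at h1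
  have c := Derives.cons h1.ctx h1
  have h2 := Derives.wk (Ψ := [A.wk 1]) h0 c
  have h3 := Derives.var (i := 0) c rfl
  have e1 : (A.wk 1).wk 1 = A.wk 2 := by rw [wk_eq_subst (A.wk 1), wk_subst, wk_eq_subst]
  simp only [Judgement.subst, ← wk_eq_subst, List.length_singleton, e1] at h2
  have e2 : (A.rename fun i => if i < Φ.length then i + (Φ.length + 2)
      else i + (2 * Φ.length + 2)).subst (up 2 (reflSub Φ)) = A.wk 2 := by
    rw [subst_rename, wk_eq_subst]
    congr 1
    funext i
    split_ifs with h
    · rw [← Nat.add_assoc, up_add, reflSub_apply, if_neg (by omega), if_pos (by omega)]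
      simp [Expr.wk, rename]
    · rw [← Nat.add_assoc, up_add, reflSub_apply, if_neg (by omega), if_neg (by omega)]
      simp [Expr.wk, rename]
  have e3 : ((Expr.transport (jTerm Φ) Φ.length A).wk 1).subst (up 2 (reflSub Φ)) =
      ((Expr.transport (jTerm Φ) Φ.length A).subst (up 1 (reflSub Φ))).wk 1 := by
    rw [wk_subst, subst_wk]
    congr 1
    funext i
    rw [show 2 = 1 + 1 from rfl, ← up_up, up_add]
  rw [Nat.zero_add, e1] at h3
  simp only [Expr.lastId, Expr.subst, e2, e3, up_lt (show 0 < 2 by omega)]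
  exact Derives.id_congr h2 (.reflTerm h3)

/-- The last identity type was formed in `(x, y, u, x', y')`, whereas the identity context lists its
variables as `(x, x', y, y', u)`. The proof inserts `x'` and `y'` at their places and moves the type
along the resulting renaming. -/
theorem ElimSpec.ctx_cons (h : ElimSpec T Γ Φ) (hA : T.Derives (Φ ++ Γ) (.isType A)) :
    T.Derives (pathCxt (A :: Φ) ++ Γ) .ctx := by
  have c0 : T.Derives ((A :: Φ) ++ Γ) .ctx := .cons hA.ctx hA
  have c2 := (IsSub.wk c0).tsubst_ctx c0 c0
  have s2 := (IsSub.wk (Ψ := [A]) c0).up c0 (Ψ := trename (· + Φ.length) Φ)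
    (by have := h.ctx; simp only [pathCxt, List.append_assoc] at this; exact this.of_append)
  rw [tsubst_trename, length_trename] at s2
  rw [← trename_eq_tsubst] at c2
  have c3 : T.Derives (trename (· + (Φ.length + 1)) (A :: Φ) ++ (A :: Φ ++ Γ)) .ctx := c2
  have s3 : T.IsSub (trename (· + (Φ.length + 1)) (A :: Φ) ++ (A :: Φ ++ Γ))
      (fun i => .var (if i < Φ.length then i + 1 else i + 2))
      (trename (· + Φ.length) Φ ++ (Φ ++ Γ)) := by
    have := s2.wk_comp (Ψ := [A.rename (upR Φ.length (· + (Φ.length + 1)))]) (by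
      simpa only [← trename_eq_tsubst, trename, Nat.add_assoc, List.length_singleton] using! c3)
    convert this using 1
    · simp [Nat.add_assoc, trename, trename_eq_tsubst]
    · funext i
      simp only [Expr.up, List.length_singleton, Expr.wk, rename]
      split_ifs <;> simp only [rename]; congr 1; omega
    · rfl
  have c1 := h.ctx
  simp only [pathCxt, List.append_assoc] at c1
  have c4 := s3.tsubst_ctx c3 c1
  have s4 := s3.up c3 c1
  have hv := IsSub.var c4
  simp only [trename, List.cons_append, isSub_append, isSub_cons, length_tsubst, length_idVar,
    length_trename] at hv
  obtain ⟨-, v1, -, v2, -⟩ := hv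
  have e : pathCxt (A :: Φ) ++ Γ = (Expr.lastId (jTerm Φ) Φ.length A).rename (fun i =>
      if i = 0 then Φ.length else if i = 1 then 2 * Φ.length + 1
      else if i < Φ.length + 2 then i - 2 else if i < 2 * Φ.length + 2 then i - 1 else i) ::
      (tsubst (fun i => .var (if i < Φ.length then i + 1 else i + 2)) (idVar Φ) ++
      (trename (· + (Φ.length + 1)) (A :: Φ) ++ (A :: Φ ++ Γ))) := by
    simp [pathCxt, idVar, trename_eq_tsubst]
  rw [e, rename_eq_subst]
  refine .cons c4 (.subst (h.lastId hA) c4 ?_)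
  refine isSub_cons.2 ⟨?_, isSub_cons.2 ⟨?_, ?_⟩⟩
  · convert v1 using 2
    · rfl
    · simp
    · rw [Expr.secondType, subst_rename, subst_rename]
      congr 1
      funext i
      simp only [upR]
      split_ifs <;> first | contradiction | omega | exact congrArg _ (by omega)
  · convert v2 using 2
    · rfl
    · simp; omega
    · rw [wk_subst]
      congr 1
      funext i
      split_ifs <;> first | contradiction | omega | exact congrArg _ (by omega)
  · simp only [pathCxt, List.append_assoc]
    convert s4 using 1
    funext i
    rw [up_var_comp]
    simp only [upR, length_idVar]
    split_ifs <;> first | contradiction | omega | exact congrArg _ (by omega)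

theorem pathCxt_cons (Γ Φ : List (Expr T.sig)) (A : Expr T.sig) : pathCxt (A :: Φ) ++ Γ =
    (Expr.lastId (jTerm Φ) Φ.length A).rename (fun i =>
      if i = 0 then Φ.length else if i = 1 then 2 * Φ.length + 1
      else if i < Φ.length + 2 then i - 2 else if i < 2 * Φ.length + 2 then i - 1 else i) ::
      (tsubst (fun i => .var (if i < Φ.length then i + 1 else i + 2)) (idVar Φ) ++
      (A.rename (upR Φ.length (· + (Φ.length + 1))) ::
        (tsubst (fun i => .var (i + (Φ.length + 1))) Φ ++ (A :: (Φ ++ Γ))))) := by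
  simp [pathCxt, idVar, trename_eq_tsubst, trename, rename_eq_subst]

set_option maxHeartbeats 1000000 in
-- Both orders of the variables impose the same seven groups of typing conditions, listed
-- differently, so each condition is one of those for the identity substitution after index
-- bookkeeping. The same holds for the inverse, `ElimSpec.isSub_unshuffle`.
theorem ElimSpec.isSub_shuffle (h : ElimSpec T Γ Φ) (hA : T.Derives (Φ ++ Γ) (.isType A)) :
    T.IsSub (Expr.lastId (jTerm Φ) Φ.length A :: Expr.secondType Φ.length A ::
      A.wk (2 * Φ.length) :: (pathCxt Φ ++ Γ)) (fun i => .var (shuffle Φ.length i))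
      (pathCxt (A :: Φ) ++ Γ) := by
  have hL := h.lastId hA
  obtain ⟨Ξ, hΞ⟩ : ∃ Ξ, Ξ = Expr.lastId (jTerm Φ) Φ.length A :: Expr.secondType Φ.length A ::
      A.wk (2 * Φ.length) :: (pathCxt Φ ++ Γ) := ⟨_, rfl⟩
  have hv : T.IsSub Ξ .var (Expr.lastId (jTerm Φ) Φ.length A :: Expr.secondType Φ.length A ::
      A.wk (2 * Φ.length) :: (pathCxt Φ ++ Γ)) := by
    rw [hΞ]; exact IsSub.var (.cons hL.ctx hL)
  rw [← hΞ, pathCxt_cons]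
  rw [pathCxt] at hv
  simp only [List.append_assoc, isSub_cons, isSub_append, trename_eq_tsubst, isSub_tsubst,
    length_tsubst, length_idVar] at hv ⊢
  obtain ⟨h1, h2, h3, h4, h5, h6, h7⟩ := hv
  refine ⟨?_, ?_, ?_, ?_, ?_, ?_, ?_⟩
  · convert h1 using 2
    · simp [shuffle]
    rw [subst_rename]
    congr 1
    funext i
    simp only [shuffle]
    split_ifs <;> first | contradiction | omega | exact congrArg _ (by omega)
  · convert h4 using 1
    funext i
    simp only [shuffle, Expr.subst]
    split_ifs <;> first | contradiction | omega | exact congrArg _ (by omega)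
  · convert h2 using 2
    · simp [shuffle]
    rw [Expr.secondType, subst_rename, subst_rename]
    congr 1
    funext i
    simp only [shuffle, upR]
    split_ifs <;> first | contradiction | omega | exact congrArg _ (by omega)
  · convert h5 using 1
    funext i
    simp only [shuffle, Expr.subst]
    split_ifs <;> first | contradiction | omega | exact congrArg _ (by omega)
  · convert h3 using 2
    · simp only [shuffle]
      split_ifs <;> first | contradiction | omega | exact congrArg _ (by omega)
    rw [subst_rename]
    congr 1
    funext i
    simp only [shuffle]
    split_ifs <;> first | contradiction | omega | exact congrArg _ (by omega)
  · convert h6 using 1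
    funext i
    simp only [shuffle]
    split_ifs <;> first | contradiction | omega | exact congrArg _ (by omega)
  · convert h7 using 1
    funext i
    simp only [shuffle]
    split_ifs <;> first | contradiction | omega | exact congrArg _ (by omega)

set_option maxHeartbeats 1000000 in
theorem ElimSpec.isSub_unshuffle (h : ElimSpec T Γ Φ) (hA : T.Derives (Φ ++ Γ) (.isType A)) :
    T.IsSub (pathCxt (A :: Φ) ++ Γ) (fun i => .var (unshuffle Φ.length i))
      (Expr.lastId (jTerm Φ) Φ.length A :: Expr.secondType Φ.length A ::
      A.wk (2 * Φ.length) :: (pathCxt Φ ++ Γ)) := by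
  obtain ⟨Ξ, hΞ⟩ : ∃ Ξ, Ξ = pathCxt (A :: Φ) ++ Γ := ⟨_, rfl⟩
  have hv : T.IsSub Ξ .var (pathCxt (A :: Φ) ++ Γ) := by
    rw [hΞ]; exact IsSub.var (h.ctx_cons hA)
  rw [← hΞ, pathCxt]
  rw [pathCxt_cons] at hv
  simp only [List.append_assoc, isSub_cons, isSub_append, trename_eq_tsubst, isSub_tsubst,
    length_tsubst, length_idVar] at hv ⊢
  obtain ⟨h1, h4, h2, h5, h3, h6, h7⟩ := hv
  refine ⟨?_, ?_, ?_, ?_, ?_, ?_, ?_⟩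
  · convert h1 using 2
    · simp [unshuffle]
    rw [subst_rename]
    conv_lhs => rw [← subst_var (Expr.lastId (jTerm Φ) Φ.length A)]
    rw [subst_subst]
    congr 1
    funext i
    simp only [unshuffle, Expr.subst]
    split_ifs <;> first | contradiction | omega | exact congrArg _ (by omega)
  · convert h2 using 2
    · simp [unshuffle]
    rw [Expr.secondType, subst_rename, subst_rename]
    congr 1
    funext i
    simp only [unshuffle, upR]
    split_ifs <;> first | contradiction | omega | exact congrArg _ (by omega)
  · convert h3 using 2
    · simp only [unshuffle]
      split_ifs <;> first | contradiction | omega | exact congrArg _ (by omega)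
    rw [subst_rename]
    congr 1
    funext i
    simp only [unshuffle]
    split_ifs <;> first | contradiction | omega | exact congrArg _ (by omega)
  · convert h4 using 1
    funext i
    simp only [unshuffle, Expr.subst]
    split_ifs <;> first | contradiction | omega | exact congrArg _ (by omega)
  · convert h5 using 1
    funext i
    simp only [unshuffle, Expr.subst]
    split_ifs <;> first | contradiction | omega | exact congrArg _ (by omega)
  · convert h6 using 1
    funext i
    simp only [unshuffle]
    split_ifs <;> first | contradiction | omega | exact congrArg _ (by omega)
  · convert h7 using 1
    funext i
    simp only [unshuffle]
    split_ifs <;> first | contradiction | omega | exact congrArg _ (by omega)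

end Cons

end TypeTheory
namespace TypeTheory

variable {T : TypeTheory.{u}}

theorem diag_eq (Φ : List (Expr T.sig)) (i : ℕ) :
    (Expr.var (shuffle Φ.length i)).subst (up 3 (reflSub Φ)) = diag Φ i := by
  rw [Expr.subst, diag_apply]
  have h0 : up 3 (reflSub Φ) 0 = .var 0 := rfl
  have h1 : up 3 (reflSub Φ) 1 = .var 1 := rfl
  have h2 : up 3 (reflSub Φ) 2 = .var 2 := rfl
  have h3 : ∀ j, up 3 (reflSub Φ) (j + 3) = (reflSub Φ j).wk 3 := fun j => up_add _ _ _
  simp only [shuffle]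
  split_ifs with c1 c2 c3 c4 c5
  · rw [h0]
  · obtain ⟨j, rfl⟩ : ∃ j, i = j + 1 := ⟨i - 1, by omega⟩
    rw [show j + 1 + 2 = j + 3 from rfl, h3, reflSub_apply, if_pos (by omega)]
    rfl
  · rw [h1]
  · obtain ⟨j, rfl⟩ : ∃ j, i = j + 2 := ⟨i - 2, by omega⟩
    rw [show j + 2 + 1 = j + 3 from rfl, h3, reflSub_apply, if_neg (by omega), if_pos (by omega)]
    simp only [Expr.wk, rename]
    exact congrArg Expr.var (by omega)
  · rw [h2]
  · obtain ⟨j, rfl⟩ : ∃ j, i = j + 3 := ⟨i - 3, by omega⟩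
    rw [h3, reflSub_apply, if_neg (by omega), if_neg (by omega)]
    simp only [Expr.wk, rename]
    exact congrArg Expr.var (by omega)

/-- The diagonal of `(Φ, A)` is reached in two stages, first making `u` and then `u'` a reflexivity.
The two eliminations of `ElimSpec.elim_cons` follow these stages. -/
theorem reflSub_cons (Φ : List (Expr T.sig)) (A : Expr T.sig) (i : ℕ) :
    (diag Φ i).subst (push [.refl (.var 0), .var 0] .var) = reflSub (A :: Φ) i := by
  rw [reflSub_apply, diag_apply, List.length_cons]
  have h2 : ∀ j, (push [.refl (.var 0), .var 0] .var (j + 2) : Expr T.sig) = .var j := fun j => rfl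
  split_ifs <;> first | contradiction | omega | skip
  all_goals simp only [Expr.subst]
  · subst_vars; rfl
  · rw [h2]
  · rw [show i - (Φ.length + 1) = 0 by omega]; rfl
  · obtain ⟨j, rfl⟩ : ∃ j, i = j + (Φ.length + 2) := ⟨i - (Φ.length + 2), by omega⟩
    rw [show j + (Φ.length + 2) - Φ.length + 1 = j + 1 + 2 by omega, h2]
    exact congrArg _ (by omega)
  · subst_vars
    rw [show 2 * Φ.length + 2 - 2 * (Φ.length + 1) = 0 by omega]; rfl
  · obtain ⟨j, rfl⟩ : ∃ j, i = j + (2 * Φ.length + 2) := ⟨i - (2 * Φ.length + 2), by omega⟩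
    rw [show j + (2 * Φ.length + 2) - 2 * Φ.length = j + 2 by omega, h2]
    exact congrArg _ (by omega)

theorem unshuffle_shuffle (k i : ℕ) : unshuffle k (shuffle k i) = i := by
  simp only [shuffle, unshuffle]
  split_ifs <;> first | contradiction | omega

theorem shuffle_unshuffle (k i : ℕ) : shuffle k (unshuffle k i) = i := by
  simp only [shuffle, unshuffle]
  split_ifs <;> first | contradiction | omega

theorem reflSub_unshuffle (Φ : List (Expr T.sig)) (A : Expr T.sig) (i : ℕ) :
    reflSub (A :: Φ) (unshuffle Φ.length i) =
      (up 3 (reflSub Φ) i).subst (push [.refl (.var 0), .var 0] .var) := by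
  rw [← reflSub_cons, ← diag_eq, shuffle_unshuffle, Expr.subst]

section Cons

variable {Γ Φ : List (Expr T.sig)} {A : Expr T.sig}

/-- The context `(Γ, x ∈ Φ, x' ∈ A(x), y' ∈ A(x), u' ∈ Id(x', y'))`. -/
abbrev idTypeCxt (A : Expr T.sig) (Γ : List (Expr T.sig)) : List (Expr T.sig) :=
  .Id (A.wk 2) (.var 1) (.var 0) :: A.wk 1 :: A :: Γ

theorem Derives.idTypeCxt {Γ : List (Expr T.sig)} (hA : T.Derives Γ (.isType A)) :
    T.Derives (idTypeCxt A Γ) .ctx := by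
  have c1 := Derives.cons hA.ctx hA
  have h1 := hA.wk (Ψ := [A]) c1
  simp only [Judgement.subst, ← wk_eq_subst, List.length_singleton] at h1
  have c2 := Derives.cons c1 h1
  have v0 := Derives.var (i := 0) c2 rfl
  have v1 := Derives.var (i := 1) c2 rfl
  have e1 : (A.wk 1).wk 1 = A.wk 2 := by rw [wk_eq_subst (A.wk 1), wk_subst, wk_eq_subst]
  rw [Nat.zero_add, e1] at v0
  exact .cons c2 (.idForm v0.isType v1 v0)

theorem isSub_refl {Γ : List (Expr T.sig)} (hA : T.Derives Γ (.isType A)) :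
    T.IsSub (A :: Γ) (push [.refl (.var 0), .var 0] .var) (idTypeCxt A Γ) := by
  have c1 := Derives.cons hA.ctx hA
  have v0 := Derives.var (i := 0) c1 rfl
  rw [Nat.zero_add, wk_eq_subst] at v0
  simp only [isSub_cons, push_cons_zero, push_cons_succ, push_nil, Expr.subst,
    wk_subst]
  have hv := IsSub.var c1
  rw [isSub_cons] at hv
  exact ⟨.idIntro v0.isType v0, v0, v0, hv.2⟩

/-- The instance of `(x', y', u')` over `u = r(x)` and the context of the identity type of `A`
differ only by a definitional equality in the type of `u'`. Hence the variables form a substitution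
both ways, and judgements can be moved freely between the two. -/
theorem ElimSpec.diag (h : ElimSpec T Γ Φ) (hA : T.Derives (Φ ++ Γ) (.isType A)) :
    T.IsSub (idTypeCxt A (Φ ++ Γ)) .var (tsubst (reflSub Φ) [Expr.lastId (jTerm Φ) Φ.length A,
      Expr.secondType Φ.length A, A.wk (2 * Φ.length)] ++ (Φ ++ Γ)) ∧
    T.IsSub (tsubst (reflSub Φ) [Expr.lastId (jTerm Φ) Φ.length A,
      Expr.secondType Φ.length A, A.wk (2 * Φ.length)] ++ (Φ ++ Γ)) .var
      (idTypeCxt A (Φ ++ Γ)) ∧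
    T.IsSub (tsubst (reflSub Φ) [Expr.lastId (jTerm Φ) Φ.length A,
      Expr.secondType Φ.length A, A.wk (2 * Φ.length)] ++ (Φ ++ Γ)) (up 3 (reflSub Φ))
      ([Expr.lastId (jTerm Φ) Φ.length A, Expr.secondType Φ.length A, A.wk (2 * Φ.length)] ++
        (pathCxt Φ ++ Γ)) ∧
    T.Derives (tsubst (reflSub Φ) [Expr.lastId (jTerm Φ) Φ.length A,
      Expr.secondType Φ.length A, A.wk (2 * Φ.length)] ++ (Φ ++ Γ)) .ctx ∧
    T.IsSub (idTypeCxt A (Φ ++ Γ)) (Expr.diag Φ) (pathCxt (A :: Φ) ++ Γ) := by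
  have hL := h.lastId hA
  have hr := h.refl.up hA.ctx (Ψ := [Expr.lastId (jTerm Φ) Φ.length A,
      Expr.secondType Φ.length A, A.wk (2 * Φ.length)]) (.cons hL.ctx hL)
  have hc := h.refl.tsubst_ctx hA.ctx (Ψ := [Expr.lastId (jTerm Φ) Φ.length A,
      Expr.secondType Φ.length A, A.wk (2 * Φ.length)]) (.cons hL.ctx hL)
  have e := h.lastId_refl hA
  have h1 : T.IsSub (idTypeCxt A (Φ ++ Γ)) .var (tsubst (reflSub Φ) [Expr.lastId (jTerm Φ) Φ.length A,
      Expr.secondType Φ.length A, A.wk (2 * Φ.length)] ++ (Φ ++ Γ)) := by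
    simp only [tsubst, List.length_cons, List.length_nil, Nat.zero_add, up_zero, firstType_subst,
      secondType_subst]
    exact IsSub.var_cons e
  have h2 : T.IsSub (tsubst (reflSub Φ) [Expr.lastId (jTerm Φ) Φ.length A,
      Expr.secondType Φ.length A, A.wk (2 * Φ.length)] ++ (Φ ++ Γ)) .var
      (idTypeCxt A (Φ ++ Γ)) := by
    simp only [tsubst, List.length_cons, List.length_nil, Nat.zero_add, up_zero, firstType_subst,
      secondType_subst]
    exact IsSub.var_cons (.symmType e)
  refine ⟨h1, h2, hr, hc, ?_⟩
  have := ((h.isSub_shuffle hA).comp hr hc).comp h1 hA.idTypeCxt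
  convert this using 2 with i
  rw [subst_var]
  exact (diag_eq Φ i).symm

theorem ElimSpec.refl_cons (h : ElimSpec T Γ Φ) (hA : T.Derives (Φ ++ Γ) (.isType A)) :
    T.IsSub (A :: Φ ++ Γ) (reflSub (A :: Φ)) (pathCxt (A :: Φ) ++ Γ) := by
  have := (h.diag hA).2.2.2.2.comp (isSub_refl hA) (.cons hA.ctx hA)
  rw [funext (reflSub_cons Φ A)] at this
  exact this

/-- Eliminate on `u'` over the diagonal `u = r(x)`, where it lies in an identity type of `A`, and
use the result as eliminating term for `u` with parameters `(x', y', u', Θ)`. That `J` admits a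
parameter context is essential here. -/
theorem ElimSpec.elim_cons (h : ElimSpec T Γ Φ) (hA : T.Derives (Φ ++ Γ) (.isType A))
    (Θ : List (Expr T.sig)) (C d : Expr T.sig)
    (hC : T.Derives (Θ ++ (pathCxt (A :: Φ) ++ Γ)) (.isType C))
    (hd : T.Derives (tsubst (reflSub (A :: Φ)) Θ ++ (A :: Φ ++ Γ))
      (.isTerm d (C.subst (up Θ.length (reflSub (A :: Φ)))))) :
    T.Derives (Θ ++ (pathCxt (A :: Φ) ++ Γ)) (.isTerm (jTerm (A :: Φ) Θ C d) C) ∧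
    T.Derives (tsubst (reflSub (A :: Φ)) Θ ++ (A :: Φ ++ Γ))
      (.eqTerm ((jTerm (A :: Φ) Θ C d).subst (up Θ.length (reflSub (A :: Φ)))) d
        (C.subst (up Θ.length (reflSub (A :: Φ))))) := by
  obtain ⟨s1, s2, s3, c3, s4⟩ := h.diag hA
  have hL := h.lastId hA
  set l := Θ.length with hl
  set ρ : ℕ → Expr T.sig := push [.refl (.var 0), .var 0] .var with hρ
  set X := [Expr.lastId (jTerm Φ) Φ.length A, Expr.secondType Φ.length A, A.wk (2 * Φ.length)]
    with hX
  have cX : T.Derives (X ++ (pathCxt Φ ++ Γ)) .ctx := .cons hL.ctx hL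
  have c0 := hA.idTypeCxt
  have hsh := h.isSub_shuffle hA
  have eρ : ∀ Θ : List (Expr T.sig), tsubst ρ (tsubst (Expr.diag Φ) Θ) =
      tsubst (reflSub (A :: Φ)) Θ := by
    intro Θ; rw [tsubst_tsubst, funext (reflSub_cons Φ A)]
  have eρ' : ∀ e : Expr T.sig, (e.subst (up l (Expr.diag Φ))).subst (up l ρ) =
      e.subst (up l (reflSub (A :: Φ))) := by
    intro e; rw [subst_subst, funext (subst_up_up l _ _), funext (reflSub_cons Φ A)]
  have eD : ∀ Θ : List (Expr T.sig), tsubst (up 3 (reflSub Φ)) (trename (shuffle Φ.length) Θ) =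
      tsubst (Expr.diag Φ) Θ := by
    intro Θ; rw [trename_eq_tsubst, tsubst_tsubst, funext (diag_eq Φ)]
  have eD' : ∀ e : Expr T.sig, (e.rename (upR l (shuffle Φ.length))).subst
      (up (l + 3) (reflSub Φ)) = e.subst (up l (Expr.diag Φ)) := by
    intro e
    rw [← up_up, subst_rename, funext (up_upR l _ _), ← funext (diag_eq Φ)]
    rfl
  -- elimination on the last component
  have hCd := Derives.subst hC (s4.tsubst_ctx c0 hC.ctx) (s4.up c0 hC.ctx)
  have hd' : T.Derives (tsubst ρ (tsubst (Expr.diag Φ) Θ) ++ A :: (Φ ++ Γ)) (.isTerm d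
      ((C.subst (up l (Expr.diag Φ))).subst (up (tsubst (Expr.diag Φ) Θ).length ρ))) := by
    rw [length_tsubst, eρ, ← hl, eρ']; exact hd
  have j1 := jVar_type hCd hd'
  have j2 := jVar_comp hCd hd'
  rw [← hρ, length_tsubst, eρ, ← hl, eρ'] at j2
  set d₁ := jVar A (tsubst (Expr.diag Φ) Θ) (C.subst (up l (Expr.diag Φ))) d with hd₁
  -- elimination on the first components
  set Θ₁ := trename (shuffle Φ.length) Θ ++ X with hΘ₁
  have lΘ₁ : Θ₁.length = l + 3 := by simp [hΘ₁, hX, hl]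
  have cΘ₁ := hsh.tsubst_ctx cX hC.ctx
  have hC₁ := Derives.subst hC cΘ₁ (hsh.up cX hC.ctx)
  rw [up_var_comp, Judgement.subst, ← rename_eq_subst, ← trename_eq_tsubst] at hC₁
  have eΘ₁ : tsubst (reflSub Φ) Θ₁ ++ (Φ ++ Γ) =
      tsubst (Expr.diag Φ) Θ ++ (tsubst (reflSub Φ) X ++ (Φ ++ Γ)) := by
    rw [hΘ₁, tsubst_append, show X.length = 3 from rfl, eD, List.append_assoc]
  have sΘ : T.IsSub (tsubst (Expr.diag Φ) Θ ++ (tsubst (reflSub Φ) X ++ (Φ ++ Γ))) .var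
      (tsubst (Expr.diag Φ) Θ ++ idTypeCxt A (Φ ++ Γ)) := s2.up_var c3 hCd.ctx
  have sΘ' : T.IsSub (tsubst (Expr.diag Φ) Θ ++ idTypeCxt A (Φ ++ Γ)) .var
      (tsubst (Expr.diag Φ) Θ ++ (tsubst (reflSub Φ) X ++ (Φ ++ Γ))) := by
    refine s1.up_var c0 ?_
    have := s2.tsubst_ctx c3 hCd.ctx
    rwa [tsubst_var] at this
  have cΘ : T.Derives (tsubst (Expr.diag Φ) Θ ++ (tsubst (reflSub Φ) X ++ (Φ ++ Γ))) .ctx := by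
    have := s2.tsubst_ctx c3 hCd.ctx
    rwa [tsubst_var] at this
  -- The term obtained on the diagonal is moved to the context in which elimination on `u` expects
  -- its eliminating term; the two contexts agree up to definitional equality.
  have hd₂ : T.Derives (tsubst (reflSub Φ) Θ₁ ++ (Φ ++ Γ)) (.isTerm d₁
      ((C.rename (upR l (shuffle Φ.length))).subst (up Θ₁.length (reflSub Φ)))) := by
    rw [eΘ₁, lΘ₁, eD']
    exact j1.conv_ctx sΘ cΘ
  obtain ⟨k1, k2⟩ := h.elim Θ₁ (C.rename (upR l (shuffle Φ.length))) d₁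
    (by rw [hΘ₁, List.append_assoc]; exact hC₁) hd₂
  rw [eΘ₁, lΘ₁, eD'] at k2
  have eJ : jTerm (A :: Φ) Θ C d = (jTerm Φ Θ₁ (C.rename (upR l (shuffle Φ.length))) d₁).rename
      (upR l (unshuffle Φ.length)) := rfl
  set J₁ := jTerm Φ Θ₁ (C.rename (upR l (shuffle Φ.length))) d₁ with hJ₁
  have hun := h.isSub_unshuffle hA
  have cP := h.ctx_cons hA
  rw [hΘ₁, List.append_assoc] at k1
  have eun : trename (unshuffle Φ.length) (trename (shuffle Φ.length) Θ) = Θ := by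
    rw [trename_eq_tsubst, tsubst_trename]
    simp only [unshuffle_shuffle, tsubst_var]
  rw [eJ]
  constructor
  · have := Derives.subst k1 (hun.tsubst_ctx cP k1.ctx) (hun.up cP k1.ctx)
    rw [up_var_comp, length_trename, ← hl, ← trename_eq_tsubst, eun, Judgement.subst,
      ← rename_eq_subst, ← rename_eq_subst] at this
    convert this using 2
    rw [rename_eq_subst, subst_rename]
    conv_lhs => rw [← subst_var C]
    refine subst_ext (fun i => ?_) C
    simp only [upR]
    split_ifs with h1 h2
    · rfl
    · omega
    · rw [Nat.add_sub_cancel, unshuffle_shuffle, Nat.sub_add_cancel (by omega)]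
  -- Computation takes place in the same two stages: at `u = r(x)` the outer elimination returns
  -- `d₁`, and at `u' = r(x')` the term `d₁` computes to `d`.
  · have k3 := k2.conv_ctx sΘ' hCd.ctx
    have sρ := isSub_refl hA
    have k4 := Derives.subst k3 (sρ.tsubst_ctx (.cons hA.ctx hA) hCd.ctx)
      (sρ.up (.cons hA.ctx hA) hCd.ctx)
    rw [length_tsubst, ← hl, ← hρ, eρ, Judgement.subst, eρ'] at k4
    have k5 := Derives.transTerm k4 j2
    rw [← List.cons_append] at k5
    convert k5 using 2
    rw [subst_rename, subst_subst]
    refine subst_ext (fun i => ?_) _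
    rw [← up_up, up_upR, subst_up_up, funext (reflSub_unshuffle Φ A)]

end Cons

theorem elimSpec_nil {Γ : List (Expr T.sig)} (hΓ : T.Derives Γ .ctx) : ElimSpec T Γ [] := by
  have e : reflSub ([] : List (Expr T.sig)) = .var := by
    funext i; simp [reflSub_apply]
  have e2 : pathCxt ([] : List (Expr T.sig)) = [] := rfl
  refine ⟨hΓ, by rw [e]; exact IsSub.var hΓ, fun Θ C d hC hd => ?_⟩
  rw [e, tsubst_var, up_var, subst_var] at hd
  rw [e, tsubst_var, up_var, subst_var, subst_var]
  exact ⟨hd, .reflTerm hd⟩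

theorem elimSpec {Γ Φ : List (Expr T.sig)} (h : T.Derives (Φ ++ Γ) .ctx) : ElimSpec T Γ Φ := by
  induction Φ with
  | nil => exact elimSpec_nil h
  | cons A Φ ih =>
    have ih := ih h.tail
    exact ⟨ih.ctx_cons h.head, ih.refl_cons h.head, ih.elim_cons h.head⟩

/-- Elimination for identity contexts, with an eliminating context `Ω`. -/
theorem jTerms_spec {Γ Φ Θ : List (Expr T.sig)} (h : T.Derives (Φ ++ Γ) .ctx) :
    ∀ {Ω ds : List (Expr T.sig)} (_ : T.Derives (Ω ++ (Θ ++ (pathCxt Φ ++ Γ))) .ctx)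
      (_ : T.IsElem (tsubst (reflSub Φ) Θ ++ (Φ ++ Γ)) ds (tsubst (up Θ.length (reflSub Φ)) Ω)),
    T.IsElem (Θ ++ (pathCxt Φ ++ Γ)) (jTerms Φ Θ Ω ds) Ω ∧
    T.EqElem (tsubst (reflSub Φ) Θ ++ (Φ ++ Γ))
      ((jTerms Φ Θ Ω ds).map (Expr.subst (up Θ.length (reflSub Φ)))) ds
      (tsubst (up Θ.length (reflSub Φ)) Ω) := by
  intro Ω
  induction Ω with
  | nil =>
    intro ds _ hds
    obtain rfl : ds = [] := List.length_eq_zero_iff.1 hds.1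
    exact ⟨⟨rfl, isSub_nil _ _⟩, eqSub_nil _ _ _⟩
  | cons C Ω ih =>
    intro ds hΩ hds
    obtain ⟨d, ds, rfl⟩ : ∃ d ds', ds = d :: ds' := by
      have := hds.1
      cases ds with
      | nil => simp at this
      | cons d ds => exact ⟨d, ds, rfl⟩
    have hsp := elimSpec h
    set τ := up Θ.length (reflSub Φ) with hτ
    have hlen : (d :: ds).length = (C :: Ω).length := by simpa using hds.1
    have hlen' : ds.length = Ω.length := by simpa using hlen
    have hds' := (isElem_tsubst_iff.1 hds).2
    rw [isSub_cons] at hds'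
    simp only [push_cons_succ] at hds'
    obtain ⟨hd, hds'⟩ := hds'
    have hds'' : T.IsElem (tsubst (reflSub Φ) Θ ++ (Φ ++ Γ)) ds (tsubst τ Ω) :=
      isElem_tsubst_iff.2 ⟨hlen', hds'⟩
    obtain ⟨i1, i2⟩ := ih hΩ.tail hds''
    set js := jTerms Φ Θ Ω ds with hjs
    have cΘ := hΩ.tail.of_append
    have sτ : T.IsSub (tsubst (reflSub Φ) Θ ++ (Φ ++ Γ)) τ (Θ ++ (pathCxt Φ ++ Γ)) :=
      hsp.refl.up h cΘ
    have cτ := hds''.2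
    have cΘ' : T.Derives (tsubst (reflSub Φ) Θ ++ (Φ ++ Γ)) .ctx := hsp.refl.tsubst_ctx h cΘ
    have p1 : T.IsSub (Θ ++ (pathCxt Φ ++ Γ)) (push js .var) (Ω ++ (Θ ++ (pathCxt Φ ++ Γ))) :=
      (IsSub.var cΘ).push (by rw [tsubst_var]; exact i1)
    have hC' := Derives.subst hΩ.head cΘ p1
    have ljs : (js.map (Expr.subst τ)).length = Ω.length := by simpa using i1.1
    have i1' : T.IsElem (tsubst (reflSub Φ) Θ ++ (Φ ++ Γ)) (js.map (Expr.subst τ))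
        (tsubst τ Ω) := by
      refine isElem_tsubst_iff.2 ⟨ljs, ?_⟩
      have := (isSub_append.1 (p1.comp sτ cΘ')).1
      simpa only [subst_push, Expr.subst] using this
    have p2 : T.IsSub (tsubst (reflSub Φ) Θ ++ (Φ ++ Γ)) (push (js.map (Expr.subst τ)) τ)
        (Ω ++ (Θ ++ (pathCxt Φ ++ Γ))) := sτ.push i1'
    have p3 : T.EqSub (tsubst (reflSub Φ) Θ ++ (Φ ++ Γ)) (push (js.map (Expr.subst τ)) τ)
        (push ds τ) (Ω ++ (Θ ++ (pathCxt Φ ++ Γ))) :=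
      (EqSub.refl sτ).push sτ i1' hds'' i2 cΘ' hΩ.tail
    have p4 := p3.isSub_right p2 cΘ' hΩ.tail
    -- On the diagonal the components already constructed equal `ds` only up to definitional
    -- equality, so the next type must be converted before it can be used for elimination.
    have hcc := p2.eqType p4 p3 cΘ' hΩ.head
    have eC : (C.subst (push js .var)).subst τ = C.subst (push (js.map (Expr.subst τ)) τ) := by
      rw [subst_subst]
      exact subst_ext (fun i => subst_push _ _ _ _) C
    obtain ⟨k1, k2⟩ := hsp.elim Θ (C.subst (push js .var)) d hC' (by
      rw [← hτ, eC]; exact hd.conv (.symmType hcc))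
    have ejs : jTerms Φ Θ (C :: Ω) (d :: ds) = jTerm Φ Θ (C.subst (push js .var)) d :: js := rfl
    rw [ejs]
    refine ⟨⟨by simpa using i1.1, isSub_cons.2 ⟨?_, ?_⟩⟩, ?_⟩
    · simp only [push_cons_succ, push_cons_zero]
      exact k1
    · simp only [push_cons_succ]
      exact i1.2
    · rw [List.map_cons, eqElem_tsubst_iff (by simpa using i1.1) hlen, eqSub_cons]
      simp only [push_cons_succ]
      refine ⟨?_, (eqSub_append.1 p3).1⟩
      rw [← hτ, eC] at k2
      exact k2

end TypeTheory

namespace TypeTheory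

variable {T : TypeTheory.{u}}

/-! ### Context morphisms as substitutions -/

theorem IsSub.congr {Δ Γ : List (Expr T.sig)} {σ τ : ℕ → Expr T.sig} (h : T.IsSub Δ σ Γ)
    (hΓ : T.Derives Γ .ctx) (hστ : ∀ i < Γ.length, σ i = τ i) : T.IsSub Δ τ Γ := by
  intro i B hi
  rw [← hστ i (List.getElem?_eq_some_iff.1 hi).1,
    ← Expr.subst_congr _ (hΓ.scoped.1.get hi) hστ]
  exact h i B hi

theorem EqSub.congr {Δ Γ : List (Expr T.sig)} {σ σ' τ τ' : ℕ → Expr T.sig}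
    (h : T.EqSub Δ σ σ' Γ) (hΓ : T.Derives Γ .ctx) (hτ : ∀ i < Γ.length, σ i = τ i)
    (hτ' : ∀ i < Γ.length, σ' i = τ' i) : T.EqSub Δ τ τ' Γ := by
  intro i B hi
  have hi' := (List.getElem?_eq_some_iff.1 hi).1
  rw [← hτ i hi', ← hτ' i hi', ← Expr.subst_congr _ (hΓ.scoped.1.get hi) hτ]
  exact h i B hi

theorem EqSub.congr_right {Δ Γ : List (Expr T.sig)} {σ σ' τ' : ℕ → Expr T.sig}
    (h : T.EqSub Δ σ σ' Γ) (hτ' : ∀ i < Γ.length, σ' i = τ' i) : T.EqSub Δ σ τ' Γ := by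
  intro i B hi
  rw [← hτ' i (List.getElem?_eq_some_iff.1 hi).1]
  exact h i B hi

theorem IsSub.eqSub_congr {Δ Γ : List (Expr T.sig)} {σ τ : ℕ → Expr T.sig} (h : T.IsSub Δ σ Γ)
    (hστ : ∀ i < Γ.length, σ i = τ i) : T.EqSub Δ σ τ Γ :=
  (EqSub.refl h).congr_right hστ

/-- The sequence of the first `n` entries of a substitution. -/
def _root_.Expr.take {S : Signature.{u}} (n : ℕ) (σ : ℕ → Expr S) : List (Expr S) :=
  (List.range n).map σ

@[simp] theorem _root_.Expr.length_take {S : Signature.{u}} (n : ℕ) (σ : ℕ → Expr S) :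
    (take n σ).length = n := by simp [take]

theorem _root_.Expr.push_take {S : Signature.{u}} (n : ℕ) (σ τ : ℕ → Expr S) (i : ℕ) :
    push (take n σ) τ i = if i < n then σ i else τ (i - n) := by
  simp only [push, take, List.getD, List.length_map, List.length_range, List.getElem?_map]
  split_ifs with h
  · simp [h]
  · simp [h]

theorem IsSub.isElem {Δ Γ : List (Expr T.sig)} {σ : ℕ → Expr T.sig} (h : T.IsSub Δ σ Γ)
    (hΓ : T.Derives Γ .ctx) : T.IsElem Δ (take Γ.length σ) Γ :=
  ⟨by simp, h.congr hΓ fun i hi => by rw [push_take, if_pos hi]⟩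

end TypeTheory

theorem CategoryTheory.isPullback_of_exists_lift {C : Type*} [Category* C] {P X Y Z : C}
    {fst : P ⟶ X} {snd : P ⟶ Y} {f : X ⟶ Z} {g : Y ⟶ Z} (w : fst ≫ f = snd ≫ g)
    (lift : ∀ {W : C} (a : W ⟶ X) (b : W ⟶ Y), a ≫ f = b ≫ g →
      ∃ l : W ⟶ P, l ≫ fst = a ∧ l ≫ snd = b)
    (ext : ∀ {W : C} (l l' : W ⟶ P), l ≫ fst = l' ≫ fst → l ≫ snd = l' ≫ snd → l = l') :
    IsPullback fst snd f g := by
  choose l h1 h2 using @lift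
  exact ⟨⟨w⟩, ⟨Limits.PullbackCone.IsLimit.mk w (fun c => l c.fst c.snd c.condition)
    (fun c => h1 _ _ _) (fun c => h2 _ _ _)
    fun c m h h' => ext _ _ (h.trans (h1 _ _ _).symm) (h'.trans (h2 _ _ _).symm)⟩⟩

/-! ### The category of contexts in terms of substitutions -/

namespace Cxt

open TypeTheory

variable {T : TypeTheory.{u}} {Γ Δ Ξ : Cxt T}

/-- The context morphism given by a substitution. -/
def sub (σ : ℕ → Expr T.sig) (h : T.IsSub Γ.toList σ Δ.toList) : Γ ⟶ Δ :=
  Quot.mk _ ⟨take Δ.len σ, h.isElem Δ.wf⟩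

/-- Definitional equality of elements is already an equivalence relation, so passing to the quotient
creates no further identifications. -/
theorem mk_eq_mk_iff {s s' : {s : List (Expr T.sig) // T.IsElem Γ.toList s Δ.toList}} :
    (Quot.mk _ s : Γ ⟶ Δ) = Quot.mk _ s' ↔ T.EqElem Γ.toList s.1 s'.1 Δ.toList := by
  have he : Equivalence fun s s' : {s : List (Expr T.sig) // T.IsElem Γ.toList s Δ.toList} =>
      T.EqElem Γ.toList s.1 s'.1 Δ.toList :=
    ⟨fun s => EqSub.refl s.2.2, fun {s s'} h => EqSub.symm h s.2.2 Γ.wf Δ.wf,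
      fun {s s' s''} h h' => EqSub.trans h h' s.2.2 Γ.wf Δ.wf⟩
  exact ⟨fun h => he.eqvGen_iff.1 (Quot.eqvGen_exact h), fun h => Quot.sound h⟩

theorem sub_eq_sub_iff {σ τ : ℕ → Expr T.sig} {h : T.IsSub Γ.toList σ Δ.toList}
    {h' : T.IsSub Γ.toList τ Δ.toList} : sub σ h = sub τ h' ↔ T.EqSub Γ.toList σ τ Δ.toList := by
  refine mk_eq_mk_iff.trans ⟨fun h => EqSub.congr h Δ.wf ?_ ?_, fun h => EqSub.congr h Δ.wf ?_ ?_⟩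
  all_goals intro i hi; rw [push_take, if_pos hi]

theorem mk_eq_sub (s : {s : List (Expr T.sig) // T.IsElem Γ.toList s Δ.toList}) :
    (Quot.mk _ s : Γ ⟶ Δ) = sub (push s.1 .var) s.2.2 := by
  refine mk_eq_mk_iff.2 (IsSub.eqSub_congr s.2.2 fun i hi => ?_)
  rw [push_take, if_pos hi]

theorem exists_sub (f : Γ ⟶ Δ) : ∃ (σ : ℕ → Expr T.sig) (h : T.IsSub Γ.toList σ Δ.toList),
    f = sub σ h := by
  induction f using Quot.ind with | _ s
  exact ⟨_, _, mk_eq_sub s⟩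

theorem represents_iff {f : Γ ⟶ Δ} {s : List (Expr T.sig)} : Represents f s ↔
    s.length = Δ.len ∧ ∃ h : T.IsSub Γ.toList (push s .var) Δ.toList, f = sub _ h := by
  constructor
  · rintro ⟨h, rfl⟩
    exact ⟨h.1, h.2, mk_eq_sub _⟩
  · rintro ⟨h1, h2, rfl⟩
    exact ⟨⟨h1, h2⟩, (mk_eq_sub ⟨s, _⟩).symm⟩

theorem sub_eq_sub {σ τ : ℕ → Expr T.sig} {h : T.IsSub Γ.toList σ Δ.toList}
    {h' : T.IsSub Γ.toList τ Δ.toList} (hστ : ∀ i < Δ.len, σ i = τ i) : sub σ h = sub τ h' :=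
  sub_eq_sub_iff.2 (h.eqSub_congr hστ)

theorem sub_comp_sub {σ τ : ℕ → Expr T.sig} (h : T.IsSub Γ.toList σ Δ.toList)
    (h' : T.IsSub Δ.toList τ Ξ.toList) :
    sub σ h ≫ sub τ h' = sub (fun i => (τ i).subst σ) (h'.comp h Γ.wf) := by
  refine (mk_eq_sub _).trans (sub_eq_sub fun i hi => ?_)
  simp only
  rw [push_comp (by simpa using hi), push_take, if_pos hi]
  have hσ := (h'.isElem Ξ.wf).scoped (τ i)
    (by simp only [take, List.mem_map, List.mem_range]; exact ⟨i, hi, rfl⟩)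
  exact Expr.subst_congr _ hσ fun j hj => by rw [push_take, if_pos hj]

theorem id_eq_sub (Γ : Cxt T) : 𝟙 Γ = sub .var (IsSub.var Γ.wf) := by
  refine (mk_eq_sub _).trans (sub_eq_sub fun i hi => ?_)
  rw [push_vars, if_pos hi, Nat.zero_add]

theorem hom_ext_empty (f g : Γ ⟶ empty T) : f = g := by
  obtain ⟨σ, h, rfl⟩ := exists_sub f
  obtain ⟨τ, h', rfl⟩ := exists_sub g
  exact sub_eq_sub_iff.2 (eqSub_nil _ _ _)

/-! ### Projections -/

variable {E B : Cxt T} {Ψ : List (Expr T.sig)}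

/-- The projection from `(B, Ψ)` to `B`. -/
def proj (hE : E.toList = Ψ ++ B.toList) : E ⟶ B :=
  sub (fun i => .var (i + Ψ.length)) (by rw [hE]; exact IsSub.wk (hE ▸ E.wf))

theorem isSub_push {A : Cxt T} (hE : E.toList = Ψ ++ B.toList) {τ : ℕ → Expr T.sig}
    (hτ : T.IsSub A.toList τ B.toList) {ds : List (Expr T.sig)}
    (hds : T.IsElem A.toList ds (tsubst τ Ψ)) : T.IsSub A.toList (push ds τ) E.toList := by
  rw [hE]; exact hτ.push hds

theorem sub_push_comp_proj {A : Cxt T} (hE : E.toList = Ψ ++ B.toList) {τ : ℕ → Expr T.sig}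
    (hτ : T.IsSub A.toList τ B.toList) {ds : List (Expr T.sig)}
    (hds : T.IsElem A.toList ds (tsubst τ Ψ)) :
    sub (push ds τ) (isSub_push hE hτ hds) ≫ proj hE = sub τ hτ := by
  rw [proj, sub_comp_sub]
  exact sub_eq_sub fun i hi => by rw [Expr.subst, push_add' (by simpa using hds.1)]

theorem sub_push_eq_iff {A : Cxt T} (hE : E.toList = Ψ ++ B.toList) {τ : ℕ → Expr T.sig}
    (hτ : T.IsSub A.toList τ B.toList) {ds ds' : List (Expr T.sig)}
    (hds : T.IsElem A.toList ds (tsubst τ Ψ)) (hds' : T.IsElem A.toList ds' (tsubst τ Ψ)) :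
    sub (push ds τ) (isSub_push hE hτ hds) = sub (push ds' τ) (isSub_push hE hτ hds') ↔
      T.EqElem A.toList ds ds' (tsubst τ Ψ) := by
  have l1 : ds.length = Ψ.length := by simpa using hds.1
  have l2 : ds'.length = Ψ.length := by simpa using hds'.1
  rw [sub_eq_sub_iff, hE, eqSub_append, eqElem_tsubst_iff l1 l2]
  refine ⟨And.left, fun h => ⟨h, ?_⟩⟩
  simpa only [push_add' l1, push_add' l2] using EqSub.refl hτ

/-- A map to `(B, Ψ)` is given by a map to `B` and a dependent element of `Ψ`. -/
theorem exists_push {A : Cxt T} (hE : E.toList = Ψ ++ B.toList) {τ : ℕ → Expr T.sig}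
    (hτ : T.IsSub A.toList τ B.toList) {a : A ⟶ E} (ha : a ≫ proj hE = sub τ hτ) :
    ∃ (ds : List (Expr T.sig)) (hds : T.IsElem A.toList ds (tsubst τ Ψ)),
      a = sub (push ds τ) (isSub_push hE hτ hds) := by
  obtain ⟨α, hα, rfl⟩ := exists_sub a
  rw [proj, sub_comp_sub, sub_eq_sub_iff] at ha
  simp only [Expr.subst] at ha
  have h1 := hα
  rw [hE, isSub_append] at h1
  have e : ∀ i, push (take Ψ.length α) (fun j => α (j + Ψ.length)) i = α i := by
    intro i; rw [push_take]; split_ifs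
    · rfl
    · rw [Nat.sub_add_cancel (by omega)]
  have h2 : T.IsElem A.toList (take Ψ.length α) (tsubst (fun j => α (j + Ψ.length)) Ψ) :=
    isElem_tsubst_iff.2 ⟨by simp, by rw [funext e]; exact h1.1⟩
  have hΨ : T.Derives (Ψ ++ B.toList) .ctx := hE ▸ E.wf
  refine ⟨_, h2.conv ha h1.2 A.wf hΨ, ?_⟩
  rw [sub_eq_sub_iff, hE]
  have := ha.push_left h2
  rwa [funext e] at this

/-- Substitution in dependent contexts gives pullbacks. -/
theorem isPullback_up {E' B' : Cxt T} (hE : E.toList = Ψ ++ B.toList) {σ : ℕ → Expr T.sig}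
    (hE' : E'.toList = tsubst σ Ψ ++ B'.toList) (hσ : T.IsSub B'.toList σ B.toList)
    (hσ' : T.IsSub E'.toList (up Ψ.length σ) E.toList) :
    IsPullback (sub (up Ψ.length σ) hσ') (proj hE') (proj hE) (sub σ hσ) := by
  refine isPullback_of_exists_lift ?_ ?_ ?_
  · simp only [proj, sub_comp_sub]
    refine sub_eq_sub fun i hi => ?_
    rw [Expr.subst, up_add, length_tsubst, wk_eq_subst]
  · intro X a b hc
    obtain ⟨η, hη, rfl⟩ := exists_sub b
    rw [sub_comp_sub] at hc
    obtain ⟨ds, hds, rfl⟩ := exists_push hE _ hc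
    have hds' := hds
    rw [← tsubst_tsubst] at hds'
    refine ⟨sub _ (isSub_push hE' hη hds'), ?_, sub_push_comp_proj hE' hη hds'⟩
    rw [sub_comp_sub]
    refine sub_eq_sub fun i hi => ?_
    rw [up_subst_push (by simpa using hds.1)]
  · intro X l l' h1 h2
    obtain ⟨α, hα, rfl⟩ := exists_sub l
    obtain ⟨β, hβ, rfl⟩ := exists_sub l'
    simp only [proj, sub_comp_sub, sub_eq_sub_iff] at h1 h2 ⊢
    rw [hE, eqSub_append] at h1
    rw [hE', eqSub_append, eqSub_tsubst, length_tsubst]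
    rw [length_tsubst] at h2
    refine ⟨?_, h2⟩
    have e : ∀ γ : ℕ → Expr T.sig, (fun i => (up Ψ.length σ i).subst γ) = fun j =>
        if j < Ψ.length then γ j else (σ (j - Ψ.length)).subst fun i => γ (i + Ψ.length) := by
      intro γ; funext j
      split_ifs with h
      · rw [up_lt h, Expr.subst]
      · obtain ⟨k, rfl⟩ : ∃ k, j = k + Ψ.length := ⟨j - Ψ.length, by omega⟩
        rw [up_add, wk_subst, Nat.add_sub_cancel]
    rw [e, e] at h1
    exact h1.1

end Cxt

/-! ### Abstract homotopy theory of categories with path objects -/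

namespace CategoryTheory

universe v w

variable {C : Type w} [Category.{v} C]

/-- A path object of `p : E ⟶ B` with respect to a class of fibrations: a factorisation of the
diagonal of `E` over `B` into a fibration and a map `r` such that, after any change of base
`B' ⟶ B`, the pullbacks of `r` along fibrations have the left lifting property with respect to
fibrations. -/
structure PathObject (Fib : MorphismProperty C) {E B : C} (p : E ⟶ B) where
  obj : C
  r : E ⟶ obj
  s : obj ⟶ E
  t : obj ⟶ E
  r_s : r ≫ s = 𝟙 E
  r_t : r ≫ t = 𝟙 E
  w : s ≫ p = t ≫ p
  fib {D : C} {a b : D ⟶ E} (h : IsPullback a b p p) {m : obj ⟶ D} (hs : m ≫ a = s)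
    (ht : m ≫ b = t) : Fib m
  elim {B' P' Q R : C} {f : B' ⟶ B} {g : P' ⟶ obj} {p' : P' ⟶ B'}
    (h : IsPullback g p' (s ≫ p) f) {q : Q ⟶ P'} (hq : Fib q) {e : R ⟶ E} {j : R ⟶ Q}
    (h' : IsPullback e j r (q ≫ g)) : Fib.llp j

namespace PathObject

variable {Fib : MorphismProperty C} {E B : C} {p : E ⟶ B} (L : PathObject Fib p)

attribute [simp] r_s r_t

@[simp]
theorem r_s_assoc {Z : C} (h : E ⟶ Z) : L.r ≫ L.s ≫ h = h := by
  rw [← Category.assoc, L.r_s, Category.id_comp]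

@[simp]
theorem r_t_assoc {Z : C} (h : E ⟶ Z) : L.r ≫ L.t ≫ h = h := by
  rw [← Category.assoc, L.r_t, Category.id_comp]

end PathObject

/-- A category with a class of fibrations which has path objects. -/
structure PathCategory (C : Type w) [Category.{v} C] where
  Fib : MorphismProperty C
  id_mem (X : C) : Fib (𝟙 X)
  comp_mem {X Y Z : C} {p : X ⟶ Y} {q : Y ⟶ Z} : Fib p → Fib q → Fib (p ≫ q)
  baseChange {E' E B' B : C} {f' : E' ⟶ E} {p' : E' ⟶ B'} {p : E ⟶ B} {f : B' ⟶ B} :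
    IsPullback f' p' p f → Fib p → Fib p'
  exists_pullback {E B B' : C} {p : E ⟶ B} : Fib p → ∀ f : B' ⟶ B,
    ∃ (E' : C) (f' : E' ⟶ E) (p' : E' ⟶ B'), IsPullback f' p' p f
  one : C
  toOne (X : C) : X ⟶ one
  toOne_uniq {X : C} (f g : X ⟶ one) : f = g
  toOne_mem (X : C) : Fib (toOne X)
  path (X : C) : PathObject Fib (toOne X)
  exists_path {E B : C} {p : E ⟶ B} : Fib p → Nonempty (PathObject Fib p)

namespace PathCategory

variable (K : PathCategory C)

section General

variable {K} {E B : C} {p : E ⟶ B} (hp : K.Fib p) (L : PathObject K.Fib p)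

include hp in
-- Path induction: the map from the path object to `E ×_B E` is a fibration, so a path given on `A`
-- extends to `X` with prescribed endpoints.
theorem fill {A X : C} {i : A ⟶ X} (hi : K.Fib.llp i) {a b : X ⟶ E} (hab : a ≫ p = b ≫ p)
    {u : A ⟶ L.obj} (hs : u ≫ L.s = i ≫ a) (ht : u ≫ L.t = i ≫ b) :
    ∃ v : X ⟶ L.obj, i ≫ v = u ∧ v ≫ L.s = a ∧ v ≫ L.t = b := by
  obtain ⟨D, d₁, d₂, hD⟩ := K.exists_pullback hp p
  set m := hD.lift L.s L.t L.w
  have hm : K.Fib m := L.fib hD (hD.lift_fst _ _ _) (hD.lift_snd _ _ _)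
  have sq : CommSq u i m (hD.lift a b hab) := ⟨hD.hom_ext (by simp [m, hs]) (by simp [m, ht])⟩
  have := hi m hm
  refine ⟨sq.lift, sq.fac_left, ?_, ?_⟩
  · rw [← hD.lift_fst L.s L.t L.w, sq.fac_right_assoc, hD.lift_fst]
  · rw [← hD.lift_snd L.s L.t L.w, sq.fac_right_assoc, hD.lift_snd]

theorem elim {Q R : C} {q : Q ⟶ L.obj} (hq : K.Fib q) {e : R ⟶ E} {j : R ⟶ Q}
    (h : IsPullback e j L.r q) : K.Fib.llp j := by
  have h1 : IsPullback (𝟙 L.obj) (L.s ≫ p) (L.s ≫ p) (𝟙 B) := IsPullback.id_horiz _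
  exact L.elim h1 hq (by simpa using h)

theorem llp_r : K.Fib.llp L.r := elim L (K.id_mem _) (IsPullback.id_horiz _)

include hp

theorem fib_s : K.Fib L.s := by
  obtain ⟨D, d₁, d₂, hD⟩ := K.exists_pullback hp p
  rw [← hD.lift_fst L.s L.t L.w]
  exact K.comp_mem (L.fib hD (hD.lift_fst _ _ _) (hD.lift_snd _ _ _)) (K.baseChange hD.flip hp)

theorem fib_t : K.Fib L.t := by
  obtain ⟨D, d₁, d₂, hD⟩ := K.exists_pullback hp p
  rw [← hD.lift_snd L.s L.t L.w]
  exact K.comp_mem (L.fib hD (hD.lift_fst _ _ _) (hD.lift_snd _ _ _)) (K.baseChange hD hp)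

theorem exists_inv : ∃ v : L.obj ⟶ L.obj, L.r ≫ v = L.r ∧ v ≫ L.s = L.t ∧ v ≫ L.t = L.s :=
  fill hp L (llp_r L) L.w.symm (by simp) (by simp)

omit hp in
/-- Elimination over paths which start at the image of a fibration. -/
theorem llp_base {X T : C} {g : X ⟶ E} (hg : K.Fib g) {a : T ⟶ X} {b : T ⟶ L.obj}
    (h : IsPullback a b g L.s) {j : X ⟶ T} (ha : j ≫ a = 𝟙 X) (hb : j ≫ b = g ≫ L.r) :
    K.Fib.llp j := by
  have h1 : IsPullback (j ≫ a) g g (L.r ≫ L.s) := by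
    rw [ha, L.r_s]; exact IsPullback.id_horiz _
  exact elim L (K.baseChange h hg) (IsPullback.of_right h1 hb h).flip

end General

/-- A composition operation for paths. -/
structure Composition {E B : C} {p : E ⟶ B} (L : PathObject K.Fib p) where
  obj : C
  fst : obj ⟶ L.obj
  snd : obj ⟶ L.obj
  isPullback : IsPullback fst snd L.t L.s
  op : obj ⟶ L.obj
  op_s : op ≫ L.s = fst ≫ L.s
  op_t : op ≫ L.t = snd ≫ L.t
  op_unit : isPullback.lift (𝟙 _) (L.t ≫ L.r) (by simp) ≫ op = 𝟙 _

/-- Pairs of a path and a constant path at its end embed in all composable pairs by a map with the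
lifting property, so the composite may be prescribed on them to be the first path. This gives a
strict right unit; the left unit law will hold only up to homotopy. -/
theorem exists_composition {E B : C} {p : E ⟶ B} (hp : K.Fib p) (L : PathObject K.Fib p) :
    Nonempty (K.Composition L) := by
  obtain ⟨T, a, b, h⟩ := K.exists_pullback (fib_t hp L) L.s
  have hj := llp_base L (fib_t hp L) h (j := h.lift (𝟙 _) (L.t ≫ L.r) (by simp))
    (h.lift_fst _ _ _) (h.lift_snd _ _ _)
  obtain ⟨v, h1, h2, h3⟩ := fill hp L hj (a := a ≫ L.s) (b := b ≫ L.t) (u := 𝟙 _)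
    (by rw [Category.assoc, L.w, ← Category.assoc, h.w, Category.assoc, L.w, Category.assoc])
    (by simp) (by simp)
  exact ⟨⟨T, a, b, h, v, h2, h3, h1⟩⟩

noncomputable section

/-- The chosen path object of `X`. -/
abbrev P (X : C) : C := (K.path X).obj
abbrev r (X : C) : X ⟶ K.P X := (K.path X).r
abbrev s (X : C) : K.P X ⟶ X := (K.path X).s
abbrev t (X : C) : K.P X ⟶ X := (K.path X).t

theorem exists_square (X : C) : ∃ (D : C) (a b : D ⟶ X),
    IsPullback a b (K.toOne X) (K.toOne X) := K.exists_pullback (K.toOne_mem X) _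

/-- The product of `X` with itself. -/
def square (X : C) : C := (K.exists_square X).choose
def fst (X : C) : K.square X ⟶ X := (K.exists_square X).choose_spec.choose
def snd (X : C) : K.square X ⟶ X := (K.exists_square X).choose_spec.choose_spec.choose

theorem isPullback_square (X : C) :
    IsPullback (K.fst X) (K.snd X) (K.toOne X) (K.toOne X) :=
  (K.exists_square X).choose_spec.choose_spec.choose_spec

/-- The endpoints of a path. -/
def ends (X : C) : K.P X ⟶ K.square X :=
  (K.isPullback_square X).lift (K.s X) (K.t X) (K.toOne_uniq _ _)

@[simp]
theorem ends_fst (X : C) : K.ends X ≫ K.fst X = K.s X := IsPullback.lift_fst _ _ _ _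

@[simp]
theorem ends_snd (X : C) : K.ends X ≫ K.snd X = K.t X := IsPullback.lift_snd _ _ _ _

theorem ends_mem (X : C) : K.Fib (K.ends X) :=
  (K.path X).fib (K.isPullback_square X) (K.ends_fst X) (K.ends_snd X)

/-- The object of homotopies between paths with the same endpoints. -/
def path₂ (X : C) : PathObject K.Fib (K.ends X) := (K.exists_path (K.ends_mem X)).some

variable {K}

theorem comp_ends_eq {X Y : C} {u v : Y ⟶ K.P X} :
    u ≫ K.ends X = v ≫ K.ends X ↔ u ≫ K.s X = v ≫ K.s X ∧ u ≫ K.t X = v ≫ K.t X := by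
  constructor
  · intro h
    constructor
    · rw [← ends_fst, ← Category.assoc, h, Category.assoc]
    · rw [← ends_snd, ← Category.assoc, h, Category.assoc]
  · rintro ⟨h1, h2⟩
    exact (K.isPullback_square X).hom_ext (by simpa using h1) (by simpa using h2)

/-- Homotopy of (generalised) paths with the same endpoints. -/
def Htp {X Y : C} (u v : Y ⟶ K.P X) : Prop :=
  ∃ k : Y ⟶ (K.path₂ X).obj, k ≫ (K.path₂ X).s = u ∧ k ≫ (K.path₂ X).t = v

namespace Htp

variable {X Y Z : C} {u v x : Y ⟶ K.P X}

theorem parallel (h : Htp u v) : u ≫ K.s X = v ≫ K.s X ∧ u ≫ K.t X = v ≫ K.t X := by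
  obtain ⟨k, rfl, rfl⟩ := h
  rw [← comp_ends_eq, Category.assoc, Category.assoc, (K.path₂ X).w]

theorem refl (u : Y ⟶ K.P X) : Htp u u := ⟨u ≫ (K.path₂ X).r, by simp, by simp⟩

theorem of_eq (h : u = v) : Htp u v := h ▸ refl u

theorem symm (h : Htp u v) : Htp v u := by
  obtain ⟨k, rfl, rfl⟩ := h
  obtain ⟨i, -, h1, h2⟩ := exists_inv (K.ends_mem X) (K.path₂ X)
  exact ⟨k ≫ i, by simp [h1], by simp [h2]⟩

theorem trans (h : Htp u v) (h' : Htp v x) : Htp u x := by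
  obtain ⟨k, rfl, h1⟩ := h
  obtain ⟨k', h2, rfl⟩ := h'
  obtain ⟨c⟩ := K.exists_composition (K.ends_mem X) (K.path₂ X)
  refine ⟨c.isPullback.lift k k' (h1.trans h2.symm) ≫ c.op, ?_, ?_⟩
  · simp [c.op_s]
  · simp [c.op_t]

theorem precomp (h : Htp u v) (f : Z ⟶ Y) : Htp (f ≫ u) (f ≫ v) := by
  obtain ⟨k, rfl, rfl⟩ := h
  exact ⟨f ≫ k, by simp, by simp⟩

/-- A homotopy is a path in the path object over the square of `X`, so `fill` applies to it. This is
the induction principle behind all the laws below. -/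
theorem extend {i : Z ⟶ Y} (hi : K.Fib.llp i) (hs : u ≫ K.s X = v ≫ K.s X)
    (ht : u ≫ K.t X = v ≫ K.t X) (h : Htp (i ≫ u) (i ≫ v)) : Htp u v := by
  obtain ⟨k, h1, h2⟩ := h
  obtain ⟨k', -, h3, h4⟩ := fill (K.ends_mem X) (K.path₂ X) hi (comp_ends_eq.2 ⟨hs, ht⟩) h1 h2
  exact ⟨k', h3, h4⟩

end Htp

/-! ### Operations on paths -/

variable (K) in
def composition (X : C) : K.Composition (K.path X) :=
  (K.exists_composition (K.toOne_mem X) _).some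

/-- The composite of two generalised paths. -/
def comp {X Y : C} (u v : Y ⟶ K.P X) (h : u ≫ K.t X = v ≫ K.s X) : Y ⟶ K.P X :=
  (K.composition X).isPullback.lift u v h ≫ (K.composition X).op

section Comp

variable {X Y Z : C} {u v x : Y ⟶ K.P X}

theorem comp_s (h : u ≫ K.t X = v ≫ K.s X) : comp u v h ≫ K.s X = u ≫ K.s X := by
  simp [comp, (K.composition X).op_s]

theorem comp_s_assoc (h : u ≫ K.t X = v ≫ K.s X) {W : C} (k : X ⟶ W) :
    comp u v h ≫ K.s X ≫ k = u ≫ K.s X ≫ k := by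
  simp only [← Category.assoc, comp_s]

theorem comp_t (h : u ≫ K.t X = v ≫ K.s X) : comp u v h ≫ K.t X = v ≫ K.t X := by
  simp [comp, (K.composition X).op_t]

theorem comp_t_assoc (h : u ≫ K.t X = v ≫ K.s X) {W : C} (k : X ⟶ W) :
    comp u v h ≫ K.t X ≫ k = v ≫ K.t X ≫ k := by
  simp only [← Category.assoc, comp_t]

theorem precomp_comp (f : Z ⟶ Y) (h : u ≫ K.t X = v ≫ K.s X) :
    f ≫ comp u v h = comp (f ≫ u) (f ≫ v) (by simp [h]) := by
  simp only [comp, ← Category.assoc]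
  congr 1
  exact (K.composition X).isPullback.hom_ext (by simp) (by simp)

/-- The strict right unit law. Proofs about composites arrange for the last path to be the one which
is made constant. -/
theorem comp_eq_left (h : u ≫ K.t X = v ≫ K.s X) (hv : v = u ≫ K.t X ≫ K.r X) :
    comp u v h = u := by
  subst hv
  conv_rhs => rw [← Category.comp_id u, ← (K.composition X).op_unit, ← Category.assoc]
  rw [comp]
  congr 1
  exact (K.composition X).isPullback.hom_ext (by simp) (by simp)

theorem comp_congr {u' v' : Y ⟶ K.P X} (h : u ≫ K.t X = v ≫ K.s X) (hu : u = u') (hv : v = v') :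
    comp u v h = comp u' v' (hu ▸ hv ▸ h) := by
  subst hu hv; rfl

end Comp

theorem exists_map {X Y : C} (f : X ⟶ Y) : ∃ g : K.P X ⟶ K.P Y,
    K.r X ≫ g = f ≫ K.r Y ∧ g ≫ K.s Y = K.s X ≫ f ∧ g ≫ K.t Y = K.t X ≫ f :=
  fill (K.toOne_mem Y) (K.path Y) (llp_r (K.path X)) (K.toOne_uniq _ _) (by simp) (by simp)

variable (K) in
/-- The action of a map on paths. -/
def map {X Y : C} (f : X ⟶ Y) : K.P X ⟶ K.P Y := (exists_map f).choose

variable (K) in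
@[simp]
theorem r_map {X Y : C} (f : X ⟶ Y) : K.r X ≫ K.map f = f ≫ K.r Y :=
  (exists_map f).choose_spec.1

variable (K) in
@[simp]
theorem r_map_assoc {X Y : C} (f : X ⟶ Y) {W : C} (k : K.P Y ⟶ W) :
    K.r X ≫ K.map f ≫ k = f ≫ K.r Y ≫ k := by
  simp only [← Category.assoc, r_map]

variable (K) in
@[simp]
theorem map_s {X Y : C} (f : X ⟶ Y) : K.map f ≫ K.s Y = K.s X ≫ f :=
  (exists_map f).choose_spec.2.1

variable (K) in
@[simp]
theorem map_s_assoc {X Y : C} (f : X ⟶ Y) {W : C} (k : Y ⟶ W) :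
    K.map f ≫ K.s Y ≫ k = K.s X ≫ f ≫ k := by
  simp only [← Category.assoc, map_s]

variable (K) in
@[simp]
theorem map_t {X Y : C} (f : X ⟶ Y) : K.map f ≫ K.t Y = K.t X ≫ f :=
  (exists_map f).choose_spec.2.2

variable (K) in
@[simp]
theorem map_t_assoc {X Y : C} (f : X ⟶ Y) {W : C} (k : Y ⟶ W) :
    K.map f ≫ K.t Y ≫ k = K.t X ≫ f ≫ k := by
  simp only [← Category.assoc, map_t]

variable (K) in
/-- The inversion of paths. -/
def inv (X : C) : K.P X ⟶ K.P X := (exists_inv (K.toOne_mem X) (K.path X)).choose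

variable (K) in
@[simp]
theorem r_inv (X : C) : K.r X ≫ K.inv X = K.r X :=
  (exists_inv (K.toOne_mem X) (K.path X)).choose_spec.1

variable (K) in
@[simp]
theorem inv_s (X : C) : K.inv X ≫ K.s X = K.t X :=
  (exists_inv (K.toOne_mem X) (K.path X)).choose_spec.2.1

variable (K) in
@[simp]
theorem inv_t (X : C) : K.inv X ≫ K.t X = K.s X :=
  (exists_inv (K.toOne_mem X) (K.path X)).choose_spec.2.2

/-- Maps out of a path object are homotopic if they are so on reflexivities. -/
theorem Htp.of_r {X Y : C} {u v : K.P X ⟶ K.P Y} (hs : u ≫ K.s Y = v ≫ K.s Y)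
    (ht : u ≫ K.t Y = v ≫ K.t Y) (h : Htp (K.r X ≫ u) (K.r X ≫ v)) : Htp u v :=
  .extend (llp_r (K.path X)) hs ht h

/-- A map which preserves the endpoints of homotopic paths preserves homotopy. -/
theorem Htp.postcomp {X Y Z : C} {u v : Z ⟶ K.P X} (h : Htp u v) (g : K.P X ⟶ K.P Y)
    (hg : ∀ {W : C} {x y : W ⟶ K.P X}, Htp x y →
      x ≫ g ≫ K.s Y = y ≫ g ≫ K.s Y ∧ x ≫ g ≫ K.t Y = y ≫ g ≫ K.t Y) :
    Htp (u ≫ g) (v ≫ g) := by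
  have h0 : Htp (K.path₂ X).s (K.path₂ X).t := ⟨𝟙 _, by simp, by simp⟩
  obtain ⟨k, rfl, rfl⟩ := h
  rw [Category.assoc, Category.assoc]
  refine Htp.precomp ?_ k
  refine .extend (llp_r (K.path₂ X)) ?_ ?_ (.of_eq (by simp))
  · simpa using (hg h0).1
  · simpa using (hg h0).2

theorem Htp.map {X Y Z : C} {u v : Z ⟶ K.P X} (h : Htp u v) (f : X ⟶ Y) :
    Htp (u ≫ K.map f) (v ≫ K.map f) :=
  h.postcomp _ fun h => by
    simp [reassoc_of% h.parallel.1, reassoc_of% h.parallel.2]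

theorem Htp.inv {X Z : C} {u v : Z ⟶ K.P X} (h : Htp u v) : Htp (u ≫ K.inv X) (v ≫ K.inv X) :=
  h.postcomp _ fun h => by simp [h.parallel.1, h.parallel.2]

section Laws

variable {X Y Z : C} {u v x : Y ⟶ K.P X}

/-- In the universal case, a homotopy together with a path starting at its common target, the path
may be taken constant. Then both composites reduce strictly to the paths joined by the given
homotopy. -/
theorem comp_congr_left {u' : Y ⟶ K.P X} (h : u ≫ K.t X = v ≫ K.s X) (hu : Htp u u') :
    Htp (comp u v h) (comp u' v (hu.parallel.2.symm.trans h)) := by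
  obtain ⟨k, rfl, rfl⟩ := hu
  have hf : K.Fib ((K.path₂ X).s ≫ K.t X) :=
    K.comp_mem (fib_s (K.ends_mem X) _) (fib_t (K.toOne_mem X) _)
  have hw : (K.path₂ X).s ≫ K.t X = (K.path₂ X).t ≫ K.t X :=
    (comp_ends_eq.1 (K.path₂ X).w).2
  have hw' : (K.path₂ X).s ≫ K.s X = (K.path₂ X).t ≫ K.s X :=
    (comp_ends_eq.1 (K.path₂ X).w).1
  obtain ⟨T, a, b, hT⟩ := K.exists_pullback hf (K.s X)
  have key : Htp (comp (a ≫ (K.path₂ X).s) b (by simpa using hT.w))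
      (comp (a ≫ (K.path₂ X).t) b (by simpa [hw] using hT.w)) := by
    refine .extend (llp_base (K.path X) hf hT (j := hT.lift (𝟙 _) _ (by simp)) (by simp)
      (hT.lift_snd _ _ _)) ?_ ?_ ?_
    · simp [comp_s, hw']
    · simp [comp_t]
    · rw [precomp_comp, precomp_comp, comp_eq_left, comp_eq_left]
      · exact ⟨𝟙 _, by simp, by simp⟩
      · simp [hw]
      · simp
  have := key.precomp (hT.lift k v (by simpa using h))
  rw [precomp_comp, precomp_comp] at this
  convert this using 2 <;> simp

/-- Here the induction is on the homotopy, with the first path as parameter: over the constant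
homotopy the two composites coincide. The parameter forms a fibration over the object of homotopies,
which is why lifting is needed for pullbacks of reflexivity too. -/
theorem comp_congr_right {v' : Y ⟶ K.P X} (h : u ≫ K.t X = v ≫ K.s X) (hv : Htp v v') :
    Htp (comp u v h) (comp u v' (h.trans hv.parallel.1)) := by
  obtain ⟨k, rfl, rfl⟩ := hv
  have hw : (K.path₂ X).s ≫ K.t X = (K.path₂ X).t ≫ K.t X :=
    (comp_ends_eq.1 (K.path₂ X).w).2
  have hw' : (K.path₂ X).s ≫ K.s X = (K.path₂ X).t ≫ K.s X :=
    (comp_ends_eq.1 (K.path₂ X).w).1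
  obtain ⟨T, a, b, hT⟩ := K.exists_pullback (fib_t (K.toOne_mem X) (K.path X))
    ((K.path₂ X).s ≫ K.s X)
  have hb := K.baseChange hT (fib_t (K.toOne_mem X) _)
  obtain ⟨R, j, e, hR⟩ := K.exists_pullback hb (K.path₂ X).r
  have key : Htp (comp a (b ≫ (K.path₂ X).s) (by simpa using hT.w))
      (comp a (b ≫ (K.path₂ X).t) (by simpa [hw'] using hT.w)) := by
    refine .extend (elim (K.path₂ X) hb hR.flip) ?_ ?_ (.of_eq ?_)
    · simp [comp_s]
    · simp [comp_t, hw]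
    · rw [precomp_comp, precomp_comp]
      exact comp_congr _ rfl (by simp [hR.w_assoc])
  have := key.precomp (hT.lift u k (by simpa using h))
  rw [precomp_comp, precomp_comp] at this
  convert this using 2 <;> simp

theorem Htp.comp {u' v' : Y ⟶ K.P X} (hu : Htp u u') (hv : Htp v v')
    (h : u ≫ K.t X = v ≫ K.s X) (h' : u' ≫ K.t X = v' ≫ K.s X) :
    Htp (comp u v h) (comp u' v' h') :=
  (comp_congr_left h hu).trans (comp_congr_right _ hv)

/-- When the path is itself constant, the strict right unit law applies; path induction does the
rest. -/
theorem one_comp (h : u ≫ K.t X = v ≫ K.s X) (hu : u = v ≫ K.s X ≫ K.r X) :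
    Htp (comp u v h) v := by
  subst hu
  have key : Htp (PathCategory.comp (K.s X ≫ K.r X) (𝟙 _) (by simp)) (𝟙 (K.P X)) := by
    refine .of_r (by simp [comp_s]) (by simp [comp_t]) (.of_eq ?_)
    rw [precomp_comp, comp_eq_left] <;> simp
  have := key.precomp v
  rw [precomp_comp] at this
  convert this using 2 <;> simp

theorem comp_inv (h : u ≫ K.t X = (u ≫ K.inv X) ≫ K.s X) :
    Htp (comp u (u ≫ K.inv X) h) (u ≫ K.s X ≫ K.r X) := by
  have key : Htp (PathCategory.comp (𝟙 (K.P X)) (K.inv X) (by simp)) (K.s X ≫ K.r X) := by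
    refine .of_r (by simp [comp_s]) (by simp [comp_t]) (.of_eq ?_)
    rw [precomp_comp, comp_eq_left] <;> simp
  have := key.precomp u
  rw [precomp_comp] at this
  convert this using 2; simp

theorem inv_comp (h : (u ≫ K.inv X) ≫ K.t X = u ≫ K.s X) :
    Htp (comp (u ≫ K.inv X) u h) (u ≫ K.t X ≫ K.r X) := by
  have key : Htp (PathCategory.comp (K.inv X) (𝟙 (K.P X)) (by simp)) (K.t X ≫ K.r X) := by
    refine .of_r (by simp [comp_s]) (by simp [comp_t]) (.of_eq ?_)
    rw [precomp_comp, comp_eq_left] <;> simp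
  have := key.precomp u
  rw [precomp_comp] at this
  convert this using 2; simp

/-- Induction on the last of three generic paths: when it is constant, both sides are strictly the
composite of the first two. -/
theorem comp_assoc (h : u ≫ K.t X = v ≫ K.s X) (h' : v ≫ K.t X = x ≫ K.s X) :
    Htp (comp (comp u v h) x ((comp_t h).trans h'))
      (comp u (comp v x h') (h.trans (comp_s h').symm)) := by
  set c := K.composition X
  have hf : K.Fib (c.snd ≫ K.t X) :=
    K.comp_mem (K.baseChange c.isPullback (fib_t (K.toOne_mem X) _)) (fib_t (K.toOne_mem X) _)
  obtain ⟨T, a, b, hT⟩ := K.exists_pullback hf (K.s X)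
  have w1 : (a ≫ c.fst) ≫ K.t X = (a ≫ c.snd) ≫ K.s X := by simp [c.isPullback.w]
  have w2 : (a ≫ c.snd) ≫ K.t X = b ≫ K.s X := by simpa using hT.w
  have key : Htp (PathCategory.comp (PathCategory.comp (a ≫ c.fst) (a ≫ c.snd) w1) b
      ((comp_t w1).trans w2)) (PathCategory.comp (a ≫ c.fst) (PathCategory.comp (a ≫ c.snd) b w2)
        (w1.trans (comp_s w2).symm)) := by
    refine .extend (llp_base (K.path X) hf hT (j := hT.lift (𝟙 _) _ (by simp)) (by simp)
      (hT.lift_snd _ _ _)) ?_ ?_ (.of_eq ?_)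
    · simp [comp_s]
    · simp [comp_t]
    · rw [precomp_comp, comp_eq_left, precomp_comp, precomp_comp]
      · refine comp_congr _ rfl ?_
        rw [precomp_comp, comp_eq_left]
        simp
      · simp [comp_t_assoc]
  have := key.precomp (hT.lift (c.isPullback.lift u v h) x (by simpa using h'))
  simp only [precomp_comp] at this
  convert this using 2
  · exact comp_congr _ (by simp) (by simp)
  · simp
  · simp
  · exact comp_congr _ (by simp) (by simp)

theorem map_comp_path (f : X ⟶ Z) (h : u ≫ K.t X = v ≫ K.s X) :
    Htp (comp u v h ≫ K.map f)
      (comp (u ≫ K.map f) (v ≫ K.map f) (by simp [reassoc_of% h])) := by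
  set c := K.composition X
  have hf := fib_t (K.toOne_mem X) (K.path X)
  have w : c.fst ≫ K.t X = c.snd ≫ K.s X := c.isPullback.w
  have key : Htp (PathCategory.comp c.fst c.snd w ≫ K.map f)
      (PathCategory.comp (c.fst ≫ K.map f) (c.snd ≫ K.map f) (by simp [reassoc_of% w])) := by
    refine .extend (llp_base (K.path X) hf c.isPullback
      (j := c.isPullback.lift (𝟙 _) _ (by simp)) (by simp) (c.isPullback.lift_snd _ _ _))
      ?_ ?_ (.of_eq ?_)
    · simp [comp_s, comp_s_assoc]
    · simp [comp_t, comp_t_assoc]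
    · rw [← Category.assoc, precomp_comp, precomp_comp, comp_eq_left _ (by simp)]
      exact ((comp_eq_left _ (by simp)).trans (by simp)).symm
  have := key.precomp (c.isPullback.lift u v h)
  rw [precomp_comp, ← Category.assoc, precomp_comp] at this
  convert this using 2
  · rw [comp_congr] <;> simp
  · simp
  · simp

variable (K) in
theorem map_id (X : C) : Htp (K.map (𝟙 X)) (𝟙 _) :=
  .of_r (by simp) (by simp) (.of_eq (by simp))

variable (K) in
theorem map_comp (f : X ⟶ Y) (g : Y ⟶ Z) : Htp (K.map (f ≫ g)) (K.map f ≫ K.map g) :=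
  .of_r (by simp) (by simp) (.of_eq (by simp))

/-- Naturality of homotopies. -/
theorem naturality (h : X ⟶ K.P Z) (u : Y ⟶ K.P X) :
    Htp (comp (u ≫ K.map (h ≫ K.s Z)) (u ≫ K.t X ≫ h) (by simp))
      (comp (u ≫ K.s X ≫ h) (u ≫ K.map (h ≫ K.t Z)) (by simp)) := by
  have key : Htp (PathCategory.comp (K.map (h ≫ K.s Z)) (K.t X ≫ h) (by simp))
      (PathCategory.comp (K.s X ≫ h) (K.map (h ≫ K.t Z)) (by simp)) := by
    refine .of_r (by simp [comp_s]) (by simp [comp_t]) ?_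
    rw [precomp_comp, precomp_comp]
    refine Htp.trans (v := h) ?_ (.of_eq ?_)
    · convert one_comp (v := h) (u := K.r X ≫ K.map (h ≫ K.s Z)) (by simp) (by simp) using 2
      simp
    · rw [comp_eq_left] <;> simp
  have := key.precomp u
  rwa [precomp_comp, precomp_comp] at this

end Laws

end

end PathCategory

end CategoryTheory

/-! ### Mapping path objects and their deformation retraction -/

namespace CategoryTheory.PathCategory

universe v w

variable {C : Type w} [Category.{v} C] {K : PathCategory C}

theorem exists_comp {X Y : C} {u v : Y ⟶ K.P X} (h : u ≫ K.t X = v ≫ K.s X) :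
    ∃ x : Y ⟶ K.P X, x ≫ K.s X = u ≫ K.s X ∧ x ≫ K.t X = v ≫ K.t X :=
  ⟨_, comp_s h, comp_t h⟩

section MappingPath

variable {X Y E : C} {f : X ⟶ Y} {h : E ⟶ K.P Y} {x : E ⟶ X}

/-- For the mapping path object `E` of `f`, the endpoint map `E ⟶ Y` is a fibration, and the square
of path objects over `X × Y` and `Y × Y` is a pullback. -/
theorem exists_isPullback_ends (hE : IsPullback h x (K.s Y) f) :
    ∃ (B : C) (f' : B ⟶ K.square Y) (π : B ⟶ X) (l : E ⟶ B), IsPullback f' π (K.fst Y) f ∧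
      IsPullback h l (K.ends Y) f' ∧ l ≫ π = x ∧ K.Fib (f' ≫ K.snd Y) := by
  have h1 : K.Fib (K.fst Y) := K.baseChange (K.isPullback_square Y).flip (K.toOne_mem Y)
  obtain ⟨B, f', π, hB⟩ := K.exists_pullback h1 f
  have hw : (h ≫ K.ends Y) ≫ K.fst Y = x ≫ f := by simpa using hE.w
  have hE' : IsPullback h (hB.lift (h ≫ K.ends Y) x hw ≫ π) (K.ends Y ≫ K.fst Y) f := by
    simpa using hE
  refine ⟨B, f', π, hB.lift (h ≫ K.ends Y) x hw, hB,
    IsPullback.of_bot hE' (by simp) hB, by simp, ?_⟩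
  have h2 := hB.flip.paste_vert (K.isPullback_square Y)
  exact K.baseChange (K.toOne_uniq (f ≫ K.toOne Y) (K.toOne X) ▸ h2) (K.toOne_mem X)

/-- The endpoint map factors as a pullback of the fibration `K.ends Y`, followed by a projection
which is a pullback of `X ⟶ 1`. -/
theorem fib_target (hE : IsPullback h x (K.s Y) f) : K.Fib (h ≫ K.t Y) := by
  obtain ⟨B, f', π, l, hB, hl, rfl, h2⟩ := exists_isPullback_ends hE
  rw [← ends_snd, ← Category.assoc, hl.w, Category.assoc]
  exact K.comp_mem (K.baseChange hl (K.ends_mem Y)) h2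

/-- Homotopic paths give connected points of a pullback of the path object. -/
theorem exists_path_of_htp {B : C} {f' : B ⟶ K.square Y} {l : E ⟶ B}
    (hl : IsPullback h l (K.ends Y) f') {Z : C} {a b : Z ⟶ E} (hx : a ≫ l = b ≫ l)
    (hab : Htp (a ≫ h) (b ≫ h)) : ∃ v : Z ⟶ K.P E, v ≫ K.s E = a ∧ v ≫ K.t E = b := by
  set L := K.path₂ Y
  obtain ⟨Q, g, q, hQ⟩ :=
    K.exists_pullback (K.comp_mem (fib_s (K.ends_mem Y) L) (K.ends_mem Y)) f'
  have hj : K.Fib.llp (hQ.lift (h ≫ L.r) l (by simp [hl.w])) := by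
    -- The object `Q` of homotopies over `E` is a base change along `f'`, which need not be a
    -- fibration. This is where stability of the lifting property under arbitrary change of base
    -- enters.
    refine L.elim hQ (K.id_mem _) (e := h) ?_
    rw [Category.id_comp]
    refine IsPullback.of_bot (v₂₁ := q) (v₂₂ := L.s ≫ K.ends Y) (h₃₁ := f') ?_ (by simp) hQ
    simpa using hl
  have w1 : (g ≫ L.s) ≫ K.ends Y = q ≫ f' := by rw [Category.assoc, hQ.w]
  have w2 : (g ≫ L.t) ≫ K.ends Y = q ≫ f' := by rw [Category.assoc, ← L.w, hQ.w]
  obtain ⟨v, -, hv1, hv2⟩ := fill (K.toOne_mem E) (K.path E) hj (u := K.r E)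
    (a := hl.lift _ _ w1) (b := hl.lift _ _ w2) (K.toOne_uniq _ _)
    (hl.hom_ext (by simp) (by simp)) (hl.hom_ext (by simp) (by simp))
  obtain ⟨k, hk1, hk2⟩ := hab
  have wk : k ≫ L.s ≫ K.ends Y = (a ≫ l) ≫ f' := by
    rw [reassoc_of% hk1, hl.w, Category.assoc]
  refine ⟨hQ.lift k (a ≫ l) wk ≫ v, ?_, ?_⟩
  · rw [Category.assoc, hv1]
    exact hl.hom_ext (by simp [hk1, L]) (by simp)
  · rw [Category.assoc, hv2]
    exact hl.hom_ext (by simp [hk2, L]) (by simpa using hx)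

/-- Connected points of a family of paths with constant endpoints are homotopic. -/
theorem htp_of_path (hh : K.s E ≫ h ≫ K.ends Y = K.t E ≫ h ≫ K.ends Y) {Z : C} (v : Z ⟶ K.P E) :
    Htp (v ≫ K.s E ≫ h) (v ≫ K.t E ≫ h) := by
  have h' := comp_ends_eq.1 (((Category.assoc _ _ _).trans hh).trans (Category.assoc _ _ _).symm)
  exact (Htp.of_r h'.1 h'.2 (.of_eq (by simp))).precomp v

/-- The mapping path object of `f` deformation retracts onto the domain of `f`. -/
theorem exists_retraction (hE : IsPullback h x (K.s Y) f) {i : X ⟶ E} (hx : i ≫ x = 𝟙 X)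
    (hh : i ≫ h = f ≫ K.r Y) : ∃ H : E ⟶ K.P E, H ≫ K.s E = x ≫ i ∧ H ≫ K.t E = 𝟙 E := by
  have hp := fib_target hE
  obtain ⟨T, a, b, hT⟩ := K.exists_pullback hp (K.s Y)
  have hw : (a ≫ h) ≫ K.t Y = b ≫ K.s Y := by simpa using hT.w
  -- A point of `T` is a point of `E` with a path `b` in `Y` leaving its target. Composing its own
  -- path with `b` gives another point of `E` over the same point of `X`.
  have hc : comp (a ≫ h) b hw ≫ K.s Y = (a ≫ x) ≫ f := by
    rw [comp_s, Category.assoc, hE.w, Category.assoc]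
  have hj := llp_base (K.path Y) hp hT (j := hT.lift (𝟙 _) ((h ≫ K.t Y) ≫ K.r Y) (by simp))
    (hT.lift_fst _ _ _) (hT.lift_snd _ _ _)
  -- Extension along `b` leaves the point strictly unchanged when `b` is constant, by the right unit
  -- law, so induction on `b` joins every point to its extension.
  obtain ⟨v, -, hv1, hv2⟩ := fill (K.toOne_mem E) (K.path E) hj (u := K.r E)
    (a := a) (b := hE.lift _ _ hc) (K.toOne_uniq _ _) (by simp) (by
      refine hE.hom_ext ?_ (by simp)
      rw [Category.assoc, Category.assoc, hE.lift_fst, precomp_comp, comp_eq_left] <;> simp)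
  have we : (x ≫ i) ≫ h ≫ K.t Y = h ≫ K.s Y := by
    rw [Category.assoc, reassoc_of% hh, hE.w]; simp
  -- Extend the retracted point, whose path is constant, along the path of the original point.
  set e := hT.lift (x ≫ i) h we
  -- The extension has path `1` followed by `h`, which is `h` only up to homotopy because left units
  -- are not strict.
  have h1 : Htp ((e ≫ hE.lift _ _ hc) ≫ h) (𝟙 E ≫ h) := by
    rw [Category.assoc, hE.lift_fst, precomp_comp, Category.id_comp]
    have he : e ≫ b = h := hT.lift_snd _ _ _
    refine (one_comp _ ?_).trans (.of_eq he)
    rw [he]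
    simp only [e, hT.lift_fst_assoc, Category.assoc, hh, hE.w_assoc]
  obtain ⟨B, f', π, l, hB, hl, rfl, -⟩ := exists_isPullback_ends hE
  have hll : (e ≫ hE.lift _ _ hc) ≫ l = 𝟙 E ≫ l := by
    refine hB.hom_ext ?_ (by simp [e, hx])
    simp only [Category.assoc, ← hl.w]
    simpa only [Category.assoc] using comp_ends_eq.2 h1.parallel
  -- The remaining homotopy of paths with fixed endpoints is a path in `E`; composing it with the
  -- path along the extension gives the retraction.
  obtain ⟨v', hv3, hv4⟩ := exists_path_of_htp hl hll h1
  obtain ⟨H, hH1, hH2⟩ := exists_comp (u := e ≫ v) (v := v') (by simp [hv2, hv3])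
  exact ⟨H, by simp [hH1, hv1, e], by simp [hH2, hv4]⟩

end MappingPath

end CategoryTheory.PathCategory

/-! ### Contexts as a category with path objects -/

theorem Expr.isBlock_reflSub {S : Signature.{u}} (Φ : List (Expr S)) :
    IsBlock (reflSub Φ) (3 * Φ.length) Φ.length := by
  refine ⟨fun i hi σ => ?_, fun i => ?_⟩
  · rw [reflSub_apply]
    split_ifs <;> simp only [Expr.subst] <;> rw [up_lt (by omega)]
  · rw [reflSub_apply, if_neg (by omega), if_neg (by omega)]
    exact congrArg var (by omega)

theorem Expr.reflSub_tsubst {S : Signature.{u}} (Φ : List (Expr S)) (σ : ℕ → Expr S) :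
    reflSub (tsubst σ Φ) = reflSub Φ := by
  funext i; simp [reflSub_apply]

namespace Cxt

open TypeTheory

variable {T : TypeTheory.{u}} {E B E' B' : Cxt T} {Ψ : List (Expr T.sig)}

theorem wf_tsubst (hE : E.toList = Ψ ++ B.toList) {σ : ℕ → Expr T.sig}
    (hσ : T.IsSub B'.toList σ B.toList) : T.Derives (tsubst σ Ψ ++ B'.toList) .ctx :=
  hσ.tsubst_ctx B'.wf (hE ▸ E.wf)

theorem isSub_up (hE : E.toList = Ψ ++ B.toList) {σ : ℕ → Expr T.sig}
    (hE' : E'.toList = tsubst σ Ψ ++ B'.toList) (hσ : T.IsSub B'.toList σ B.toList) :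
    T.IsSub E'.toList (up Ψ.length σ) E.toList := by
  rw [hE, hE']; exact hσ.up B'.wf (hE ▸ E.wf)

/-! ### Fibrations -/

variable (T) in
/-- The maps which are isomorphic to projections of dependent contexts. -/
def fibration : MorphismProperty (Cxt T) := fun E B p =>
  ∃ (Ψ : List (Expr T.sig)) (E' : Cxt T) (h : E'.toList = Ψ ++ B.toList) (e : E ≅ E'),
    p = e.hom ≫ proj h

theorem fibration_proj (hE : E.toList = Ψ ++ B.toList) : fibration T (proj hE) :=
  ⟨Ψ, E, hE, Iso.refl _, by simp⟩

theorem exists_isPullback_proj (hE : E.toList = Ψ ++ B.toList) (f : B' ⟶ B) :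
    ∃ (Ψ' : List (Expr T.sig)) (E' : Cxt T) (hE' : E'.toList = Ψ' ++ B'.toList) (f' : E' ⟶ E),
      IsPullback f' (proj hE') (proj hE) f := by
  obtain ⟨σ, hσ, rfl⟩ := exists_sub f
  exact ⟨tsubst σ Ψ, ⟨_, wf_tsubst hE hσ⟩, rfl, _, isPullback_up hE rfl hσ (isSub_up hE rfl hσ)⟩

theorem exists_isPullback {p : E ⟶ B} (hp : fibration T p) (f : B' ⟶ B) :
    ∃ (Ψ' : List (Expr T.sig)) (E' : Cxt T) (hE' : E'.toList = Ψ' ++ B'.toList) (f' : E' ⟶ E),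
      IsPullback f' (proj hE') p f := by
  obtain ⟨Ψ, E₀, hE, e, rfl⟩ := hp
  obtain ⟨Ψ', E', hE', f', h⟩ := exists_isPullback_proj hE f
  refine ⟨Ψ', E', hE', f' ≫ e.inv, ?_⟩
  have h' : IsPullback e.inv (proj hE) (e.hom ≫ proj hE) (𝟙 B) := .of_horiz_isIso ⟨by simp⟩
  simpa using h.paste_horiz h'

theorem fibration_baseChange {f' : E' ⟶ E} {p' : E' ⟶ B'} {p : E ⟶ B} {f : B' ⟶ B}
    (h : IsPullback f' p' p f) (hp : fibration T p) : fibration T p' := by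
  obtain ⟨Ψ', E₁, hE₁, f₁, h₁⟩ := exists_isPullback hp f
  exact ⟨Ψ', E₁, hE₁, h.isoIsPullback _ _ h₁, (h.isoIsPullback_hom_snd _ _ h₁).symm⟩

/-- Composition with an isomorphism is base change along its inverse. -/
theorem fibration_comp_iso {p : E ⟶ B} (hp : fibration T p) (e : B ≅ B') :
    fibration T (p ≫ e.hom) :=
  fibration_baseChange (f' := 𝟙 E) (p := p) (f := e.inv) (.of_horiz_isIso ⟨by simp⟩) hp

theorem fibration_comp {A : Cxt T} {p : E ⟶ B} {q : B ⟶ A} (hp : fibration T p)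
    (hq : fibration T q) : fibration T (p ≫ q) := by
  obtain ⟨Ω, B₀, hB, e, rfl⟩ := hq
  obtain ⟨Ψ, E₀, hE, e', h⟩ := fibration_comp_iso hp e
  rw [← Category.assoc, h]
  refine ⟨Ψ ++ Ω, E₀, by rw [hE, hB, List.append_assoc], e', ?_⟩
  rw [Category.assoc, proj, proj, sub_comp_sub]
  congr 1
  refine sub_eq_sub fun i hi => ?_
  rw [Expr.subst, List.length_append]
  exact congrArg _ (by omega)

/-- Pulling the fibration back along the lower map turns a lifting problem into one for a projection
`(X, Ω) ⟶ X`. A filler is then an element of `Ω` with prescribed values along `τ`, as an elimination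
rule provides. -/
theorem llp_of_elim {X A : Cxt T} {τ : ℕ → Expr T.sig} (hτ : T.IsSub A.toList τ X.toList)
    (H : ∀ {Ω ds : List (Expr T.sig)}, T.Derives (Ω ++ X.toList) .ctx →
      T.IsElem A.toList ds (tsubst τ Ω) → ∃ js, T.IsElem X.toList js Ω ∧
        T.EqElem A.toList (js.map (Expr.subst τ)) ds (tsubst τ Ω)) :
    (fibration T).llp (sub τ hτ) := by
  intro Y Z p hp
  refine ⟨fun {a b} sq => ?_⟩
  obtain ⟨Ω, Y', hY', b', h⟩ := exists_isPullback hp b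
  obtain ⟨ds, hds, e⟩ := exists_push hY' hτ (h.lift_snd a (sub τ hτ) sq.w)
  obtain ⟨js, hjs, hjd⟩ := H (hY' ▸ Y'.wf) hds
  have hv := IsSub.var X.wf
  have hjs' : T.IsElem X.toList js (tsubst .var Ω) := by rwa [tsubst_var]
  have hjs'' : T.IsElem A.toList (js.map (Expr.subst τ)) (tsubst τ Ω) := by
    refine isElem_tsubst_iff.2 ⟨by simpa using hjs.1, ?_⟩
    have := (isSub_append.1 ((isSub_push hY' hv hjs').comp hτ A.wf |> (hY' ▸ ·))).1
    simpa only [subst_push, Expr.subst] using this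
  have key : sub τ hτ ≫ sub (push js .var) (isSub_push hY' hv hjs') =
      h.lift a (sub τ hτ) sq.w := by
    rw [e, sub_comp_sub, ← (sub_push_eq_iff hY' hτ hjs'' hds).2 hjd]
    refine sub_eq_sub fun i hi => ?_
    rw [subst_push]
    rfl
  refine ⟨⟨⟨sub (push js .var) (isSub_push hY' hv hjs') ≫ b', ?_, ?_⟩⟩⟩
  · rw [← Category.assoc, key, h.lift_fst]
  · rw [Category.assoc, h.w, ← Category.assoc, sub_push_comp_proj hY' hv hjs', ← id_eq_sub,
      Category.id_comp]

/-! ### Path objects -/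

section PathObject

variable {P : Cxt T} {Φ : List (Expr T.sig)} (hE : E.toList = Φ ++ B.toList)
  (hP : P.toList = pathCxt Φ ++ B.toList)

include hE in
theorem elimSpec : ElimSpec T B.toList Φ := TypeTheory.elimSpec (hE ▸ E.wf)

/-- Reflexivity. -/
def reflMor : E ⟶ P := sub (reflSub Φ) (by rw [hE, hP]; exact (elimSpec hE).refl)

include hE in
theorem wf_second : T.Derives (trename (· + Φ.length) Φ ++ E.toList) .ctx := by
  rw [trename_eq_tsubst, hE]
  have := E.wf
  rw [hE] at this
  exact (IsSub.wk this).tsubst_ctx this this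

/-- The product of `(B, Φ)` with itself over `B`. -/
def double : Cxt T := ⟨_, wf_second hE⟩

/-- The first projection. -/
def doubleFst : double hE ⟶ E := proj (Ψ := trename (· + Φ.length) Φ) rfl

theorem isSub_doubleSnd : T.IsSub (double hE).toList (up Φ.length fun i => .var (i + Φ.length))
    E.toList :=
  isSub_up hE (by rw [← trename_eq_tsubst]; rfl) (hE ▸ IsSub.wk (hE ▸ E.wf))

/-- The second projection. -/
def doubleSnd : double hE ⟶ E := sub _ (isSub_doubleSnd hE)

theorem isPullback_double : IsPullback (doubleSnd hE) (doubleFst hE) (proj hE) (proj hE) := by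
  have h : (double hE).toList = tsubst (fun i => .var (i + Φ.length)) Φ ++ E.toList := by
    rw [← trename_eq_tsubst]; rfl
  have e : doubleFst hE = proj h := by
    simp only [doubleFst, proj]
    exact sub_eq_sub fun i hi => by simp
  rw [e]
  exact isPullback_up hE h (hE ▸ IsSub.wk (hE ▸ E.wf)) (isSub_doubleSnd hE)

include hP in
theorem toList_eq_double : P.toList = idVar Φ ++ (double hE).toList := by
  rw [hP, pathCxt, show (double hE).toList = trename (· + Φ.length) Φ ++ E.toList from rfl, hE]
  simp

/-- The endpoints of a path. -/
def endsMor : P ⟶ double hE := proj (toList_eq_double hE hP)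

theorem endsMor_fst : endsMor hE hP ≫ doubleFst hE ≫ proj hE = proj hP := by
  simp only [endsMor, doubleFst, proj, sub_comp_sub]
  refine sub_eq_sub fun i hi => ?_
  simp only [Expr.subst, length_trename, length_idVar, length_pathCxt]
  exact congrArg _ (by omega)

theorem reflMor_fst : reflMor hE hP ≫ endsMor hE hP ≫ doubleFst hE = 𝟙 E := by
  simp only [reflMor, endsMor, doubleFst, proj, sub_comp_sub, id_eq_sub]
  refine sub_eq_sub fun i hi => ?_
  simp only [Expr.subst, length_trename, length_idVar]
  rw [reflSub_apply, if_neg (by omega), if_neg (by omega)]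
  exact congrArg _ (by omega)

theorem reflMor_snd : reflMor hE hP ≫ endsMor hE hP ≫ doubleSnd hE = 𝟙 E := by
  rw [reflMor, endsMor, doubleSnd, proj, sub_comp_sub, sub_comp_sub, id_eq_sub]
  refine sub_eq_sub fun i hi => ?_
  by_cases h : i < Φ.length
  · rw [up_lt h]
    simp only [Expr.subst, length_idVar]
    rw [reflSub_apply, if_neg (by omega), if_pos (by omega), Nat.add_sub_cancel]
  · obtain ⟨j, rfl⟩ : ∃ j, i = j + Φ.length := ⟨i - Φ.length, by omega⟩
    rw [up_add]
    simp only [Expr.subst, length_idVar, Expr.wk, rename]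
    rw [reflSub_apply, if_neg (by omega), if_neg (by omega)]
    exact congrArg _ (by omega)

include hE hP in
-- The elimination and computation rules for identity contexts, read as a lifting property. The
-- parameter context `Θ` accounts for pullbacks of reflexivity along fibrations.
theorem llp_up_reflSub {Q R : Cxt T} {Θ : List (Expr T.sig)} (hQ : Q.toList = Θ ++ P.toList)
    (hR : R.toList = tsubst (reflSub Φ) Θ ++ E.toList)
    (h : T.IsSub R.toList (up Θ.length (reflSub Φ)) Q.toList) :
    (fibration T).llp (sub (up Θ.length (reflSub Φ)) h) := by
  refine llp_of_elim h fun {Ω ds} hΩ hds => ?_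
  have := jTerms_spec (Θ := Θ) (hE ▸ E.wf) (Ω := Ω) (ds := ds) (by rwa [hQ, hP] at hΩ)
    (by rwa [hR, hE] at hds)
  refine ⟨jTerms Φ Θ Ω ds, ?_, ?_⟩
  · rw [hQ, hP]; exact this.1
  · rw [hR, hE]; exact this.2

theorem fibration_of_ends {D : Cxt T} {a b : D ⟶ E} (h : IsPullback a b (proj hE) (proj hE))
    {m : P ⟶ D} (hs : m ≫ a = endsMor hE hP ≫ doubleFst hE)
    (ht : m ≫ b = endsMor hE hP ≫ doubleSnd hE) : fibration T m := by
  have h' := (isPullback_double hE).flip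
  have e : m = endsMor hE hP ≫ (h'.isoIsPullback _ _ h).hom :=
    h.hom_ext (by simp [hs]) (by simp [ht])
  rw [e]
  exact fibration_comp_iso (fibration_proj _) _

/-- Up to isomorphism all the pullbacks are given by substitution. As identity contexts and
reflexivity are strictly stable under it, the map in question becomes the reflexivity of a
substituted context with parameters. -/
theorem llp_of_isPullback {P' Q R : Cxt T} {f : B' ⟶ B} {g : P' ⟶ P} {p' : P' ⟶ B'}
    (h : IsPullback g p' (proj hP) f) {q : Q ⟶ P'} (hq : fibration T q) {e : R ⟶ E} {j : R ⟶ Q}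
    (h' : IsPullback e j (reflMor hE hP) (q ≫ g)) : (fibration T).llp j := by
  obtain ⟨σ, hσ, rfl⟩ := exists_sub f
  -- The syntactic base change along `σ`: `P₁` is at once the pullback of `P` and the identity
  -- context of `E₁`.
  let E₁ : Cxt T := ⟨_, wf_tsubst hE hσ⟩
  have hE₁ : E₁.toList = tsubst σ Φ ++ B'.toList := rfl
  let P₁ : Cxt T := ⟨_, wf_tsubst hP hσ⟩
  have hP₁ : P₁.toList = tsubst σ (pathCxt Φ) ++ B'.toList := rfl
  have hP₁' : P₁.toList = pathCxt (tsubst σ Φ) ++ B'.toList := by rw [hP₁, pathCxt_tsubst]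
  have hEs := isPullback_up hE hE₁ hσ (isSub_up hE hE₁ hσ)
  have hPs := isPullback_up hP hP₁ hσ (isSub_up hP hP₁ hσ)
  have hr : sub (up Φ.length σ) (isSub_up hE hE₁ hσ) ≫ reflMor hE hP =
      reflMor hE₁ hP₁' ≫ sub (up (pathCxt Φ).length σ) (isSub_up hP hP₁ hσ) := by
    simp only [reflMor, sub_comp_sub]
    refine sub_eq_sub fun i hi => ?_
    rw [reflSub_tsubst, length_pathCxt, (isBlock_reflSub Φ).comm]
  have hrp : reflMor hE hP ≫ proj hP = proj hE := by
    rw [← endsMor_fst hE hP, ← Category.assoc, ← Category.assoc, Category.assoc (reflMor _ _),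
      reflMor_fst, Category.id_comp]
  have hrp₁ : reflMor hE₁ hP₁' ≫ proj hP₁ = proj hE₁ := by
    have e : proj hP₁ = proj hP₁' := by
      simp only [proj]; exact sub_eq_sub fun i hi => by simp
    rw [e, ← endsMor_fst hE₁ hP₁', ← Category.assoc, ← Category.assoc,
      Category.assoc (reflMor _ _), reflMor_fst, Category.id_comp]
  have hrs : IsPullback (sub (up Φ.length σ) (isSub_up hE hE₁ hσ)) (reflMor hE₁ hP₁')
      (reflMor hE hP) (sub (up (pathCxt Φ).length σ) (isSub_up hP hP₁ hσ)) :=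
    IsPullback.of_bot (by rw [hrp, hrp₁]; exact hEs) hr hPs
  set φ := h.isoIsPullback _ _ hPs
  -- Up to isomorphism the fibration `q` is the projection of a context `(P₁, Θ)`, and `Θ` is the
  -- parameter context of the elimination.
  obtain ⟨Θ, Q₁, hQ₁, ε, hε⟩ := fibration_comp_iso hq φ
  have hr₁ : T.IsSub E₁.toList (reflSub (tsubst σ Φ)) P₁.toList := by
    rw [hE₁, hP₁']; exact (elimSpec hE₁).refl
  let R₁ : Cxt T := ⟨_, wf_tsubst hQ₁ hr₁⟩
  have hR₁ : R₁.toList = tsubst (reflSub (tsubst σ Φ)) Θ ++ E₁.toList := rfl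
  have hj := llp_up_reflSub hE₁ hP₁' hQ₁ hR₁ (isSub_up hQ₁ hR₁ hr₁)
  have hRs := isPullback_up hQ₁ hR₁ hr₁ (isSub_up hQ₁ hR₁ hr₁)
  have hRs' := hRs.flip.paste_horiz hrs
  have hqg : ε.hom ≫ proj hQ₁ ≫ sub (up (pathCxt Φ).length σ) (isSub_up hP hP₁ hσ) = q ≫ g := by
    rw [← Category.assoc, ← hε, Category.assoc]
    congr 1
    exact h.isoIsPullback_hom_fst _ _ hPs
  have h'' : IsPullback (e) (j ≫ ε.hom) (reflMor hE hP)
      (proj hQ₁ ≫ sub (up (pathCxt Φ).length σ) (isSub_up hP hP₁ hσ)) := by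
    have h3 : IsPullback (𝟙 _) (reflMor hE hP) (reflMor hE hP) (𝟙 _) := IsPullback.id_horiz _
    refine IsPullback.of_iso h' (Iso.refl _) (Iso.refl _) ε (Iso.refl _) (by simp) (by simp)
      (by simp) (by rw [Iso.refl_hom, Category.comp_id, hqg])
  have hjj : j = (h''.isoIsPullback _ _ hRs').hom ≫ sub _ (isSub_up hQ₁ hR₁ hr₁) ≫ ε.inv := by
    rw [← Category.assoc, h''.isoIsPullback_hom_snd]; simp
  rw [hjj]
  exact MorphismProperty.RespectsIso.precomp _ _ _
    (MorphismProperty.RespectsIso.postcomp _ _ _ hj)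

/-- Identity contexts are path objects. -/
def pathObject : PathObject (fibration T) (proj hE) where
  obj := P
  r := reflMor hE hP
  s := endsMor hE hP ≫ doubleFst hE
  t := endsMor hE hP ≫ doubleSnd hE
  r_s := reflMor_fst hE hP
  r_t := reflMor_snd hE hP
  w := by rw [Category.assoc, Category.assoc, (isPullback_double hE).w]
  fib h _ hs ht := fibration_of_ends hE hP h hs ht
  elim h _ hq _ _ h' := llp_of_isPullback hE hP (by rwa [Category.assoc, endsMor_fst] at h) hq h'

end PathObject

theorem exists_pathObject {p : E ⟶ B} (hp : fibration T p) :
    Nonempty (PathObject (fibration T) p) := by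
  obtain ⟨Φ, E₀, hE, e, rfl⟩ := hp
  let L := pathObject hE (show (Cxt.mk _ (elimSpec hE).ctx).toList = _ from rfl)
  refine ⟨⟨L.obj, e.hom ≫ L.r, L.s ≫ e.inv, L.t ≫ e.inv, by simp, by simp, by simp [L.w],
    fun {D a b} h {m} hs ht => ?_, fun {B' P' Q R f g p'} h {q} hq e' j h' => ?_⟩⟩
  · refine L.fib (a := a ≫ e.hom) (b := b ≫ e.hom) ?_ (by simp [reassoc_of% hs])
      (by simp [reassoc_of% ht])
    exact IsPullback.of_iso h (Iso.refl _) e e (Iso.refl _) (by simp) (by simp) (by simp) (by simp)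
  · refine L.elim (by simpa using h) hq (e := e' ≫ e.hom) ?_
    exact IsPullback.of_iso h' (Iso.refl _) e (Iso.refl _) (Iso.refl _) (by simp) (by simp)
      (by simp) (by simp)

theorem toList_eq_append_empty (X : Cxt T) : X.toList = X.toList ++ (empty T).toList :=
  (List.append_nil _).symm

/-- The identity context of `X`, as a context `(x ∈ X, y ∈ X, u ∈ Id(x, y))`. -/
def pathSpace (X : Cxt T) : Cxt T :=
  ⟨pathCxt X.toList, by
    have := (elimSpec (toList_eq_append_empty X)).ctx
    rwa [show (empty T).toList = [] from rfl, List.append_nil] at this⟩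

variable (T) in
/-- The category of contexts, with identity contexts as path objects. -/
def pathCategory : PathCategory (Cxt T) where
  Fib := fibration T
  id_mem X := ⟨[], X, rfl, Iso.refl _, by
    rw [Iso.refl_hom, Category.id_comp, proj, id_eq_sub]; exact sub_eq_sub fun i hi => rfl⟩
  comp_mem hp hq := fibration_comp hp hq
  baseChange h hp := fibration_baseChange h hp
  exists_pullback hp f := by
    obtain ⟨_, E', hE', f', h⟩ := exists_isPullback hp f
    exact ⟨E', f', _, h⟩
  one := empty T
  toOne X := proj (toList_eq_append_empty X)
  toOne_uniq f g := hom_ext_empty f g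
  toOne_mem X := fibration_proj _
  path X := pathObject (toList_eq_append_empty X)
    (toList_eq_append_empty (pathSpace X))
  exists_path hp := exists_pathObject hp

end Cxt

/-! ### Terms for paths compared with maps into path objects -/

namespace Expr

variable {S : Signature.{u}}

theorem push_congr {s : List (Expr S)} {i : ℕ} (h : i < s.length) (σ τ : ℕ → Expr S) :
    push s σ i = push s τ i := by rw [push_lt h, push_lt h]

theorem tsubst_idAt {Φ : List (Expr S)} (σ τ : ℕ → Expr S) (a b : List (Expr S)) :
    tsubst τ (idAt Φ σ a b) =
      idAt Φ (fun i => (σ i).subst τ) (a.map (subst τ)) (b.map (subst τ)) := by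
  rw [idAt, idAt, tsubst_tsubst]
  congr 1
  funext i
  rw [subst_push]
  congr 1
  funext j
  rw [subst_push]

@[simp] theorem length_idAt (Φ : List (Expr S)) (σ : ℕ → Expr S) (a b : List (Expr S)) :
    (idAt Φ σ a b).length = Φ.length := by simp [idAt]

theorem map_subst_vars (k m : ℕ) (σ : ℕ → Expr S) :
    (vars k m).map (subst σ) = take k fun i => σ (m + i) := by
  simp [vars, take, Function.comp_def, Expr.subst]

theorem take_push {k : ℕ} {s : List (Expr S)} (h : s.length = k) (σ : ℕ → Expr S) :
    take k (push s σ) = s := by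
  subst h
  refine List.ext_getElem (by simp) fun i h1 h2 => ?_
  simp [take, push_lt h2]

theorem map_wk_eq (s : List (Expr S)) (n : ℕ) :
    s.map (wk n) = s.map (subst fun i => var (i + n)) :=
  List.map_congr_left fun e _ => wk_eq_subst e n

end Expr

namespace Cxt

open TypeTheory CategoryTheory.PathCategory

variable {T : TypeTheory.{u}} {X Y Φ Ψ : Cxt T} {a b p a' b' p' : List (Expr T.sig)}

/-! ### Elements and paths in terms of context morphisms -/

theorem toList_path (Φ : Cxt T) : ((pathCategory T).P Φ).toList = pathCxt Φ.toList := rfl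

theorem tscoped_idVar (Φ : Cxt T) :
    TScoped (idVar Φ.toList ++ (trename (· + Φ.len) Φ.toList ++ Φ.toList)) := by
  have := (pathSpace Φ).wf.scoped.1
  simpa [pathSpace, pathCxt] using this

/-- Over the empty context the identity context mentions only the two endpoints, so the substitution
`σ` for further variables is immaterial. This disposes of the different index shifts in `compPath`,
`invPath` and `mapPath`. -/
theorem idAt_congr (Φ : Cxt T) (ha : a.length = Φ.len) (hb : b.length = Φ.len)
    (σ τ : ℕ → Expr T.sig) : idAt Φ.toList σ a b = idAt Φ.toList τ a b := by
  refine tsubst_congr (tscoped_idVar Φ) fun i hi => ?_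
  rw [← push_append, ← push_append]
  exact push_congr (by simpa [ha, hb] using hi) _ _

theorem _root_.TypeTheory.IsElem.map_subst (ha : T.IsElem X.toList a Φ.toList)
    {τ : ℕ → Expr T.sig} (hτ : T.IsSub Y.toList τ X.toList) :
    T.IsElem Y.toList (a.map (subst τ)) Φ.toList := by
  refine ⟨by simpa using ha.1, (IsSub.comp ha.2 hτ Y.wf).congr Φ.wf fun i hi => ?_⟩
  rw [subst_push]
  exact push_congr (by simpa [ha.1] using hi) _ _

theorem isElem_vars_of_isSub {m : ℕ} (h : T.IsSub X.toList (fun i => .var (m + i)) Φ.toList) :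
    T.IsElem X.toList (vars Φ.len m) Φ.toList :=
  ⟨by simp, h.congr Φ.wf fun i hi => by rw [push_vars, if_pos hi]⟩

theorem toList_eq_pathSpace (Φ : Cxt T) : ((pathCategory T).P Φ).toList =
    idVar Φ.toList ++ (double (toList_eq_append_empty Φ)).toList :=
  toList_eq_double (toList_eq_append_empty Φ) (toList_eq_append_empty (pathSpace Φ))

/-- The endpoints of a path. -/
def endsMap (Φ : Cxt T) : (pathCategory T).P Φ ⟶ double (toList_eq_append_empty Φ) :=
  proj (toList_eq_pathSpace Φ)

theorem s_eq (Φ : Cxt T) :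
    (pathCategory T).s Φ = endsMap Φ ≫ doubleFst (toList_eq_append_empty Φ) := rfl

theorem t_eq (Φ : Cxt T) :
    (pathCategory T).t Φ = endsMap Φ ≫ doubleSnd (toList_eq_append_empty Φ) := rfl

theorem isElem_second (ha : T.IsElem X.toList a Φ.toList) (hb : T.IsElem X.toList b Φ.toList) :
    T.IsElem X.toList b (tsubst (push a .var) (trename (· + Φ.len) Φ.toList)) := by
  rw [tsubst_trename]
  have e : (fun i => push a Expr.var (i + Φ.len)) = Expr.var := by
    funext i; rw [push_add' ha.1]
  rwa [e, tsubst_var]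

theorem isSub_ends (ha : T.IsElem X.toList a Φ.toList) (hb : T.IsElem X.toList b Φ.toList) :
    T.IsSub X.toList (push b (push a .var)) (double (toList_eq_append_empty Φ)).toList :=
  isSub_push (E := double (toList_eq_append_empty Φ)) (B := Φ) rfl ha.2 (isElem_second ha hb)

theorem wf_idAt (ha : T.IsElem X.toList a Φ.toList) (hb : T.IsElem X.toList b Φ.toList) :
    T.Derives (idAt Φ.toList .var a b ++ X.toList) .ctx :=
  wf_tsubst (toList_eq_pathSpace Φ) (isSub_ends ha hb)

theorem isSub_path (ha : T.IsElem X.toList a Φ.toList) (hb : T.IsElem X.toList b Φ.toList)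
    (hp : T.IsElem X.toList p (idAt Φ.toList .var a b)) :
    T.IsSub X.toList (push p (push b (push a .var))) ((pathCategory T).P Φ).toList :=
  isSub_push (toList_eq_pathSpace Φ) (isSub_ends ha hb) hp

/-- The map to the identity context of `Φ` given by two elements and a path between them. -/
def pathMor (ha : T.IsElem X.toList a Φ.toList) (hb : T.IsElem X.toList b Φ.toList)
    (hp : T.IsElem X.toList p (idAt Φ.toList .var a b)) : X ⟶ (pathCategory T).P Φ :=
  sub _ (isSub_path ha hb hp)

section

variable (ha : T.IsElem X.toList a Φ.toList) (hb : T.IsElem X.toList b Φ.toList)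
  (hp : T.IsElem X.toList p (idAt Φ.toList .var a b))

theorem pathMor_congr (ha' : T.IsElem X.toList a' Φ.toList) (hb' : T.IsElem X.toList b' Φ.toList)
    (hp' : T.IsElem X.toList p' (idAt Φ.toList .var a' b')) (h1 : a = a') (h2 : b = b')
    (h3 : p = p') : pathMor ha hb hp = pathMor ha' hb' hp' := by
  subst h1 h2 h3; rfl

theorem pathMor_ends : pathMor ha hb hp ≫ endsMap Φ = sub _ (isSub_ends ha hb) :=
  sub_push_comp_proj (toList_eq_pathSpace Φ) (isSub_ends ha hb) hp

theorem sub_ends_fst : sub _ (isSub_ends ha hb) ≫ doubleFst (toList_eq_append_empty Φ) =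
    sub _ ha.2 :=
  sub_push_comp_proj (E := double (toList_eq_append_empty Φ)) rfl ha.2
    (isElem_second ha hb)

theorem sub_ends_snd : sub _ (isSub_ends ha hb) ≫ doubleSnd (toList_eq_append_empty Φ) =
    sub _ hb.2 := by
  rw [doubleSnd, sub_comp_sub]
  refine sub_eq_sub fun i hi => ?_
  rw [up_subst_push hb.1]
  exact push_congr (by rw [hb.1]; exact hi) _ _

theorem pathMor_s : pathMor ha hb hp ≫ (pathCategory T).s Φ = sub _ ha.2 := by
  rw [s_eq, ← Category.assoc, pathMor_ends, sub_ends_fst ha hb]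

theorem pathMor_t : pathMor ha hb hp ≫ (pathCategory T).t Φ = sub _ hb.2 := by
  rw [t_eq, ← Category.assoc, pathMor_ends, sub_ends_snd ha hb]

/-- The endpoints determine the composite with the projection to the double context, by its pullback
property; what remains of `z` is a dependent element of the identity context. -/
theorem exists_pathMor {z : X ⟶ (pathCategory T).P Φ} (hs : z ≫ (pathCategory T).s Φ = sub _ ha.2)
    (ht : z ≫ (pathCategory T).t Φ = sub _ hb.2) :
    ∃ (p : List (Expr T.sig)) (hp : T.IsElem X.toList p (idAt Φ.toList .var a b)),
      z = pathMor ha hb hp := by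
  refine exists_push (toList_eq_pathSpace Φ) (isSub_ends ha hb) ?_
  refine (isPullback_double (toList_eq_append_empty Φ)).hom_ext ?_ ?_
  · rw [sub_ends_snd ha hb, ← ht, t_eq, ← Category.assoc]; rfl
  · rw [sub_ends_fst ha hb, ← hs, s_eq, ← Category.assoc]; rfl

/-- Classes of paths refer to chosen representatives of their endpoints. The same sequence of terms
serves for any definitionally equal endpoints. -/
theorem pathMor_conv (ha' : T.IsElem X.toList a' Φ.toList) (hb' : T.IsElem X.toList b' Φ.toList)
    (h1 : sub _ ha.2 = sub _ ha'.2) (h2 : sub _ hb.2 = sub _ hb'.2) :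
    ∃ hp' : T.IsElem X.toList p (idAt Φ.toList .var a' b'),
      pathMor ha' hb' hp' = pathMor ha hb hp := by
  have h : sub _ (isSub_ends ha hb) = sub _ (isSub_ends ha' hb') :=
    (isPullback_double (toList_eq_append_empty Φ)).hom_ext
      (by rw [sub_ends_snd ha hb, sub_ends_snd ha' hb', h2]) (by rw [sub_ends_fst ha hb, sub_ends_fst ha' hb', h1])
  have h' := sub_eq_sub_iff.1 h
  refine ⟨hp.conv h' (isSub_ends ha hb) X.wf (toList_eq_pathSpace Φ ▸ ((pathCategory T).P Φ).wf),
    (sub_eq_sub_iff.2 ?_).symm⟩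
  rw [toList_eq_pathSpace Φ]
  exact h'.push_left hp

include ha hb hp in
theorem isElem_map_subst_idAt {τ : ℕ → Expr T.sig} (hτ : T.IsSub Y.toList τ X.toList) :
    T.IsElem Y.toList (p.map (subst τ))
      (idAt Φ.toList .var (a.map (subst τ)) (b.map (subst τ))) := by
  rw [idAt_congr Φ (by simpa using ha.1) (by simpa using hb.1) _ fun i => (Expr.var i).subst τ,
    ← tsubst_idAt]
  have hl : p.length = (idAt Φ.toList .var a b).length := hp.1
  refine isElem_tsubst_iff.2 ⟨by simpa using hl, ?_⟩
  have h1 : T.IsSub X.toList (push p .var) (idAt Φ.toList .var a b ++ X.toList) :=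
    (IsSub.var X.wf).push (by rwa [tsubst_var])
  have h2 := (isSub_append.1 (h1.comp hτ Y.wf)).1
  simpa only [subst_push, Expr.subst] using h2

theorem sub_comp_pathMor {τ : ℕ → Expr T.sig} (hτ : T.IsSub Y.toList τ X.toList) :
    sub τ hτ ≫ pathMor ha hb hp = pathMor (ha.map_subst hτ) (hb.map_subst hτ)
      (isElem_map_subst_idAt ha hb hp hτ) := by
  refine (sub_comp_sub _ _).trans (sub_eq_sub fun i hi => ?_)
  simp only [← push_append]
  rw [subst_push]
  simp only [List.map_append]
  refine push_congr ?_ _ _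
  have h1 := hp.1
  have h2 := ha.1
  have h3 := hb.1
  have hi : i < (pathCxt Φ.toList).length := hi
  simp at h1 hi ⊢
  omega

end

/-- The path given by elimination. -/
theorem exists_elim {Q R : Cxt T} {Θ ds : List (Expr T.sig)} (hQ : Q.toList = Θ ++ ((pathCategory T).P Φ).toList)
    (hR : R.toList = tsubst (reflSub Φ.toList) Θ ++ Φ.toList)
    (hτ : T.IsSub R.toList (up Θ.length (reflSub Φ.toList)) Q.toList)
    (ha : T.IsElem Q.toList a Ψ.toList) (hb : T.IsElem Q.toList b Ψ.toList)
    (ha' : T.IsElem R.toList a' Ψ.toList) (hb' : T.IsElem R.toList b' Ψ.toList)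
    (hds : T.IsElem R.toList ds (idAt Ψ.toList .var a' b'))
    (haa : a.map (subst (up Θ.length (reflSub Φ.toList))) = a')
    (hbb : b.map (subst (up Θ.length (reflSub Φ.toList))) = b') (σ : ℕ → Expr T.sig) :
    ∃ h : T.IsElem Q.toList (jTerms Φ.toList Θ (idAt Ψ.toList σ a b) ds)
        (idAt Ψ.toList .var a b),
      sub _ hτ ≫ pathMor ha hb h = pathMor ha' hb' hds := by
  subst haa hbb
  rw [idAt_congr Ψ ha.1 hb.1 σ .var]
  have hΩ := wf_idAt ha hb
  have hds' : T.IsElem R.toList ds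
      (tsubst (up Θ.length (reflSub Φ.toList)) (idAt Ψ.toList .var a b)) := by
    rwa [tsubst_idAt, idAt_congr Ψ ha'.1 hb'.1 _ .var]
  have hQ' : Q.toList = Θ ++ (pathCxt Φ.toList ++ []) := by rw [List.append_nil]; exact hQ
  have hR' : R.toList = tsubst (reflSub Φ.toList) Θ ++ (Φ.toList ++ []) := by simpa using hR
  obtain ⟨h1, h2⟩ := jTerms_spec (Θ := Θ) (Φ := Φ.toList) (Γ := []) (by simpa using Φ.wf)
    (by rwa [← hQ']) (by rwa [← hR'])
  rw [← hQ'] at h1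
  rw [← hR'] at h2
  refine ⟨h1, ?_⟩
  rw [sub_comp_pathMor]
  rw [tsubst_idAt, idAt_congr Ψ ha'.1 hb'.1 _ .var] at h2
  exact (sub_push_eq_iff (toList_eq_pathSpace Ψ) (isSub_ends ha' hb')
    (isElem_map_subst_idAt ha hb h1 hτ) hds).2 h2

end Cxt

namespace Expr

variable {S : Signature.{u}}

theorem take_congr {k : ℕ} {σ τ : ℕ → Expr S} (h : ∀ i < k, σ i = τ i) : take k σ = take k τ :=
  List.map_congr_left fun i hi => h i (List.mem_range.1 hi)

theorem map_vars_eq {k m : ℕ} {σ : ℕ → Expr S} {s : List (Expr S)} (hs : s.length = k)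
    (h : ∀ i < k, σ (m + i) = push s var i) : (vars k m).map (subst σ) = s := by
  rw [map_subst_vars, take_congr h, take_push hs]

theorem map_vars_eq_vars {k m n : ℕ} {σ : ℕ → Expr S}
    (h : ∀ i < k, σ (m + i) = var (n + i)) : (vars k m).map (subst σ) = vars k n := by
  rw [map_subst_vars, take_congr h]; rfl

end Expr

namespace Cxt

open TypeTheory CategoryTheory.PathCategory

variable {T : TypeTheory.{u}} {X Y Φ Ψ : Cxt T} {a b c p q : List (Expr T.sig)}

theorem map_subst_closed (ha : T.IsElem (empty T).toList a Φ.toList) (σ τ : ℕ → Expr T.sig) :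
    a.map (subst σ) = a.map (subst τ) :=
  map_subst_congr ha.scoped fun i hi => absurd hi (Nat.not_lt_zero i)

theorem map_subst_eq_self (ha : T.IsElem (empty T).toList a Φ.toList) (σ : ℕ → Expr T.sig) :
    a.map (subst σ) = a := by
  rw [map_subst_closed ha σ .var]
  exact (List.map_congr_left fun e _ => subst_var e).trans (List.map_id a)

theorem isElem_of_closed (ha : T.IsElem (empty T).toList a Φ.toList) :
    T.IsElem X.toList a Φ.toList := by
  have := ha.map_subst (Y := X) (τ := .var) (isSub_nil _ _)
  rwa [map_subst_eq_self ha] at this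

theorem isElem_of_isSub_path (hp : p.length = Φ.len)
    (h : T.IsSub X.toList (push p (push b (push a .var))) ((pathCategory T).P Φ).toList) :
    T.IsElem X.toList p (idAt Φ.toList .var a b) := by
  rw [toList_eq_pathSpace] at h
  exact isElem_tsubst_iff.2 ⟨by simpa using hp, (isSub_append.1 h).1⟩

theorem isElem_vars_zero (Φ : Cxt T) : T.IsElem Φ.toList (vars Φ.len 0) Φ.toList :=
  isElem_vars Φ.wf

theorem isSub_source (Φ : Cxt T) :
    T.IsSub ((pathCategory T).P Φ).toList (fun i => .var (2 * Φ.len + i)) Φ.toList := by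
  have h : ((pathCategory T).P Φ).toList = (idVar Φ.toList ++ trename (· + Φ.len) Φ.toList) ++ Φ.toList := by
    simp [toList_path, pathCxt]
  rw [h]
  refine (IsSub.wk (h ▸ ((pathCategory T).P Φ).wf)).congr Φ.wf fun i hi => ?_
  simp only [List.length_append, length_idVar, length_trename]
  exact congrArg _ (by simp only [len] at *; omega)

theorem isSub_target (Φ : Cxt T) :
    T.IsSub ((pathCategory T).P Φ).toList (fun i => .var (Φ.len + i)) Φ.toList := by
  have h := (elimSpec (toList_eq_append_empty Φ)).isSub_second
  rw [← toList_eq_append_empty] at h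
  rw [toList_eq_append_empty ((pathCategory T).P Φ)]
  refine IsSub.congr h Φ.wf fun i hi => ?_
  rw [if_pos hi]
  exact congrArg _ (by simp only [len] at *; omega)

theorem isElem_source (Φ : Cxt T) :
    T.IsElem ((pathCategory T).P Φ).toList (vars Φ.len (2 * Φ.len)) Φ.toList :=
  isElem_vars_of_isSub (isSub_source Φ)

theorem isElem_target (Φ : Cxt T) :
    T.IsElem ((pathCategory T).P Φ).toList (vars Φ.len Φ.len) Φ.toList :=
  isElem_vars_of_isSub (isSub_target Φ)

theorem isSub_proj {E B : Cxt T} {Ω : List (Expr T.sig)} (hE : E.toList = Ω ++ B.toList) :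
    T.IsSub E.toList (fun i => .var (i + Ω.length)) B.toList := by
  rw [hE]; exact IsSub.wk (hE ▸ E.wf)

theorem sub_source (Φ : Cxt T) : sub _ (isElem_source Φ).2 = (pathCategory T).s Φ := by
  refine Eq.trans ?_ (sub_comp_sub (isSub_proj (toList_eq_pathSpace Φ))
    (isSub_proj (E := double (toList_eq_append_empty Φ)) rfl)).symm
  refine sub_eq_sub fun i hi => ?_
  rw [push_vars, if_pos hi, Expr.subst]
  simp only [length_trename, length_idVar]
  exact congrArg _ (by simp only [len] at *; omega)

theorem sub_target (Φ : Cxt T) : sub _ (isElem_target Φ).2 = (pathCategory T).t Φ := by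
  refine Eq.trans ?_ (sub_comp_sub (isSub_proj (toList_eq_pathSpace Φ))
    (isSub_doubleSnd (toList_eq_append_empty Φ))).symm
  refine sub_eq_sub fun i hi => ?_
  rw [push_vars, if_pos hi, up_lt hi, Expr.subst]
  simp only [length_idVar]
  exact congrArg _ (by simp only [len] at *; omega)

theorem sub_isSub_source (Φ : Cxt T) : sub _ (isSub_source Φ) = (pathCategory T).s Φ := by
  rw [← sub_source]
  exact sub_eq_sub fun i hi => by rw [push_vars, if_pos hi]

theorem sub_isSub_target (Φ : Cxt T) : sub _ (isSub_target Φ) = (pathCategory T).t Φ := by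
  rw [← sub_target]
  exact sub_eq_sub fun i hi => by rw [push_vars, if_pos hi]

theorem isSub_reflSub (Φ : Cxt T) :
    T.IsSub Φ.toList (reflSub Φ.toList) ((pathCategory T).P Φ).toList := by
  have := (elimSpec (toList_eq_append_empty Φ)).refl
  rw [← toList_eq_append_empty] at this
  rwa [toList_eq_append_empty ((pathCategory T).P Φ)]

theorem isElem_rTerms (Φ : Cxt T) : T.IsElem Φ.toList (rTerms Φ.toList)
    (idAt Φ.toList .var (vars Φ.len 0) (vars Φ.len 0)) := by
  refine isElem_of_isSub_path (by simp) ((isSub_reflSub Φ).congr ((pathCategory T).P Φ).wf fun i hi => ?_)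
  have hi : i < (pathCxt Φ.toList).length := hi
  rw [length_pathCxt] at hi
  rw [push_rTerms, reflSub_apply, push_vars, push_vars]
  simp only [len] at *
  split_ifs <;> first | rfl | omega | exact congrArg _ (by omega)

theorem r_eq (Φ : Cxt T) : (pathCategory T).r Φ = sub _ (isSub_reflSub Φ) := rfl

theorem pathMor_rTerms (Φ : Cxt T) : pathMor (isElem_vars_zero Φ) (isElem_vars_zero Φ)
    (isElem_rTerms Φ) = (pathCategory T).r Φ := by
  rw [r_eq]
  refine sub_eq_sub fun i hi => ?_
  have hi : i < (pathCxt Φ.toList).length := hi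
  rw [length_pathCxt] at hi
  rw [push_rTerms, reflSub_apply, push_vars, push_vars]
  simp only [len] at *
  split_ifs <;> first | rfl | omega | exact congrArg _ (by omega)

theorem map_source {σ : ℕ → Expr T.sig} (ha : a.length = Φ.len) (hb : b.length = Φ.len)
    (hp : p.length = Φ.len) :
    (vars Φ.len (2 * Φ.len)).map (subst (push p (push b (push a σ)))) = a := by
  refine map_vars_eq ha fun i hi => ?_
  rw [show 2 * Φ.len + i = i + Φ.len + Φ.len by omega, push_add' hp, push_add' hb]
  exact push_congr (by simp only [len] at *; omega) _ _

theorem map_target {σ : ℕ → Expr T.sig} (hb : b.length = Φ.len) (hp : p.length = Φ.len) :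
    (vars Φ.len Φ.len).map (subst (push p (push b σ))) = b := by
  refine map_vars_eq hb fun i hi => ?_
  rw [show Φ.len + i = i + Φ.len by omega, push_add' hp]
  exact push_congr (by simp only [len] at *; omega) _ _

theorem exists_pathMor_subst {a' b' p' : List (Expr T.sig)} (ha' : T.IsElem Y.toList a' Φ.toList)
    (hb' : T.IsElem Y.toList b' Φ.toList)
    (hp' : T.IsElem Y.toList p' (idAt Φ.toList .var a' b')) {ω : ℕ → Expr T.sig}
    (hω : T.IsSub X.toList ω Y.toList) (ha : T.IsElem X.toList a Φ.toList)
    (hb : T.IsElem X.toList b Φ.toList) (e1 : a'.map (subst ω) = a) (e2 : b'.map (subst ω) = b) :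
    ∃ h : T.IsElem X.toList (p'.map (subst ω)) (idAt Φ.toList .var a b),
      sub ω hω ≫ pathMor ha' hb' hp' = pathMor ha hb h := by
  subst e1 e2
  exact ⟨_, sub_comp_pathMor _ _ _ _⟩

theorem sub_comp_elem {f : List (Expr T.sig)} (hf : T.IsElem Φ.toList f Ψ.toList)
    {τ : ℕ → Expr T.sig} (hτ : T.IsSub X.toList τ Φ.toList) :
    sub τ hτ ≫ sub _ hf.2 = sub _ (hf.map_subst hτ).2 := by
  refine (sub_comp_sub _ _).trans (sub_eq_sub fun i hi => ?_)
  rw [subst_push]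
  exact push_congr (by simpa [hf.1] using hi) _ _

theorem map_subst_map_subst {f : List (Expr T.sig)} (hf : T.IsElem Φ.toList f Ψ.toList)
    {σ τ υ : ℕ → Expr T.sig} (h : ∀ i < Φ.len, (σ i).subst τ = υ i) :
    (f.map (subst σ)).map (subst τ) = f.map (subst υ) := by
  rw [List.map_map, ← map_subst_congr hf.scoped h]
  exact List.map_congr_left fun e _ => subst_subst e σ τ

theorem map_subst_map_subst_eq {f : List (Expr T.sig)} (hf : T.IsElem Φ.toList f Ψ.toList)
    {σ τ : ℕ → Expr T.sig} (h : ∀ i < Φ.len, (σ i).subst τ = var i) :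
    (f.map (subst σ)).map (subst τ) = f := by
  rw [map_subst_map_subst hf h]
  exact (List.map_congr_left fun e _ => subst_var e).trans (List.map_id f)

theorem sub_up_nil : (sub (up ([] : List (Expr T.sig)).length (reflSub Φ.toList))
    (by rw [List.length_nil, up_zero]; exact isSub_reflSub Φ) : Φ ⟶ (pathCategory T).P Φ) =
      (pathCategory T).r Φ := by
  rw [r_eq]
  exact sub_eq_sub fun i hi => by rw [List.length_nil, up_zero]

theorem source_reflSub (Φ : Cxt T) : (vars Φ.len (2 * Φ.len)).map
    (subst (up ([] : List (Expr T.sig)).length (reflSub Φ.toList))) = vars Φ.len 0 := by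
  refine map_vars_eq_vars fun i hi => ?_
  rw [List.length_nil, up_zero, reflSub_apply, if_neg (by simp only [len] at *; omega), if_neg (by simp only [len] at *; omega)]
  exact congrArg _ (by simp only [len] at *; omega)

theorem target_reflSub (Φ : Cxt T) : (vars Φ.len Φ.len).map
    (subst (up ([] : List (Expr T.sig)).length (reflSub Φ.toList))) = vars Φ.len 0 := by
  refine map_vars_eq_vars fun i hi => ?_
  rw [List.length_nil, up_zero, reflSub_apply, if_neg (by simp only [len] at *; omega), if_pos (by simp only [len] at *; omega)]
  exact congrArg _ (by simp only [len] at *; omega)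

/-! ### Inverses, images and composites -/

/-- Both inversions send reflexivity to reflexivity and exchange the endpoints, so path induction
makes them homotopic on the generic path. The general case is a substitution instance. -/
theorem invPath_spec (ha : T.IsElem X.toList a Φ.toList) (hb : T.IsElem X.toList b Φ.toList)
    (hp : T.IsElem X.toList p (idAt Φ.toList .var a b)) :
    ∃ h : T.IsElem X.toList (invPath Φ.toList a b p) (idAt Φ.toList .var b a),
      Htp (pathMor hb ha h) (pathMor ha hb hp ≫ (pathCategory T).inv Φ) := by
  obtain ⟨h, hr⟩ := exists_elim (Q := (pathCategory T).P Φ) (R := Φ) (Θ := []) rfl rfl _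
    (isElem_target Φ) (isElem_source Φ) (isElem_vars_zero Φ) (isElem_vars_zero Φ)
    (isElem_rTerms Φ) (target_reflSub Φ) (source_reflSub Φ) fun i => .var (i + 3 * Φ.len)
  rw [pathMor_rTerms, sub_up_nil] at hr
  have key : Htp (pathMor (isElem_target Φ) (isElem_source Φ) h) ((pathCategory T).inv Φ) := by
    refine .of_r ?_ ?_ (.of_eq ?_)
    · rw [pathMor_s, sub_target, inv_s]
    · rw [pathMor_t, sub_source, inv_t]
    · rw [hr, r_inv]
  have l1 := hp.1
  rw [length_idAt] at l1
  obtain ⟨h', e⟩ := exists_pathMor_subst (isElem_target Φ) (isElem_source Φ) h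
    (isSub_path ha hb hp) hb ha (map_target hb.1 l1) (map_source ha.1 hb.1 l1)
  exact ⟨h', e ▸ key.precomp _⟩

theorem isElem_onePath (ha : T.IsElem X.toList a Φ.toList) :
    ∃ h : T.IsElem X.toList (onePath Φ.toList a) (idAt Φ.toList .var a a),
      pathMor ha ha h = sub _ ha.2 ≫ (pathCategory T).r Φ := by
  have e : (vars Φ.len 0).map (subst (push a .var)) = a :=
    map_vars_eq ha.1 fun i hi => by rw [Nat.zero_add]
  obtain ⟨h, h'⟩ := exists_pathMor_subst (isElem_vars_zero Φ) (isElem_vars_zero Φ)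
    (isElem_rTerms Φ) ha.2 ha ha e e
  exact ⟨h, h'.symm.trans (congrArg _ (pathMor_rTerms Φ))⟩

/-- On reflexivity at `x` both actions give the reflexivity at `f(x)`: the term by its computation
rule, the abstract map by construction. Path induction extends this to all paths. -/
theorem mapPath_spec {f : List (Expr T.sig)} (hf : T.IsElem Φ.toList f Ψ.toList)
    (ha : T.IsElem X.toList a Φ.toList) (hb : T.IsElem X.toList b Φ.toList)
    (hp : T.IsElem X.toList p (idAt Φ.toList .var a b)) :
    ∃ h : T.IsElem X.toList (mapPath Φ.toList Ψ.toList f a b p)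
        (idAt Ψ.toList .var (f.map (subst (push a .var))) (f.map (subst (push b .var)))),
      Htp (pathMor (hf.map_subst ha.2) (hf.map_subst hb.2) h)
        (pathMor ha hb hp ≫ (pathCategory T).map (sub _ hf.2)) := by
  have l1 := hp.1
  rw [length_idAt] at l1
  obtain ⟨h1, e1⟩ := isElem_onePath hf
  have s1 := hf.map_subst (isSub_source Φ)
  have s2 := hf.map_subst (isSub_target Φ)
  have r1 : (f.map (subst fun i => .var (2 * Φ.len + i))).map
      (subst (up ([] : List (Expr T.sig)).length (reflSub Φ.toList))) = f :=
    map_subst_map_subst_eq hf fun i hi => by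
      rw [List.length_nil, up_zero, Expr.subst, reflSub_apply, if_neg (by simp only [len] at *; omega), if_neg (by simp only [len] at *; omega)]
      exact congrArg _ (by simp only [len] at *; omega)
  have r2 : (f.map (subst fun i => .var (Φ.len + i))).map
      (subst (up ([] : List (Expr T.sig)).length (reflSub Φ.toList))) = f :=
    map_subst_map_subst_eq hf fun i hi => by
      rw [List.length_nil, up_zero, Expr.subst, reflSub_apply, if_neg (by simp only [len] at *; omega), if_pos (by simp only [len] at *; omega)]
      exact congrArg _ (by simp only [len] at *; omega)
  obtain ⟨h, hr⟩ := exists_elim (Q := (pathCategory T).P Φ) (R := Φ) (Θ := []) rfl rfl _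
    s1 s2 hf hf h1 r1 r2 .var
  rw [e1, sub_up_nil] at hr
  have key : Htp (pathMor s1 s2 h) ((pathCategory T).map (sub _ hf.2)) := by
    refine .of_r ?_ ?_ (.of_eq ?_)
    · rw [pathMor_s, ← sub_comp_elem hf (isSub_source Φ), sub_isSub_source, map_s]
    · rw [pathMor_t, ← sub_comp_elem hf (isSub_target Φ), sub_isSub_target, map_t]
    · rw [hr, r_map]
  obtain ⟨h', e⟩ := exists_pathMor_subst s1 s2 h
    (isSub_path ha hb hp) (hf.map_subst ha.2) (hf.map_subst hb.2)
    (map_subst_map_subst hf fun i hi => by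
      rw [Expr.subst, show 2 * Φ.len + i = i + Φ.len + Φ.len by omega, push_add' l1, push_add' hb.1])
    (map_subst_map_subst hf fun i hi => by
      rw [Expr.subst, show Φ.len + i = i + Φ.len by omega, push_add' l1]
      exact push_congr (by rw [hb.1]; exact hi) _ _)
  have e' : mapPath Φ.toList Ψ.toList f a b p = (jTerms Φ.toList []
      (idAt Ψ.toList .var (f.map (subst fun i => .var (2 * Φ.len + i)))
        (f.map (subst fun i => .var (Φ.len + i)))) (onePath Ψ.toList f)).map
      (subst (push p (push b (push a .var)))) := by
    simp only [mapPath, map_wk_eq, Nat.add_comm]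
  have hk := key.precomp (sub _ (isSub_path ha hb hp))
  rw [e] at hk
  exact ⟨e' ▸ h', (Htp.of_eq (pathMor_congr _ _ _ _ _ _ rfl rfl e')).trans hk⟩

theorem isElem_top {Q : Cxt T} (ha : T.IsElem X.toList a Φ.toList)
    (hb : T.IsElem X.toList b Φ.toList) (hQ : Q.toList = idAt Φ.toList .var a b ++ X.toList) :
    T.IsElem Q.toList (vars Φ.len 0) (idAt Φ.toList .var
      (a.map (subst fun i => .var (i + Φ.len))) (b.map (subst fun i => .var (i + Φ.len)))) := by
  rw [idAt_congr Φ (by simpa using ha.1) (by simpa using hb.1) _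
    fun i => (Expr.var i).subst fun i => .var (i + Φ.len), ← tsubst_idAt]
  refine isElem_tsubst_iff.2 ⟨by simp, ?_⟩
  have h := IsSub.var Q.wf
  have e : push (vars Φ.len 0) (fun i => .var (i + Φ.len)) = (Expr.var : ℕ → Expr T.sig) := by
    funext i
    rw [push_vars]
    split_ifs with h
    · rw [Nat.zero_add]
    · exact congrArg _ (by omega)
  rw [e]
  nth_rw 2 [hQ] at h
  exact (isSub_append.1 h).1

/-- Induction on the second path with the first one as parameter, exactly as the term is built. When
the second path is constant, both composites return the first one strictly. -/
theorem compPath_spec (ha : T.IsElem (empty T).toList a Φ.toList)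
    (hb : T.IsElem (empty T).toList b Φ.toList) (hc : T.IsElem (empty T).toList c Φ.toList)
    (hp : T.IsElem (empty T).toList p (idAt Φ.toList .var a b))
    (hq : T.IsElem (empty T).toList q (idAt Φ.toList .var b c)) :
    ∃ h : T.IsElem (empty T).toList (compPath Φ.toList a b c p q) (idAt Φ.toList .var a c),
      Htp (pathMor ha hc h) (comp (pathMor ha hb hp) (pathMor hb hc hq)
        (by rw [pathMor_t, pathMor_s])) := by
  have hp' := hp.1
  have hq' := hq.1
  rw [length_idAt] at hp' hq'
  have A0 := isElem_of_closed (X := (pathCategory T).P Φ) ha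
  have X0 := isElem_source Φ
  set Θ := idAt Φ.toList .var a (vars Φ.len (2 * Φ.len)) with hΘ
  have hl : Θ.length = Φ.len := length_idAt _ _ _ _
  -- `Q` is the context `(x, y, u, z ∈ Id(a, x))` in which the generic composite lives, and `R` is
  -- its restriction to `y = x` and `u = r(x)`.
  let Q : Cxt T := ⟨_, wf_idAt A0 X0⟩
  have hQ : Q.toList = Θ ++ ((pathCategory T).P Φ).toList := rfl
  let R : Cxt T := ⟨_, wf_tsubst hQ (isSub_reflSub Φ)⟩
  have hR : R.toList = tsubst (reflSub Φ.toList) Θ ++ Φ.toList := rfl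
  have hτ := isSub_up hQ hR (isSub_reflSub Φ)
  have A1 := isElem_of_closed (X := Q) ha
  have X1 := X0.map_subst (isSub_proj hQ)
  have Y1 := (isElem_target Φ).map_subst (isSub_proj hQ)
  have Z1 : T.IsElem Q.toList (vars Φ.len 0) (idAt Φ.toList .var a
      ((vars Φ.len (2 * Φ.len)).map (subst fun i => .var (i + Θ.length)))) := by
    rw [hl]
    have := isElem_top A0 X0 hQ
    rwa [map_subst_eq_self ha] at this
  have hs : proj hQ ≫ (pathCategory T).s Φ = sub _ X1.2 := by
    rw [← sub_source]; exact sub_comp_elem (isElem_source Φ) (isSub_proj hQ)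
  have ht : proj hQ ≫ (pathCategory T).t Φ = sub _ Y1.2 := by
    rw [← sub_target]; exact sub_comp_elem (isElem_target Φ) (isSub_proj hQ)
  have e1 : ((vars Φ.len (2 * Φ.len)).map (subst fun i => .var (i + Θ.length))).map
      (subst (up Θ.length (reflSub Φ.toList))) = vars Φ.len Φ.len := by
    rw [map_vars_eq_vars (n := 2 * Φ.len + Θ.length) fun i hi => ?_]
    · refine map_vars_eq_vars fun i hi => ?_
      rw [show 2 * Φ.len + Θ.length + i = 2 * Φ.len + i + Θ.length by omega, up_add, reflSub_apply,
        if_neg (by simp only [len] at *; omega), if_neg (by simp only [len] at *; omega), Expr.wk, rename]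
      exact congrArg _ (by simp only [len] at *; omega)
    · rw [Nat.add_right_comm]
  have e2 : ((vars Φ.len Φ.len).map (subst fun i => .var (i + Θ.length))).map
      (subst (up Θ.length (reflSub Φ.toList))) = vars Φ.len Φ.len := by
    rw [map_vars_eq_vars (n := Φ.len + Θ.length) fun i hi => ?_]
    · refine map_vars_eq_vars fun i hi => ?_
      rw [show Φ.len + Θ.length + i = Φ.len + i + Θ.length by omega, up_add, reflSub_apply,
        if_neg (by simp only [len] at *; omega), if_pos (by simp only [len] at *; omega), Expr.wk, rename]
      exact congrArg _ (by simp only [len] at *; omega)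
    · rw [Nat.add_right_comm]
  have A2 := isElem_of_closed (X := R) ha
  have Y2 := Y1.map_subst hτ
  rw [e2] at Y2
  obtain ⟨hd, hd'⟩ := exists_pathMor_subst A1 X1 Z1 hτ A2 Y2 (map_subst_eq_self ha _) e1
  obtain ⟨hj, hj'⟩ := exists_elim hQ hR hτ A1 Y1 A2 Y2 hd (map_subst_eq_self ha _) e2
    fun i => .var (i + 4 * Φ.len)
  have w : pathMor A1 X1 Z1 ≫ (pathCategory T).t Φ = proj hQ ≫ (pathCategory T).s Φ := by
    rw [hs, pathMor_t]
  have key : Htp (pathMor A1 Y1 hj) (comp (pathMor A1 X1 Z1) (proj hQ) w) := by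
    refine .extend (llp_up_reflSub (toList_eq_append_empty Φ) (toList_eq_append_empty _) hQ hR hτ)
      ?_ ?_ (.of_eq ?_)
    · rw [comp_s, pathMor_s, pathMor_s]
    · rw [comp_t, ht, pathMor_t]
    -- Over `R` the left side is `z` by the computation rule and the right side is `z` by the strict
    -- right unit law.
    · rw [hj', precomp_comp, comp_eq_left, hd']
      rw [(isPullback_up hQ hR (isSub_reflSub Φ) hτ).w, ← r_eq, ← Category.assoc]
      congr 1
      rw [hd', pathMor_t]
      refine (sub_eq_sub fun i hi => ?_).symm
      rw [push_vars, if_pos hi, length_tsubst, hl, Nat.add_comm]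
  have hpΘ : T.IsElem (empty T).toList p (tsubst (push q (push c (push b .var))) Θ) := by
    rw [hΘ, tsubst_idAt, map_subst_eq_self ha, map_source hb.1 hc.1 hq',
      idAt_congr Φ ha.1 hb.1 _ .var]
    exact hp
  have hω := isSub_push hQ (isSub_path hb hc hq) hpΘ
  have hX1 : ((vars Φ.len (2 * Φ.len)).map (subst fun i => .var (i + Θ.length))).map
      (subst (push p (push q (push c (push b .var))))) = b := by
    rw [map_vars_eq_vars (n := 2 * Φ.len + Φ.len) fun i hi => by rw [hl, Nat.add_right_comm]]
    refine map_vars_eq hb.1 fun i hi => ?_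
    rw [show 2 * Φ.len + Φ.len + i = i + Φ.len + Φ.len + Φ.len by omega, push_add' hp',
      push_add' hq', push_add' hc.1]
  have hY1' : (vars Φ.len Φ.len).map (subst fun i => Expr.var (i + Θ.length)) =
      (vars Φ.len (2 * Φ.len) : List (Expr T.sig)) :=
    map_vars_eq_vars fun i hi => congrArg _ (by omega)
  have hY1 : ((vars Φ.len Φ.len).map (subst fun i => .var (i + Θ.length))).map
      (subst (push p (push q (push c (push b .var))))) = c := by
    rw [hY1']
    exact map_source hc.1 hq' hp'
  obtain ⟨g, g'⟩ := exists_pathMor_subst A1 Y1 hj hω ha hc (map_subst_eq_self ha _) hY1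
  obtain ⟨z, z'⟩ := exists_pathMor_subst A1 X1 Z1 hω ha hb (map_subst_eq_self ha _) hX1
  have hz : (vars Φ.len 0).map (subst (push p (push q (push c (push b .var))))) = p :=
    map_vars_eq hp' fun i hi => by
      rw [Nat.zero_add]; exact push_congr (by rw [hp']; exact hi) _ _
  have hz' : (vars Φ.len 0).map (subst (up Θ.length (reflSub Φ.toList))) = vars Φ.len 0 :=
    map_vars_eq_vars fun i hi => up_lt (by simp only [len] at *; omega) _
  have e : compPath Φ.toList a b c p q = (jTerms Φ.toList Θ (idAt Φ.toList
      (fun i => .var (i + 4 * Φ.len)) a ((vars Φ.len Φ.len).map (subst fun i => .var (i + Θ.length))))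
      ((vars Φ.len 0).map (subst (up Θ.length (reflSub Φ.toList))))).map
      (subst (push p (push q (push c (push b .var))))) := by
    rw [hz', hY1', hΘ]
    simp only [compPath, map_wk_eq, map_subst_eq_self ha]
    rw [idAt_congr Φ ha.1 (by simp) _ .var]
  have hk := key.precomp (sub _ hω)
  rw [g', precomp_comp, comp_congr _ (z'.trans (pathMor_congr _ _ _ ha hb hp rfl rfl hz))
    (sub_push_comp_proj hQ (isSub_path hb hc hq) hpΘ)] at hk
  exact ⟨e ▸ g, (Htp.of_eq (pathMor_congr _ _ _ _ _ _ rfl rfl e)).trans hk⟩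

end Cxt

namespace Cxt

open TypeTheory CategoryTheory.PathCategory

variable {T : TypeTheory.{u}} {Φ Ψ Ξ : Cxt T}

/-! ### Homotopy classes of paths as homotopy classes of points of the path object -/

theorem isElem_rep {X : Cxt T} (f : X ⟶ Φ) : T.IsElem X.toList (rep f) Φ.toList := (Quot.out f).2

theorem sub_rep {X : Cxt T} (f : X ⟶ Φ) : sub _ (isElem_rep f).2 = f :=
  (mk_eq_sub _).symm.trans (Quot.out_eq f)

section Homotopy

variable {a b c : Φ.Pt}

/-- The point of the path object given by a path. -/
noncomputable def pathPt (p : Path a b) : empty T ⟶ (pathCategory T).P Φ :=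
  pathMor (isElem_rep a) (isElem_rep b) p.2

theorem pathPt_s (p : Path a b) : pathPt p ≫ (pathCategory T).s Φ = a :=
  (pathMor_s _ _ _).trans (sub_rep a)

theorem pathPt_t (p : Path a b) : pathPt p ≫ (pathCategory T).t Φ = b :=
  (pathMor_t _ _ _).trans (sub_rep b)

theorem exists_pathPt {z : empty T ⟶ (pathCategory T).P Φ} (hs : z ≫ (pathCategory T).s Φ = a)
    (ht : z ≫ (pathCategory T).t Φ = b) : ∃ p : Path a b, pathPt p = z := by
  obtain ⟨p, hp, rfl⟩ := exists_pathMor (isElem_rep a) (isElem_rep b) (z := z)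
    (hs.trans (sub_rep a).symm) (ht.trans (sub_rep b).symm)
  exact ⟨⟨p, hp⟩, rfl⟩

/-- `Homotopic` means joined by a path in the context `Id(a, b)`, and `Htp` means joined in the path
object over pairs of endpoints. Since `Id(a, b)` is the fibre of the latter over `(a, b)`,
`htp_of_path` and `exists_path_of_htp` give the two directions. -/
theorem homotopic_iff {p q : Path a b} : Homotopic p q ↔ Htp (pathPt p) (pathPt q) := by
  have hσ := isSub_ends (isElem_rep a) (isElem_rep b)
  have hE := toList_eq_pathSpace Φ
  let L : Cxt T := ⟨idCxt a b, by
    have := wf_tsubst hE hσ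
    rwa [show (empty T).toList = [] from rfl, List.append_nil] at this⟩
  have hL : L.toList = tsubst (push (rep b) (push (rep a) .var)) (idVar Φ.toList) ++
    (empty T).toList := (List.append_nil _).symm
  have hP := isPullback_up hE hL hσ (isSub_up hE hL hσ)
  have hD := isPullback_double (toList_eq_append_empty Φ)
  have hS := (pathCategory T).isPullback_square Φ
  have hD' : IsPullback (doubleFst (toList_eq_append_empty Φ))
    (doubleSnd (toList_eq_append_empty Φ)) ((pathCategory T).toOne Φ)
      ((pathCategory T).toOne Φ) := hD.flip
  -- The product chosen abstractly replaces the double context, to which it is canonically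
  -- isomorphic; `Id(a, b)` stays the fibre over the point `(a, b)`.
  have hP' : IsPullback (sub _ (isSub_up hE hL hσ)) (proj hL) ((pathCategory T).ends Φ)
      (sub _ hσ ≫ (hD'.isoIsPullback _ _ hS).hom) := by
    refine hP.of_iso (Iso.refl _) (Iso.refl _) (Iso.refl _) (hD'.isoIsPullback _ _ hS)
      (by simp) (by simp) ?_ (by simp)
    refine hS.hom_ext ?_ ?_
    · simp [s_eq, endsMap]
    · simp [t_eq, endsMap]
  have hp : T.IsElem (empty T).toList p.1 L.toList := p.2
  have hq : T.IsElem (empty T).toList q.1 L.toList := q.2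
  have e (r : Path a b) (hr : T.IsElem (empty T).toList r.1 L.toList) :
      sub _ hr.2 ≫ sub _ (isSub_up hE hL hσ) = pathPt r := by
    refine (sub_comp_sub _ _).trans (sub_eq_sub
      (h' := isSub_path (isElem_rep a) (isElem_rep b) r.2) fun i hi => ?_)
    rw [up_subst_push_var]
    exact hr.1.trans (length_tsubst _ _)
  rw [← e p hp, ← e q hq]
  constructor
  · rintro ⟨h, hh⟩
    have hh : T.IsElem (empty T).toList h (idAt L.toList .var p.1 q.1) := hh
    have := htp_of_path (h := sub _ (isSub_up hE hL hσ)) (by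
      rw [hP'.w, ← Category.assoc, ← Category.assoc ((pathCategory T).t L)]
      exact congrArg (· ≫ _) (hom_ext_empty _ _)) (pathMor hp hq hh)
    rwa [← Category.assoc, ← Category.assoc, pathMor_s, pathMor_t] at this
  · intro h
    obtain ⟨v, h1, h2⟩ := exists_path_of_htp hP' (hom_ext_empty _ _) h
    obtain ⟨r, hr, -⟩ := exists_pathMor hp hq h1 h2
    exact ⟨r, hr⟩

theorem mk_eq_mk_iff_htp {p q : Path a b} :
    (Quot.mk _ p : PathClass a b) = Quot.mk _ q ↔ Htp (pathPt p) (pathPt q) := by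
  have he : Equivalence fun p q : Path a b => Homotopic p q := by
    simp only [homotopic_iff]
    exact ⟨fun _ => Htp.refl _, Htp.symm, Htp.trans⟩
  rw [← homotopic_iff]
  exact ⟨fun h => he.eqvGen_iff.1 (Quot.eqvGen_exact h), fun h => Quot.sound h⟩

namespace PathClass

/-- A point of the path object which represents a given class of paths. -/
noncomputable def out (P : PathClass a b) : empty T ⟶ (pathCategory T).P Φ := pathPt (Quot.out P)

@[simp] theorem out_s (P : PathClass a b) : P.out ≫ (pathCategory T).s Φ = a := pathPt_s _

@[simp] theorem out_t (P : PathClass a b) : P.out ≫ (pathCategory T).t Φ = b := pathPt_t _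

theorem out_mk (p : Path a b) : Htp (out (Quot.mk _ p)) (pathPt p) :=
  mk_eq_mk_iff_htp.1 (Quot.out_eq _)

theorem ext_iff {P Q : PathClass a b} : P = Q ↔ Htp P.out Q.out := by
  rw [out, out, ← mk_eq_mk_iff_htp]
  exact ⟨fun h => congrArg _ (congrArg _ h), fun h => by
    rw [← Quot.out_eq P, ← Quot.out_eq Q]; exact h⟩

theorem isClassOf_iff {P : PathClass a b} {p : List (Expr T.sig)} : P.IsClassOf p ↔
    ∃ h : T.IsElem (empty T).toList p (idAt Φ.toList .var (rep a) (rep b)),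
      Htp P.out (pathMor (isElem_rep a) (isElem_rep b) h) := by
  refine exists_congr fun h => ?_
  have := out_mk (a := a) (b := b) ⟨p, h⟩
  exact ext_iff.trans ⟨fun h' => h'.trans this, fun h' => h'.trans this.symm⟩

/-- The class of a point of the path object. -/
noncomputable def cls (z : empty T ⟶ (pathCategory T).P Φ) (hs : z ≫ (pathCategory T).s Φ = a)
    (ht : z ≫ (pathCategory T).t Φ = b) : PathClass a b :=
  Quot.mk _ (exists_pathPt hs ht).choose

theorem out_cls {z : empty T ⟶ (pathCategory T).P Φ} (hs : z ≫ (pathCategory T).s Φ = a)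
    (ht : z ≫ (pathCategory T).t Φ = b) : Htp (cls z hs ht).out z := by
  have := out_mk (exists_pathPt hs ht).choose
  rwa [(exists_pathPt hs ht).choose_spec] at this

/-- The functor laws compare classes whose endpoints agree only propositionally. Their representing
points live in the same hom-set, so homotopy of these can be stated without transporting along such
equalities. -/
theorem heq {a' b' : Φ.Pt} {P : PathClass a b} {Q : PathClass a' b'} (ha : a = a') (hb : b = b')
    (h : Htp P.out Q.out) : HEq P Q := by
  subst ha hb
  exact heq_of_eq (ext_iff.2 h)

/-- The operations on classes are defined through the abstract path category, where the laws are
known up to homotopy; `one_class` and its companions then identify them with the prescribed terms.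
-/
noncomputable def one (a : Φ.Pt) : PathClass a a :=
  cls (a ≫ (pathCategory T).r Φ) (by simp) (by simp)

noncomputable def comp (P : PathClass a b) (Q : PathClass b c) : PathClass a c :=
  cls (PathCategory.comp P.out Q.out (by simp)) (by rw [comp_s, out_s]) (by rw [comp_t, out_t])

noncomputable def inv (P : PathClass a b) : PathClass b a :=
  cls (P.out ≫ (pathCategory T).inv Φ) (by simp) (by simp)

noncomputable def map (f : Φ ⟶ Ψ) (P : PathClass a b) : PathClass (a ≫ f) (b ≫ f) :=
  cls (P.out ≫ (pathCategory T).map f)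
    (by rw [Category.assoc, map_s, ← Category.assoc, out_s])
    (by rw [Category.assoc, map_t, ← Category.assoc, out_t])

theorem out_one (a : Φ.Pt) : Htp (one a).out (a ≫ (pathCategory T).r Φ) := out_cls _ _

theorem out_comp (P : PathClass a b) (Q : PathClass b c) :
    Htp (comp P Q).out (PathCategory.comp P.out Q.out (by simp)) := out_cls _ _

theorem out_inv (P : PathClass a b) : Htp (inv P).out (P.out ≫ (pathCategory T).inv Φ) :=
  out_cls _ _

theorem out_map (f : Φ ⟶ Ψ) (P : PathClass a b) :
    Htp (map f P).out (P.out ≫ (pathCategory T).map f) := out_cls _ _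

theorem one_class (a : Φ.Pt) : (one a).IsClassOf (onePath Φ.toList (rep a)) := by
  obtain ⟨h, e⟩ := isElem_onePath (isElem_rep a)
  rw [sub_rep] at e
  exact isClassOf_iff.2 ⟨h, (out_one a).trans (.of_eq e.symm)⟩

theorem comp_class {P : PathClass a b} {Q : PathClass b c} {p q : List (Expr T.sig)}
    (hp : P.IsClassOf p) (hq : Q.IsClassOf q) :
    (comp P Q).IsClassOf (compPath Φ.toList (rep a) (rep b) (rep c) p q) := by
  obtain ⟨hp, hp'⟩ := isClassOf_iff.1 hp
  obtain ⟨hq, hq'⟩ := isClassOf_iff.1 hq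
  obtain ⟨h, h'⟩ := compPath_spec (isElem_rep a) (isElem_rep b) (isElem_rep c) hp hq
  exact isClassOf_iff.2 ⟨h, (out_comp P Q).trans ((hp'.comp hq' _ _).trans h'.symm)⟩

theorem inv_class {P : PathClass a b} {p : List (Expr T.sig)} (hp : P.IsClassOf p) :
    (inv P).IsClassOf (invPath Φ.toList (rep a) (rep b) p) := by
  obtain ⟨hp, hp'⟩ := isClassOf_iff.1 hp
  obtain ⟨h, h'⟩ := invPath_spec (isElem_rep a) (isElem_rep b) hp
  exact isClassOf_iff.2 ⟨h, (out_inv P).trans (hp'.inv.trans h'.symm)⟩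

/-- The representative chosen for `a ≫ f` need not be the composite of the chosen ones, so the path
is first converted to the right endpoints. -/
theorem map_class (f : Φ ⟶ Ψ) {P : PathClass a b} {p : List (Expr T.sig)} (hp : P.IsClassOf p) :
    (map f P).IsClassOf (mapPath Φ.toList Ψ.toList (rep f) (rep a) (rep b) p) := by
  obtain ⟨hp, hp'⟩ := isClassOf_iff.1 hp
  obtain ⟨h, h'⟩ := mapPath_spec (isElem_rep f) (isElem_rep a) (isElem_rep b) hp
  obtain ⟨g, g'⟩ := pathMor_conv _ _ h (isElem_rep (a ≫ f)) (isElem_rep (b ≫ f))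
    (by rw [← sub_comp_elem (isElem_rep f) (isElem_rep a).2, sub_rep, sub_rep, sub_rep])
    (by rw [← sub_comp_elem (isElem_rep f) (isElem_rep b).2, sub_rep, sub_rep, sub_rep])
  rw [sub_rep] at h'
  exact isClassOf_iff.2
    ⟨g, (out_map f P).trans ((hp'.map f).trans (h'.symm.trans (.of_eq g'.symm)))⟩

theorem one_comp (P : PathClass a b) : comp (one a) P = P :=
  ext_iff.2 <| (out_comp _ _).trans <| ((out_one a).comp (.refl _) (by simp) (by simp)).trans <|
    PathCategory.one_comp _ (by rw [← Category.assoc, out_s])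

theorem comp_one (P : PathClass a b) : comp P (one b) = P :=
  ext_iff.2 <| (out_comp _ _).trans <| ((Htp.refl _).comp (out_one b) (by simp) (by simp)).trans <|
    .of_eq <| comp_eq_left _ (by rw [← Category.assoc, out_t])

theorem assoc {d : Φ.Pt} (P : PathClass a b) (Q : PathClass b c) (R : PathClass c d) :
    comp (comp P Q) R = comp P (comp Q R) :=
  ext_iff.2 <| (out_comp _ _).trans <|
    ((out_comp P Q).comp (.refl _) (by simp) (by rw [comp_t]; simp)).trans <|
      (PathCategory.comp_assoc _ _).trans <| .symm <| (out_comp _ _).trans <|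
        (Htp.refl _).comp (out_comp Q R) (by simp) (by rw [comp_s]; simp)

theorem inv_comp (P : PathClass a b) : comp (inv P) P = one b :=
  ext_iff.2 <| (out_comp _ _).trans <| ((out_inv P).comp (.refl _) (by simp) (by simp)).trans <|
    (PathCategory.inv_comp _).trans <| .symm <| (out_one b).trans <|
      .of_eq (by rw [← Category.assoc, out_t])

theorem comp_inv (P : PathClass a b) : comp P (inv P) = one a :=
  ext_iff.2 <| (out_comp _ _).trans <| ((Htp.refl _).comp (out_inv P) (by simp) (by simp)).trans <|
    (PathCategory.comp_inv _).trans <| .symm <| (out_one a).trans <|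
      .of_eq (by rw [← Category.assoc, out_s])

theorem map_one (f : Φ ⟶ Ψ) (a : Φ.Pt) : map f (one a) = one (a ≫ f) :=
  ext_iff.2 <| (out_map _ _).trans <| ((out_one a).map f).trans <|
    .symm <| (out_one _).trans <| .of_eq (by simp)

theorem map_comp (f : Φ ⟶ Ψ) (P : PathClass a b) (Q : PathClass b c) :
    map f (comp P Q) = comp (map f P) (map f Q) :=
  ext_iff.2 <| (out_map _ _).trans <| ((out_comp P Q).map f).trans <|
    (map_comp_path f _).trans <| .symm <| (out_comp _ _).trans <|
      (out_map f P).comp (out_map f Q) (by simp)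
        (by rw [Category.assoc, Category.assoc, map_s, map_t, ← Category.assoc, ← Category.assoc,
          out_s, out_t])

theorem id_map (P : PathClass a b) : HEq (map (𝟙 Φ) P) P :=
  PathClass.heq (Category.comp_id _) (Category.comp_id _) <| (out_map _ _).trans <|
    (((pathCategory T).map_id Φ).precomp P.out).trans (.of_eq (Category.comp_id _))

theorem comp_map (f : Φ ⟶ Ψ) (g : Ψ ⟶ Ξ) (P : PathClass a b) :
    HEq (map (f ≫ g) P) (map g (map f P)) :=
  PathClass.heq (Category.assoc _ _ _).symm (Category.assoc _ _ _).symm <| (out_map _ _).trans <|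
    (((pathCategory T).map_comp f g).precomp P.out).trans <| .symm <| (out_map _ _).trans <|
      ((out_map f P).map g).trans (.of_eq (Category.assoc _ _ _))

end PathClass

end Homotopy

variable (T) in
/-- The fundamental groupoid functor. -/
noncomputable def fundamentalGroupoidFunctor : FundamentalGroupoidFunctor T where
  one a := PathClass.one a
  comp P Q := PathClass.comp P Q
  inv P := PathClass.inv P
  map {_ _} f {_ _} P := PathClass.map f P
  one_class a := PathClass.one_class a
  comp_class hp hq := PathClass.comp_class hp hq
  inv_class hp := PathClass.inv_class hp
  map_class {_ _} f {_ _ _ _} hp := PathClass.map_class f hp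
  one_comp P := PathClass.one_comp P
  comp_one P := PathClass.comp_one P
  assoc P Q R := PathClass.assoc P Q R
  inv_comp P := PathClass.inv_comp P
  comp_inv P := PathClass.comp_inv P
  map_one f a := PathClass.map_one f a
  map_comp {_ _} f {_ _ _} P Q := PathClass.map_comp f P Q
  id_map P := PathClass.id_map P
  comp_map {_ _ _} f g {_ _} P := PathClass.comp_map f g P

end Cxt

/-! ### Mapping path objects up to isomorphism -/

namespace CategoryTheory.PathCategory

universe v w

variable {C : Type w} [Category.{v} C]

/-- A factorisation of `f` as a homotopy equivalence `i` and a map `p`, such that a point of `E` is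
a path in `Y` which starts at the image of a point of `X`, up to homotopy. -/
structure MappingPath (K : PathCategory C) {X Y : C} (f : X ⟶ Y) (E : C) where
  i : X ⟶ E
  x : E ⟶ X
  p : E ⟶ Y
  h : E ⟶ K.P Y
  H : E ⟶ K.P E
  i_x : i ≫ x = 𝟙 X
  i_p : i ≫ p = f
  i_h : i ≫ h = f ≫ K.r Y
  h_s : h ≫ K.s Y = x ≫ f
  h_t : h ≫ K.t Y = p
  H_s : H ≫ K.s E = x ≫ i
  H_t : H ≫ K.t E = 𝟙 E
  lift {Z : C} {a : Z ⟶ X} {z : Z ⟶ K.P Y} (hz : z ≫ K.s Y = a ≫ f) :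
    ∃ e : Z ⟶ E, e ≫ x = a ∧ Htp (e ≫ h) z

namespace MappingPath

variable {K : PathCategory C} {X Y E : C} {f : X ⟶ Y}

attribute [simp] i_x i_p i_h h_s h_t H_s H_t

/-- The pullback of the path object of `Y` along `f`. -/
noncomputable def ofIsPullback {h : E ⟶ K.P Y} {x : E ⟶ X} (hE : IsPullback h x (K.s Y) f)
    {i : X ⟶ E} (hx : i ≫ x = 𝟙 X) (hh : i ≫ h = f ≫ K.r Y) : K.MappingPath f E where
  i := i
  x := x
  p := h ≫ K.t Y
  h := h
  H := (exists_retraction hE hx hh).choose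
  i_x := hx
  i_p := by rw [← Category.assoc, hh]; simp
  i_h := hh
  h_s := hE.w
  h_t := rfl
  H_s := (exists_retraction hE hx hh).choose_spec.1
  H_t := (exists_retraction hE hx hh).choose_spec.2
  lift hz := ⟨hE.lift _ _ hz, by simp, .of_eq (by simp)⟩

/-- Transport along isomorphisms. -/
noncomputable def transport (M : K.MappingPath f E) {X' Y' E' : C} (α : X ≅ X') (β : Y ≅ Y') (ε : E ≅ E')
    {f' : X' ⟶ Y'} (hf : f' = α.inv ≫ f ≫ β.hom) : K.MappingPath f' E' where
  i := α.inv ≫ M.i ≫ ε.hom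
  x := ε.inv ≫ M.x ≫ α.hom
  p := ε.inv ≫ M.p ≫ β.hom
  h := ε.inv ≫ M.h ≫ K.map β.hom
  H := ε.inv ≫ M.H ≫ K.map ε.hom
  i_x := by simp [reassoc_of% M.i_x]
  i_p := by simp [hf, reassoc_of% M.i_p]
  i_h := by simp [hf, reassoc_of% M.i_h]
  h_s := by simp [hf, reassoc_of% M.h_s]
  h_t := by simp [reassoc_of% M.h_t]
  H_s := by simp [reassoc_of% M.H_s]
  H_t := by simp [reassoc_of% M.H_t]
  lift {Z a z} hz := by
    obtain ⟨e, he, he'⟩ := M.lift (a := a ≫ α.inv) (z := z ≫ K.map β.inv)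
      (by simp [reassoc_of% hz, hf])
    refine ⟨e ≫ ε.hom, by simp [reassoc_of% he], ?_⟩
    have h1 := he'.map β.hom
    rw [Category.assoc, Category.assoc] at h1
    -- The action on paths is functorial only up to homotopy. Hence the isomorphism on path objects
    -- is not strict, and `lift` asks for the path only up to homotopy.
    have h2 := (K.map_comp β.inv β.hom).symm.precomp z
    rw [β.inv_hom_id] at h2
    have h3 := h1.trans (h2.trans ((K.map_id Y').precomp z))
    simpa using h3

end MappingPath

end CategoryTheory.PathCategory

/-! ### Mapping spaces of functors of groupoids -/

namespace CategoryTheory.Grpd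

theorem comma_ext {A B : Type u} [Category.{u} A] [Category.{u} B] {F : A ⥤ B} {X Y : Comma F (𝟭 B)}
    (h1 : X.left = Y.left) (h2 : X.right = Y.right) (h3 : HEq X.hom Y.hom) : X = Y := by
  obtain ⟨a, b, β⟩ := X
  obtain ⟨a', b', β'⟩ := Y
  obtain rfl : a = a' := h1
  obtain rfl : b = b' := h2
  obtain rfl := eq_of_heq h3
  rfl

theorem comma_hom_ext {A B : Type u} [Category.{u} A] [Category.{u} B] {F : A ⥤ B}
    {X Y X' Y' : Comma F (𝟭 B)} (hX : X = X') (hY : Y = Y') {φ : X ⟶ Y} {φ' : X' ⟶ Y'}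
    (h1 : HEq φ.left φ'.left) (h2 : HEq φ.right φ'.right) : HEq φ φ' := by
  subst hX hY
  exact heq_of_eq (Comma.hom_ext _ _ (eq_of_heq h1) (eq_of_heq h2))

/-- A map between objects `(a, F(a), 1)` is determined by its first component, and `(1, β)` is an
isomorphism from `(a, F(a), 1)` to any `(a, b, β)`. -/
theorem isEquivalence_iPath {A B : Grpd.{u, u}} (f : A ⟶ B) :
    letI F : A ⥤ path f := iPath f
    F.IsEquivalence := by
  let F : A ⥤ B := f
  let I : A ⥤ Comma F (𝟭 B) := iPath f
  have h1 : I.Faithful := ⟨fun {X Y α α'} h => congrArg CommaMorphism.left h⟩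
  have h2 : I.Full := ⟨fun {X Y} φ => ⟨φ.left, by
    refine Comma.hom_ext _ _ rfl ?_
    have := φ.w
    have h' : F.map φ.left ≫ 𝟙 _ = 𝟙 _ ≫ φ.right := this
    rw [Category.comp_id, Category.id_comp] at h'
    exact h'⟩⟩
  have h3 : I.EssSurj := ⟨fun c => by
    have : IsIso (X := F.obj c.left) (Y := c.right) c.hom := inferInstance
    refine ⟨c.left, ⟨Comma.isoMk (Iso.refl _) (asIso (X := F.obj c.left) (Y := c.right) c.hom) ?_⟩⟩
    change F.map (𝟙 _) ≫ c.hom = 𝟙 _ ≫ c.hom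
    simp⟩
  have : I.IsEquivalence := {}
  exact this

theorem SurjectiveEquivalence.comp {A B D : Grpd.{u, u}} {f : A ⟶ B} {g : B ⟶ D}
    (hf : SurjectiveEquivalence f) (hg : SurjectiveEquivalence g) :
    SurjectiveEquivalence (f ≫ g) := by
  let F : A ⥤ B := f
  let G : B ⥤ D := g
  have h1 : F.IsEquivalence := hf.1
  have h2 : G.IsEquivalence := hg.1
  exact ⟨(inferInstance : (F ⋙ G).IsEquivalence), hg.2.comp hf.2⟩

end CategoryTheory.Grpd

/-! ### The comparison functor to the mapping space -/

namespace Cxt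

open TypeTheory CategoryTheory.PathCategory

variable {T : TypeTheory.{u}} {X Y E : Cxt T}

/-- The square of `PathCategory.naturality`, for classes. The sides enter through homotopies so that
their endpoints need not be literally composites with `h`. -/
theorem PathClass.naturality (h : X ⟶ (pathCategory T).P Y) {a b : X.Pt} (P : PathClass a b)
    {c₁ c₂ c₃ c₄ : Y.Pt} {U : PathClass c₁ c₂} {V : PathClass c₂ c₄} {W : PathClass c₁ c₃}
    {R : PathClass c₃ c₄}
    (hU : Htp U.out (P.out ≫ (pathCategory T).map (h ≫ (pathCategory T).s Y)))
    (hV : Htp V.out (b ≫ h)) (hW : Htp W.out (a ≫ h))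
    (hR : Htp R.out (P.out ≫ (pathCategory T).map (h ≫ (pathCategory T).t Y))) :
    PathClass.comp U V = PathClass.comp W R := by
  have ha : P.out ≫ (pathCategory T).s X ≫ h = a ≫ h := by rw [← Category.assoc, P.out_s]
  have hb : P.out ≫ (pathCategory T).t X ≫ h = b ≫ h := by rw [← Category.assoc, P.out_t]
  rw [← hb] at hV
  rw [← ha] at hW
  refine PathClass.ext_iff.2 <| (PathClass.out_comp U V).trans <| (hU.comp hV _ (by simp)).trans <|
    (PathCategory.naturality h P.out).trans <| .symm <|
      (PathClass.out_comp W R).trans <| hW.comp hR _ _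

variable {f : X ⟶ Y}

local notation "𝓕" => FundamentalGroupoidFunctor.onCxt (Cxt.fundamentalGroupoidFunctor _)

theorem out_map_map (f : X ⟶ Y) (g : E ⟶ X) {a b : E.Pt} (P : PathClass a b) :
    Htp (PathClass.map f (PathClass.map g P)).out
      (P.out ≫ (pathCategory T).map (g ≫ f)) :=
  (PathClass.out_map _ _).trans <| ((PathClass.out_map g P).map f).trans <|
    (Htp.of_eq (Category.assoc _ _ _)).trans <| ((pathCategory T).map_comp g f).symm.precomp _

/-- The path from `f(x(e))` to `p(e)`. -/
noncomputable def pathHom (M : (pathCategory T).MappingPath f E) (e : E.Pt) :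
    PathClass ((e ≫ M.x) ≫ f) (e ≫ M.p) :=
  PathClass.cls (e ≫ M.h) (by simp) (by simp)

theorem out_pathHom (M : (pathCategory T).MappingPath f E) (e : E.Pt) :
    Htp (pathHom M e).out (e ≫ M.h) := PathClass.out_cls _ _

theorem pathHom_naturality (M : (pathCategory T).MappingPath f E) {e e' : E.Pt}
    (P : PathClass e e') : PathClass.comp (PathClass.map f (PathClass.map M.x P)) (pathHom M e') =
      PathClass.comp (pathHom M e) (PathClass.map M.p P) := by
  refine PathClass.naturality M.h P ?_ (out_pathHom M e') (out_pathHom M e) ?_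
  · rw [M.h_s]; exact out_map_map _ _ _
  · rw [M.h_t]; exact PathClass.out_map _ _

/-- The path from `i(x(e))` to `e`. -/
noncomputable def retraction (M : (pathCategory T).MappingPath f E) (e : E.Pt) :
    PathClass ((e ≫ M.x) ≫ M.i) e :=
  PathClass.cls (e ≫ M.H) (by simp) (by simp)

theorem out_retraction (M : (pathCategory T).MappingPath f E) (e : E.Pt) :
    Htp (retraction M e).out (e ≫ M.H) := PathClass.out_cls _ _

theorem retraction_naturality (M : (pathCategory T).MappingPath f E) {e e' : E.Pt}
    (P : PathClass e e') : PathClass.comp (PathClass.map M.i (PathClass.map M.x P))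
      (retraction M e') = PathClass.comp (retraction M e) P := by
  refine PathClass.naturality M.H P ?_ (out_retraction M e') (out_retraction M e) ?_
  · rw [M.H_s]; exact out_map_map _ _ _
  · rw [M.H_t]
    exact .symm <| (((pathCategory T).map_id E).precomp _).trans (.of_eq (Category.comp_id _))

/-- The functor to the mapping space. -/
noncomputable def toPath (M : (pathCategory T).MappingPath f E) :
    (𝓕).obj E ⟶ Grpd.path ((𝓕).map f) :=
  let A := (𝓕).obj X
  let B := (𝓕).obj Y
  let D := (𝓕).obj E
  let F : A ⥤ B := (𝓕).map f
  show D ⥤ Comma F (𝟭 B) from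
    { obj := fun (e : E.Pt) =>
        { left := (e ≫ M.x : X.Pt)
          right := (e ≫ M.p : Y.Pt)
          hom := pathHom M e }
      map := fun P =>
        { left := PathClass.map M.x P
          right := PathClass.map M.p P
          w := pathHom_naturality M P }
      map_id := fun e => Comma.hom_ext _ _ (PathClass.map_one M.x e) (PathClass.map_one M.p e)
      map_comp := fun P Q =>
        Comma.hom_ext _ _ (PathClass.map_comp M.x P Q) (PathClass.map_comp M.p P Q) }

theorem toPath_pPath (M : (pathCategory T).MappingPath f E) :
    toPath M ≫ Grpd.pPath ((𝓕).map f) = (𝓕).map M.p := rfl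

/-- On objects the equations for `i ≫ x`, `i ≫ p` and `i ≫ h` hold as equalities of context
morphisms. On maps, functoriality up to homotopy becomes equality of classes, so the functors are
equal and not merely isomorphic. -/
theorem map_toPath (M : (pathCategory T).MappingPath f E) :
    (𝓕).map M.i ≫ toPath M = Grpd.iPath ((𝓕).map f) := by
  have hx (a : X.Pt) : (a ≫ M.i) ≫ M.x = a := by simp
  have hp (a : X.Pt) : (a ≫ M.i) ≫ M.p = a ≫ f := by simp
  have hobj (a : X.Pt) : ((𝓕).map M.i ≫ toPath M).obj a = (Grpd.iPath ((𝓕).map f)).obj a := by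
    refine Grpd.comma_ext (hx a) (hp a) ?_
    have hh : (a ≫ M.i) ≫ M.h = (a ≫ f) ≫ (pathCategory T).r Y := by simp
    exact PathClass.heq (congrArg (· ≫ f) (hx a)) (hp a)
      ((out_pathHom _ _).trans ((Htp.of_eq hh).trans (PathClass.out_one _).symm))
  refine CategoryTheory.Functor.hext hobj fun (a b : X.Pt) (P : PathClass a b) => ?_
  refine Grpd.comma_hom_ext (hobj a) (hobj b) ?_ ?_
  · refine PathClass.heq (hx a) (hx b) ?_
    refine (out_map_map _ _ _).trans ?_
    rw [M.i_x]
    exact (((pathCategory T).map_id X).precomp _).trans (.of_eq (Category.comp_id _))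
  · refine PathClass.heq (hp a) (hp b) ?_
    refine (out_map_map _ _ _).trans ?_
    rw [M.i_p]
    exact (PathClass.out_map _ _).symm

/-- `F(x)` is a strict left inverse, and the deformation retraction gives a natural isomorphism for
the other composite. -/
theorem isEquivalence_map_i (M : (pathCategory T).MappingPath f E) :
    let I : (𝓕).obj X ⥤ (𝓕).obj E := (𝓕).map M.i
    I.IsEquivalence := by
  let A := (𝓕).obj X
  let D := (𝓕).obj E
  let I : A ⥤ D := (𝓕).map M.i
  let R : D ⥤ A := (𝓕).map M.x
  have h1 : I ⋙ R = 𝟭 A := by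
    change (𝓕).map M.i ≫ (𝓕).map M.x = 𝟙 ((𝓕).obj X)
    rw [← Functor.map_comp, M.i_x, CategoryTheory.Functor.map_id]
  let η : R ⋙ I ≅ 𝟭 D := NatIso.ofComponents
    (fun e => Groupoid.isoEquivHom (C := D) ((e ≫ M.x : X.Pt) ≫ M.i : E.Pt) e |>.symm
      (retraction M e))
    (fun P => retraction_naturality M P)
  exact Functor.IsEquivalence.mk' R (eqToIso h1.symm) η

/-- Two out of three: `F(i)` and `F(i) ≫ σ = i_{F(f)}` are equivalences. Surjectivity on objects is
the lifting of a path starting at `f(a)` to a point of the mapping path object over `a`. -/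
theorem surjectiveEquivalence_toPath (M : (pathCategory T).MappingPath f E) :
    Grpd.SurjectiveEquivalence (toPath M) := by
  let A := (𝓕).obj X
  let D := (𝓕).obj E
  let I : A ⥤ D := (𝓕).map M.i
  let S : D ⥤ Grpd.path ((𝓕).map f) := toPath M
  have h1 : I.IsEquivalence := isEquivalence_map_i M
  have h2 : (I ⋙ S).IsEquivalence := by
    have h := Grpd.isEquivalence_iPath ((𝓕).map f)
    rw [← map_toPath M] at h
    exact h
  refine ⟨Functor.isEquivalence_of_comp_left I S, fun c => ?_⟩
  let a : X.Pt := c.left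
  let b : Y.Pt := c.right
  let β : PathClass (a ≫ f) b := c.hom
  obtain ⟨e, he, he'⟩ := M.lift (a := a) (z := β.out) β.out_s
  have hb : e ≫ M.p = b := by
    have h : (e ≫ M.h) ≫ (pathCategory T).t Y = β.out ≫ (pathCategory T).t Y := he'.parallel.2
    simpa using h
  exact ⟨e, Grpd.comma_ext he hb
    (PathClass.heq (congrArg (· ≫ f) he) hb ((out_pathHom _ _).trans he'))⟩

end Cxt

/-! ### Commutative squares as functors on `J` -/

namespace CategoryTheory.Grpd

theorem natTrans_heq {A : Type u} [Category.{u} A] {X Y X' Y' : J ⥤ A}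
    (hX : X = X') (hY : Y = Y') {φ : X ⟶ Y} {φ' : X' ⟶ Y'}
    (h : ∀ d, HEq (φ.app d) (φ'.app d)) : HEq φ φ' := by
  subst hX hY
  exact heq_of_eq (NatTrans.ext (funext fun d => eq_of_heq (h d)))

section

variable {A : Type u} [Groupoid.{u} A]

/-- The source or the target of a map. -/
def endpoint (a b : A) : Bool → A
  | false => a
  | true => b

/-- The map from the source to an endpoint. -/
def toEndpoint {a b : A} (β : a ⟶ b) : (d : Bool) → (a ⟶ endpoint a b d)
  | false => 𝟙 a
  | true => β

/-- The isomorphism `β` as a functor. -/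
def isoFunctor {a b : A} (β : a ⟶ b) : J ⥤ A where
  obj d := endpoint a b d.as
  map {d e} _ := Groupoid.inv (toEndpoint β d.as) ≫ toEndpoint β e.as

theorem isoFunctor_map_hom {a b : A} (β : a ⟶ b) :
    (isoFunctor β).map (X := ⟨false⟩) (Y := ⟨true⟩) () = β := by
  change Groupoid.inv (𝟙 a) ≫ β = β
  simp

/-- The maps between the endpoints given by a commutative square. -/
def endpointMap {a b a' b' : A} (φ : a ⟶ a') (ψ : b ⟶ b') :
    (d : Bool) → (endpoint a b d ⟶ endpoint a' b' d)
  | false => φ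
  | true => ψ

theorem toEndpoint_endpointMap {a b a' b' : A} {β : a ⟶ b} {β' : a' ⟶ b'} {φ : a ⟶ a'} {ψ : b ⟶ b'}
    (h : φ ≫ β' = β ≫ ψ) (d : Bool) :
    toEndpoint β d ≫ endpointMap φ ψ d = φ ≫ toEndpoint β' d := by
  cases d
  · exact (Category.id_comp φ).trans (Category.comp_id φ).symm
  · exact h.symm

/-- Commutative squares as isomorphisms. -/
def commaToFunctor : Comma (𝟭 A) (𝟭 A) ⥤ (J ⥤ A) where
  obj c := isoFunctor (A := A) c.hom
  map {c c'} φ :=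
    { app := fun d => endpointMap (A := A) φ.left φ.right d.as
      naturality := fun d e _ => by
        have h (d : Bool) : toEndpoint (A := A) c.hom d ≫ endpointMap (A := A) φ.left φ.right d =
          (show (c.left : A) ⟶ c'.left from φ.left) ≫ toEndpoint (A := A) c'.hom d :=
            toEndpoint_endpointMap (A := A) φ.w d
        change (Groupoid.inv (toEndpoint (A := A) c.hom d.as) ≫ toEndpoint (A := A) c.hom e.as) ≫ _ =
          _ ≫ Groupoid.inv (toEndpoint (A := A) c'.hom d.as) ≫ toEndpoint (A := A) c'.hom e.as
        rw [Category.assoc, h e.as, Groupoid.inv_eq_inv, IsIso.inv_comp_eq, ← Category.assoc,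
          h d.as]
        simp }
  map_id c := by
    ext ⟨d⟩
    cases d <;> rfl
  map_comp φ ψ := by
    ext ⟨d⟩
    cases d <;> rfl

/-- Any two objects of `J` are joined by a unique map, and each map factors through the object
`false`. So `G` is determined by the single map from `false` to `true`, strictly and not only up to
isomorphism. -/
theorem isoFunctor_map (G : J ⥤ A) :
    isoFunctor (G.map (X := ⟨false⟩) (Y := ⟨true⟩) ()) = G := by
  refine CategoryTheory.Functor.hext (by rintro ⟨_ | _⟩ <;> rfl) ?_
  have h (d : Bool) : HEq (toEndpoint (G.map (X := ⟨false⟩) (Y := ⟨true⟩) ()) d)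
      (G.map (X := ⟨false⟩) (Y := ⟨d⟩) ()) := by
    cases d
    · exact heq_of_eq (G.map_id _).symm
    · rfl
  rintro ⟨d⟩ ⟨e⟩ ⟨⟩
  have h1 : G.map (X := ⟨d⟩) (Y := ⟨e⟩) () =
      Groupoid.inv (G.map (X := ⟨false⟩) (Y := ⟨d⟩) ()) ≫ G.map (X := ⟨false⟩) (Y := ⟨e⟩) () := by
    rw [Groupoid.inv_eq_inv, IsIso.eq_inv_comp, ← G.map_comp]
    rfl
  rw [h1]
  have hd := h d
  have he := h e
  cases d <;> cases e <;>
    exact heq_of_eq (congrArg₂ (fun φ ψ => Groupoid.inv φ ≫ ψ) (eq_of_heq hd) (eq_of_heq he))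

theorem isoFunctor_id (a : A) : isoFunctor (𝟙 a) = (Functor.const J).obj a := by
  exact isoFunctor_map ((Functor.const J).obj a)

end

/-- The mapping space of an identity functor consists of maps and commutative squares, which are
functors on `J` and natural transformations. Allowing any `f` equal to the identity suits the image
of an identity under a functor. -/
theorem exists_powJ {A : Grpd.{u, u}} {f : A ⟶ A} (hf : f = 𝟙 A) :
    ∃ ψ : path f ⟶ powJ A, SurjectiveEquivalence ψ ∧ iPath f ≫ ψ = constJ A ∧
      ψ ≫ targetJ A = pPath f := by
  subst hf
  let S : Comma (𝟭 A) (𝟭 A) ⥤ (J ⥤ A) := commaToFunctor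
  refine ⟨S, ⟨?_, fun G => ?_⟩, ?_, rfl⟩
  · have h1 : S.Faithful := ⟨fun {c c'} φ φ' h => Comma.hom_ext _ _
      (congrArg (fun θ => θ.app ⟨false⟩) h) (congrArg (fun θ => θ.app ⟨true⟩) h)⟩
    have h2 : S.Full := ⟨fun {c c'} θ => ⟨
      { left := θ.app ⟨false⟩
        right := θ.app ⟨true⟩
        w := by
          have h := θ.naturality (X := ⟨false⟩) (Y := ⟨true⟩) ()
          exact (congrArg (θ.app ⟨false⟩ ≫ ·) (isoFunctor_map_hom (A := A) c'.hom)).symm.trans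
            (h.symm.trans (congrArg (· ≫ θ.app ⟨true⟩) (isoFunctor_map_hom (A := A) c.hom))) }, by
      ext ⟨d⟩
      cases d <;> rfl⟩⟩
    have h3 : S.EssSurj := ⟨fun G => ⟨⟨_, _, G.map (X := ⟨false⟩) (Y := ⟨true⟩) ()⟩,
      ⟨eqToIso (isoFunctor_map G)⟩⟩⟩
    have : S.IsEquivalence := {}
    exact this
  · exact ⟨⟨_, _, G.map (X := ⟨false⟩) (Y := ⟨true⟩) ()⟩, isoFunctor_map G⟩
  · refine CategoryTheory.Functor.hext (fun a => isoFunctor_id a) fun a b α => ?_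
    refine natTrans_heq (isoFunctor_id a) (isoFunctor_id b) ?_
    rintro ⟨_ | _⟩ <;> rfl

end CategoryTheory.Grpd

namespace Cxt

open TypeTheory CategoryTheory.PathCategory

variable {T : TypeTheory.{u}} {Φ Ψ X Y X' Y' : Cxt T} {s : List (Expr T.sig)}

/-! ### The context of paths which start in the image of a map -/

theorem toList_path_eq_append (Φ : Cxt T) : ((pathCategory T).P Φ).toList =
    (idVar Φ.toList ++ trename (· + Φ.len) Φ.toList) ++ Φ.toList := by
  simp [toList_path, pathCxt]

theorem proj_path (Φ : Cxt T) : proj (toList_path_eq_append Φ) = (pathCategory T).s Φ := by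
  rw [← sub_isSub_source]
  refine sub_eq_sub fun i hi => congrArg _ ?_
  simp only [List.length_append, length_idVar, length_trename, len]
  omega

/-- The second endpoint and the path form one dependent context over the first endpoint, and
substituting `f(x)` for that endpoint gives `Id(f)`. In this form it is a base change of the source
projection of the path object. -/
theorem idMor_eq (hs : s.length = Ψ.len) : idMor Φ.toList Ψ.toList s =
    tsubst (push s var) (idVar Ψ.toList ++ trename (· + Ψ.len) Ψ.toList) ++ Φ.toList := by
  have e : (fun i => push s (var : ℕ → Expr T.sig) (i + Ψ.len)) = var :=
    funext fun i => push_add' hs _ i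
  rw [tsubst_append, tsubst_trename, e, tsubst_var, length_trename, idMor, idAt, List.append_assoc]
  refine congrArg (· ++ _) (tsubst_congr (tscoped_idVar Ψ) fun i hi => ?_)
  simp only [List.length_append, length_trename] at hi
  rw [push_vars]
  simp only [up]
  split_ifs with h
  · rw [Nat.zero_add]
  · have h' : i - Ψ.toList.length < s.length := by simp only [len] at hs; omega
    rw [push_lt (by simpa using h'), push_lt h', List.getElem_map]

theorem wf_idMor (hs : T.IsElem Φ.toList s Ψ.toList) :
    T.Derives (idMor Φ.toList Ψ.toList s) .ctx := by
  rw [idMor_eq hs.1]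
  exact wf_tsubst (toList_path_eq_append Ψ) hs.2

/-- The context `Id(f)` of a context morphism `f`. -/
def mappingSpace (hs : T.IsElem Φ.toList s Ψ.toList) : Cxt T := ⟨_, wf_idMor hs⟩

theorem toList_mappingSpace (hs : T.IsElem Φ.toList s Ψ.toList) : (mappingSpace hs).toList =
    tsubst (push s var) (idVar Ψ.toList ++ trename (· + Ψ.len) Ψ.toList) ++ Φ.toList :=
  idMor_eq hs.1

/-- The morphism `(f(x), y, u)`. -/
def mappingSpacePath (hs : T.IsElem Φ.toList s Ψ.toList) :
    mappingSpace hs ⟶ (pathCategory T).P Ψ :=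
  sub _ (isSub_up (toList_path_eq_append Ψ) (toList_mappingSpace hs) hs.2)

/-- The universal property through which `Id(f)` enters the abstract argument. -/
theorem isPullback_mappingSpace (hs : T.IsElem Φ.toList s Ψ.toList) :
    IsPullback (mappingSpacePath hs) (proj (toList_mappingSpace hs)) ((pathCategory T).s Ψ)
      (sub _ hs.2) := by
  rw [← proj_path]
  exact isPullback_up _ _ _ _

theorem isElem_onePath_append (hs : T.IsElem Φ.toList s Ψ.toList) :
    T.IsElem Φ.toList (onePath Ψ.toList s ++ s) (tsubst var
      (tsubst (push s var) (idVar Ψ.toList ++ trename (· + Ψ.len) Ψ.toList))) := by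
  obtain ⟨h, -⟩ := isElem_onePath hs
  have h' := isSub_path hs hs h
  rw [toList_path_eq_append, isSub_append, ← push_append] at h'
  rw [tsubst_var]
  refine isElem_tsubst_iff.2 ⟨?_, h'.1⟩
  have h1 := h.1
  have h2 := hs.1
  simp only [length_idAt] at h1
  simp [h1, h2]

/-- The morphism `(x, f(x), 1)`. -/
def toMappingSpace (hs : T.IsElem Φ.toList s Ψ.toList) : Φ ⟶ mappingSpace hs :=
  sub _ (isSub_push (toList_mappingSpace hs) (IsSub.var Φ.wf) (isElem_onePath_append hs))

theorem toMappingSpace_proj (hs : T.IsElem Φ.toList s Ψ.toList) :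
    toMappingSpace hs ≫ proj (toList_mappingSpace hs) = 𝟙 Φ := by
  rw [id_eq_sub]
  exact sub_push_comp_proj _ _ (isElem_onePath_append hs)

theorem toMappingSpace_path (hs : T.IsElem Φ.toList s Ψ.toList) :
    toMappingSpace hs ≫ mappingSpacePath hs = sub _ hs.2 ≫ (pathCategory T).r Ψ := by
  obtain ⟨h, h'⟩ := isElem_onePath hs
  rw [← h']
  refine (sub_comp_sub _ _).trans (sub_eq_sub fun i _ => ?_)
  rw [up_subst_push_var (by simpa using (isElem_onePath_append hs).1), push_append]

theorem represents_toMappingSpace (hs : T.IsElem Φ.toList s Ψ.toList) :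
    Represents (toMappingSpace hs) (iMor Φ.toList Ψ.toList s) := by
  have h1 := (isElem_onePath_append hs).1
  simp only [length_tsubst, List.length_append, length_idVar, length_trename] at h1
  have hl : (iMor Φ.toList Ψ.toList s).length = (mappingSpace hs).len := by
    rw [len, toList_mappingSpace]
    simp only [iMor, length_tsubst, List.length_append, length_idVar, length_trename, length_vars]
    omega
  have e : ∀ i < (mappingSpace hs).len, push (onePath Ψ.toList s ++ s) var i =
      push (iMor Φ.toList Ψ.toList s) var i := by
    intro i hi
    rw [iMor, ← List.append_assoc, push_append (_ ++ _)]
    by_cases h : i < (onePath Ψ.toList s ++ s).length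
    · exact push_congr h _ _
    · obtain ⟨j, rfl⟩ := Nat.exists_eq_add_of_le' (not_lt.1 h)
      rw [push_add, push_add, push_vars, if_pos, Nat.zero_add]
      simp only [iMor, List.length_append, length_vars] at hl hi ⊢
      omega
  exact represents_iff.2 ⟨hl, (isSub_push (toList_mappingSpace hs) (IsSub.var Φ.wf)
    (isElem_onePath_append hs)).congr (mappingSpace hs).wf e, sub_eq_sub e⟩

theorem represents_mappingSpacePath_t (hs : T.IsElem Φ.toList s Ψ.toList) :
    Represents (mappingSpacePath hs ≫ (pathCategory T).t Ψ) (pMor Ψ.toList) := by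
  have h := isSub_up (toList_path_eq_append Ψ) (toList_mappingSpace hs) hs.2
  have e : ∀ i < Ψ.len, (Expr.var (Ψ.len + i)).subst (up (idVar Ψ.toList ++
      trename (· + Ψ.len) Ψ.toList).length (push s var)) = push (pMor Ψ.toList) var i := by
    intro i hi
    rw [Expr.subst, up_lt (by simp; omega), pMor, push_vars, if_pos hi]
  rw [← sub_isSub_target, mappingSpacePath, sub_comp_sub]
  exact represents_iff.2 ⟨length_vars _ _, ((isSub_target Ψ).comp h (mappingSpace hs).wf).congr Ψ.wf e,
    sub_eq_sub e⟩

/-- The mapping space as a mapping path space. -/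
noncomputable def mappingPath (hs : T.IsElem Φ.toList s Ψ.toList) :
    (pathCategory T).MappingPath (sub _ hs.2 : Φ ⟶ Ψ) (mappingSpace hs) :=
  .ofIsPullback (isPullback_mappingSpace hs) (toMappingSpace_proj hs) (toMappingSpace_path hs)

/-! ### Definitionally equal contexts -/

/-- The variables of either context are an element of the other. -/
def Conv (Γ Δ : Cxt T) : Prop :=
  Γ.len = Δ.len ∧ T.IsSub Γ.toList var Δ.toList ∧ T.IsSub Δ.toList var Γ.toList

theorem equivalence_conv : Equivalence (Conv (T := T)) where
  refl Γ := ⟨rfl, IsSub.var Γ.wf, IsSub.var Γ.wf⟩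
  symm h := ⟨h.1.symm, h.2.2, h.2.1⟩
  trans {Γ _ Ξ} h h' := ⟨h.1.trans h'.1, h'.2.1.comp h.2.1 Γ.wf, h.2.2.comp h'.2.2 Ξ.wf⟩

/-- The type equalities are given over the tails of `Γ`. They become usable over `Δ` by change of
context, which needs the substitution in the other direction, so both are proved together. -/
theorem isSub_var_of_eqType : ∀ {Γ Δ : List (Expr T.sig)}, T.Derives Γ .ctx → T.Derives Δ .ctx →
    Γ.length = Δ.length → (∀ (i : ℕ) (A B : Expr T.sig), Γ[i]? = some A → Δ[i]? = some B →
      T.Derives (Γ.drop (i + 1)) (.eqType A B)) → T.IsSub Γ var Δ ∧ T.IsSub Δ var Γ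
  | [], [], _, _, _, _ => ⟨isSub_nil _ _, isSub_nil _ _⟩
  | A :: Γ, B :: Δ, hΓ, hΔ, hl, h => by
    obtain ⟨h1, h2⟩ := isSub_var_of_eqType hΓ.tail hΔ.tail (by simpa using hl)
      fun i A' B' hA hB => by simpa using h (i + 1) A' B' (by simpa using hA) (by simpa using hB)
    have hAB : T.Derives Γ (.eqType A B) := by simpa using h 0 A B rfl rfl
    have hBA : T.Derives Δ (.eqType A B) := hAB.conv_ctx h2 hΔ.tail
    have h3 : T.IsSub (A :: Γ) var (A :: Δ) :=
      h1.up_var hΓ.tail (Ψ := [A]) (.cons hΔ.tail hBA.eqType_left)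
    have h4 : T.IsSub (B :: Δ) var (B :: Γ) :=
      h2.up_var hΔ.tail (Ψ := [B]) (.cons hΓ.tail hAB.eqType_right)
    exact ⟨(IsSub.var_cons hBA.symmType).comp h3 hΓ, (IsSub.var_cons hAB).comp h4 hΔ⟩

theorem DefEq.conv {Γ Δ : Cxt T} (h : DefEq Γ Δ) : Conv Γ Δ :=
  ⟨h.1, isSub_var_of_eqType Γ.wf Δ.wf h.1 h.2⟩

/-- A context and its chosen representative are a priori linked only by a chain of definitional
equalities. As `Conv` is an equivalence relation containing them, the chain collapses. -/
theorem conv_out (Φ : Cxt T) : Conv Φ (Quot.out Φ.cls) := by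
  have h : Relation.EqvGen DefEq (Quot.out Φ.cls) Φ :=
    Quot.eqvGen_exact (Quot.out_eq Φ.cls)
  have h' := equivalence_conv.eqvGen_iff.1 (h.mono fun _ _ => DefEq.conv)
  exact equivalence_conv.symm h'

/-- The isomorphism of definitionally equal contexts. -/
def Conv.iso {Γ Δ : Cxt T} (h : Conv Γ Δ) : Γ ≅ Δ where
  hom := sub var h.2.1
  inv := sub var h.2.2
  hom_inv_id := by rw [sub_comp_sub, id_eq_sub]; rfl
  inv_hom_id := by rw [sub_comp_sub, id_eq_sub]; rfl

/-- The connecting isomorphisms are given by the variables themselves, so the same sequence of terms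
represents the map between any representatives. -/
theorem Represents.conv {f : X ⟶ Y} (hf : Represents f s) (hX : Conv X X') (hY : Conv Y Y') :
    Represents (hX.iso.inv ≫ f ≫ hY.iso.hom) s := by
  obtain ⟨hl, h, rfl⟩ := represents_iff.1 hf
  have e : ∀ i, ((var i : Expr T.sig).subst (push s var)).subst var = push s var i :=
    fun i => Expr.subst_var _
  have h' : T.IsSub X'.toList (push s var) Y'.toList :=
    ((hY.2.1.comp h X.wf).comp hX.2.2 X'.wf).congr Y'.wf fun i _ => e i
  refine represents_iff.2 ⟨hl.trans hY.1, h', ?_⟩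
  change sub _ hX.2.2 ≫ sub _ h ≫ sub _ hY.2.1 = _
  rw [sub_comp_sub, sub_comp_sub]
  exact sub_eq_sub fun i _ => e i

/-! ### Factorisations in the classifying category -/

/-- The mapping path object is built from the literal contexts `Φ`, `Ψ` and the sequence `s`, then
transported to the chosen representatives. It is returned together with the factorisation because
the comparison functor needs its retraction and lifting. -/
theorem exists_idFactorisation (f : Φ.cls ⟶ Ψ.cls) (hf : ClassifyingCategory.Represents f s) :
    ∃ (I : IdFactorisation f s) (M : (pathCategory T).MappingPath f.hom (Quot.out I.obj)),
      I.i.hom = M.i ∧ I.p.hom = M.p := by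
  let α := (conv_out Φ).iso
  let β := (conv_out Ψ).iso
  obtain ⟨hs, hf'⟩ := Represents.conv hf (equivalence_conv.symm (conv_out Φ))
    (equivalence_conv.symm (conv_out Ψ))
  have hs' : T.IsElem Φ.toList s Ψ.toList := hs
  have hf'' : α.hom ≫ f.hom ≫ β.inv = sub _ hs'.2 := hf'.trans (mk_eq_sub _)
  let ε := (conv_out (mappingSpace hs')).iso
  let M := (mappingPath hs').transport α β ε (f' := f.hom) (by simp [← hf''])
  refine ⟨⟨(mappingSpace hs').cls, ⟨M.i⟩, ⟨M.p⟩, ⟨wf_idMor hs', rfl⟩,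
    (represents_toMappingSpace hs').conv _ _, (represents_mappingSpacePath_t hs').conv _ _,
    InducedCategory.hom_ext M.i_p⟩, M, rfl, rfl⟩

theorem represents_id (Φ : Cxt T) : ClassifyingCategory.Represents (𝟙 Φ.cls) (vars Φ.len 0) := by
  rw [(conv_out Φ).1]
  exact ⟨isElem_vars_zero _, rfl⟩

theorem exists_toPath (f : Φ.cls ⟶ Ψ.cls) (hf : ClassifyingCategory.Represents f s) :
    ∃ (I : IdFactorisation f s) (σ : (fundamentalGroupoidFunctor T).functor.obj I.obj ⟶
      Grpd.path ((fundamentalGroupoidFunctor T).functor.map f)),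
        Grpd.SurjectiveEquivalence σ ∧
        (fundamentalGroupoidFunctor T).functor.map I.i ≫ σ =
          Grpd.iPath ((fundamentalGroupoidFunctor T).functor.map f) ∧
        σ ≫ Grpd.pPath ((fundamentalGroupoidFunctor T).functor.map f) =
          (fundamentalGroupoidFunctor T).functor.map I.p := by
  obtain ⟨I, M, hi, hp⟩ := exists_idFactorisation f hf
  refine ⟨I, toPath M, surjectiveEquivalence_toPath M, ?_, ?_⟩
  · change (fundamentalGroupoidFunctor T).onCxt.map I.i.hom ≫ toPath M = _
    rw [hi]
    exact map_toPath M
  · change _ = (fundamentalGroupoidFunctor T).onCxt.map I.p.hom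
    rw [hp]
    exact toPath_pPath M

end Cxt

theorem mainTheorem6 (T : TypeTheory.{u}) :
    ∃ F : FundamentalGroupoidFunctor T,
      (∀ (Φ Ψ : Cxt T) (f : Φ.cls ⟶ Ψ.cls) (s : List (Expr T.sig)),
        ClassifyingCategory.Represents f s →
          ∃ (I : IdFactorisation f s) (σ : F.functor.obj I.obj ⟶ Grpd.path (F.functor.map f)),
            Grpd.SurjectiveEquivalence σ ∧
            F.functor.map I.i ≫ σ = Grpd.iPath (F.functor.map f) ∧
            σ ≫ Grpd.pPath (F.functor.map f) = F.functor.map I.p) ∧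
      (∀ Φ : Cxt T,
        ∃ (I : IdFactorisation (𝟙 Φ.cls) (vars Φ.len 0))
          (σ : F.functor.obj I.obj ⟶ Grpd.powJ (F.functor.obj Φ.cls)),
            Grpd.SurjectiveEquivalence σ ∧
            F.functor.map I.i ≫ σ = Grpd.constJ (F.functor.obj Φ.cls) ∧
            σ ≫ Grpd.targetJ (F.functor.obj Φ.cls) = F.functor.map I.p) := by
  refine ⟨Cxt.fundamentalGroupoidFunctor T, fun _ _ f _ hf => Cxt.exists_toPath f hf, fun Φ => ?_⟩
  obtain ⟨I, σ, h1, h2, h3⟩ := Cxt.exists_toPath (𝟙 Φ.cls) (Cxt.represents_id Φ)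
  obtain ⟨ψ, g1, g2, g3⟩ := Grpd.exists_powJ
    ((Cxt.fundamentalGroupoidFunctor T).functor.map_id Φ.cls)
  refine ⟨I, σ ≫ ψ, h1.comp g1, ?_, ?_⟩
  · rw [← Category.assoc, h2, g2]
  · rw [Category.assoc, g3, h3]
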